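/- Let $d\ge2$ and let $\Gamma=(V,\mathcal E)$ be a connected, locally finite $\mathbb Z^d$-periodic graph (loops and multiple edges allowed): $\mathbb Z^d$ acts on $\Gamma$, freely on $V$, and the fundamental graph $\Gamma_*=\Gamma/\mathbb Z^d=(V_*,\mathcal E_*)$ is finite. Let $\mathcal A_*$ be the set of oriented edges of $\Gamma_*$ (two for each unoriented edge), $\nu=\#V_*$, $\varkappa_v$ the degree of $v\in V_*$ (loops counted twice), $\varkappa=\sum_{v\in V_*}\varkappa_v$. Fix a fundamental vertex set $V_0$, i.e. a set of representatives of $V$ modulo $\mathbb Z^d$, so that each $v\in V$ is uniquely $v=v_0+[v]$ with $v_0\in V_0$, $[v]\in\mathbb Z^d$. The index of an oriented edge $\mathbf e=(u,v)$ is $\tau(\mathbf e)=[v]-[u]$; it depends only on the class of $\mathbf e$ in $\mathcal A_*$. Orient each edge in $\mathcal E_*$ in an arbitrary way; the set $\mathcal B_*$ of bridges consists of the edges in $\mathcal E_*$ with nonzero index. For $\vartheta\in\mathbb R^d$ let $\Delta(\vartheta)$ be the $\nu\times\nu$ Floquet matrix of the normalized discrete Laplacian, $$\Delta_{uv}(\vartheta)=\delta_{uv}-\frac1{\sqrt{\varkappa_u\varkappa_v}}\sum_{\mathbf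 e=(u,v)\in\mathcal A_*}e^{i\langle\tau(\mathbf e),\vartheta\rangle},\qquad u,v\in V_* .$$ Let $r$ be the number (with multiplicity) of its flat bands, i.e. of eigenvalues common to all $\Delta(\vartheta)$. Label the eigenvalues of $\Delta(\vartheta)$ as $\lambda_1(\vartheta)\le\dots\le\lambda_{\nu-r}(\vartheta)$ (those that remain after removing the flat ones) and $\lambda_n$, $\nu-r<n\le\nu$ (the flat ones). Let $\Delta_M(\vartheta)$ be the Floquet operator of the Laplacian on the equilateral metric graph (edges of length $1$): it acts in $L^2(\Gamma_*)=\bigoplus_{\mathbf e\in\mathcal E_*}L^2(0,1)$ by $(y_{\mathbf e})\mapsto(-y_{\mathbf e}'')$ on those $y$ with all $y_{\mathbf e}\in H^2(0,1)$ for which there is $Y:V_*\to\mathbb C$ with $y_{\mathbf e}(0)=Y(u)$, $y_{\mathbf e}(1)=e^{i\langle\tau(\mathbf e),\vartheta\rangle}Y(v)$ for each $\mathbf e=(u,v)\in\mathcal E_*$, and $$\sum_{\mathbf e=(v,\cdot)\in\mathcal E_*}y_{\mathbf e}'(0)-\sum_{\mathbf e=(\cdot,v)\in\mathcal E_*}e^{-i\langle\tau(\mathbf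 e),\vartheta\rangle}y_{\mathbf e}'(1)=0,\qquad v\in V_* .$$ For $1\le n\le\nu$ and $j=0,1,2,\dots$ its band functions are $E_{n,j}=z_{n,j}^2$, where $z_n=\arccos(1-\lambda_n)\in[0,\pi]$, $z_{n,j}=z_n+\pi j$ for even $j$ and $z_{n,j}=(\pi-z_n)+\pi j$ for odd $j$. For every $\vartheta$ and every real $E\notin\{(\pi k)^2:k\in\mathbb Z\setminus\{0\}\}$, the dimension of the eigenspace of $\Delta_M(\vartheta)$ at $E$ is finite and equals the number of pairs $(n,j)$ with $E_{n,j}(\vartheta)=E$. For a real function $F$ on $\mathbb R^d$ the effective form at $\vartheta_0$ is $\mu(\omega)=\frac12\frac{d^2}{d\varepsilon^2}F(\vartheta_0+\varepsilon\omega)\big|_{\varepsilon=0}$, $\omega\in\mathbb S^{d-1}$. We say that it exists if $\varepsilon\mapsto F(\vartheta_0+\varepsilon\omega)$ is $C^2$ near $0$ for each $\omega$ and $F(\vartheta)=F(\vartheta_0)+\varepsilon^2\mu(\omega)+O(\varepsilon^3)$ as $\vartheta=\vartheta_0+\varepsilon\omega$, $\varepsilon=|\vartheta-\vartheta_0|\to0$.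 Denote by $\mu_n$ and $\mu_{n,j}$ the effective forms of $\lambda_n$ and $E_{n,j}$. (i) Let $1\le n\le\nu-r$, $j\ge0$, and let $E_{n,j}$ have a (local) minimum or maximum at $\vartheta_0$, where $E_{n,j}(\vartheta_0)\ne(\pi k)^2$ for all $k\in\mathbb Z$ and $E_{n,j}(\vartheta_0)$ is a simple eigenvalue of $\Delta_M(\vartheta_0)$. Then the effective forms $\mu_n$ and $\mu_{n,j}$ at $\vartheta_0$ exist, and $$\mu_{n,j}(\omega)=\frac{2\sqrt{E_{n,j}(\vartheta_0)}}{\sin\sqrt{E_{n,j}(\vartheta_0)}}\,\mu_n(\omega)\qquad\text{for all }\omega\in\mathbb S^{d-1}.$$ (ii) At the beginning of the spectrum, i.e. at $\vartheta_0=0$ for $\lambda_1$ and $E_{1,0}$, the effective forms $\mu=\mu_1$ and $\mu_{1,0}$ exist, $\mu_{1,0}$ is the restriction to $\mathbb S^{d-1}$ of a positive definite quadratic form (it is non-degenerate), and for all $\omega\in\mathbb S^{d-1}$ $$\mu_{1,0}(\omega)=2\mu(\omega)\le\frac2{\varkappa}\sum_{\mathbf e\in\mathcal B_*}\langle\tau(\mathbf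 e),\omega\rangle^2\le\frac{2\Lambda_1}{\varkappa},$$ where $\Lambda_1$ is the largest eigenvalue of $\mathcal T_1^*\mathcal T_1$ and $\mathcal T_1$ is the matrix whose rows are the indices of all bridges in $\mathcal B_*$. There are $d$ bridges in $\mathcal B_*$ with linearly independent indices. If moreover $V_0$ is the vertex set of a subtree of $\Gamma$, then for any such $d$ bridges $$0<\frac{2\Lambda_0}{\varkappa\,\nu\,d}\le\mu_{1,0}(\omega)\qquad\text{for all }\omega\in\mathbb S^{d-1},$$ where $\Lambda_0$ is the smallest eigenvalue of $\mathcal T_0^*\mathcal T_0$ and $\mathcal T_0$ is the $d\times d$ matrix whose rows are the indices of these $d$ bridges. -/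

import Mathlib

open scoped BigOperators

noncomputable section

/-- A connected locally finite `ℤ^d`-periodic graph with vertex set `V` and set of oriented edges
`A`; loops and multiple edges are allowed.  Each unoriented edge corresponds to the two oriented
edges `a` and `inv a` (so a loop also gives two oriented edges). -/
structure PeriodicGraph (d : ℕ) (V A : Type*)
    [AddAction (Fin d → ℤ) V] [AddAction (Fin d → ℤ) A] where
  /-- initial vertex of an oriented edge -/
  src : A → V
  /-- terminal vertex of an oriented edge -/
  tgt : A → V
  /-- the same edge with the opposite orientation -/
  inv : A → A
  inv_inv : ∀ a, inv (inv a) = a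
  inv_ne : ∀ a, inv a ≠ a
  src_inv : ∀ a, src (inv a) = tgt a
  src_vadd : ∀ (m : Fin d → ℤ) (a : A), src (m +ᵥ a) = m +ᵥ src a
  tgt_vadd : ∀ (m : Fin d → ℤ) (a : A), tgt (m +ᵥ a) = m +ᵥ tgt a
  inv_vadd : ∀ (m : Fin d → ℤ) (a : A), inv (m +ᵥ a) = m +ᵥ inv a
  /-- the action on vertices is free -/
  free : ∀ (m : Fin d → ℤ) (v : V), m +ᵥ v = v → m = 0
  nonempty : Nonempty V
  connected : ∀ u v : V, Relation.ReflTransGen (fun x y => ∃ a, src a = x ∧ tgt a = y) u v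
  locallyFinite : ∀ v : V, {a : A | src a = v}.Finite
  finite_vertices : Finite (AddAction.orbitRel.Quotient (Fin d → ℤ) V)
  finite_edges : Finite (AddAction.orbitRel.Quotient (Fin d → ℤ) A)

namespace PeriodicGraph

variable {d : ℕ} {V A : Type*} [AddAction (Fin d → ℤ) V] [AddAction (Fin d → ℤ) A]

/-- The underlying simple graph (loops dropped, parallel edges identified). -/
def toSimpleGraph (G : PeriodicGraph d V A) : SimpleGraph V where
  Adj u v := u ≠ v ∧ ∃ a, G.src a = u ∧ G.tgt a = v
  symm := ⟨by
    rintro u v ⟨h, a, rfl, rfl⟩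
    exact ⟨h.symm, G.inv a, G.src_inv a, by rw [← G.src_inv, G.inv_inv]⟩⟩
  loopless := ⟨fun _ h => h.1 rfl⟩

/-! ### The fundamental graph -/

/-- Vertices `V_* = V / ℤ^d` of the fundamental graph. -/
def FundVertex (_G : PeriodicGraph d V A) : Type _ :=
  AddAction.orbitRel.Quotient (Fin d → ℤ) V

/-- Oriented edges `A_* = A / ℤ^d` of the fundamental graph. -/
def FundEdge (_G : PeriodicGraph d V A) : Type _ :=
  AddAction.orbitRel.Quotient (Fin d → ℤ) A

instance (G : PeriodicGraph d V A) : Fintype G.FundVertex :=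
  @Fintype.ofFinite _ G.finite_vertices

instance (G : PeriodicGraph d V A) : Fintype G.FundEdge :=
  @Fintype.ofFinite _ G.finite_edges

instance (G : PeriodicGraph d V A) : DecidableEq G.FundVertex := Classical.decEq _

instance (G : PeriodicGraph d V A) : DecidableEq G.FundEdge := Classical.decEq _

/-- Initial vertex on the fundamental graph. -/
def fsrc (G : PeriodicGraph d V A) : G.FundEdge → G.FundVertex :=
  Quotient.map' G.src (by
    rintro a b ⟨m, rfl⟩
    exact ⟨m, (G.src_vadd m b).symm⟩)

/-- Terminal vertex on the fundamental graph. -/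
def ftgt (G : PeriodicGraph d V A) : G.FundEdge → G.FundVertex :=
  Quotient.map' G.tgt (by
    rintro a b ⟨m, rfl⟩
    exact ⟨m, (G.tgt_vadd m b).symm⟩)

/-- Reversal of oriented edges on the fundamental graph. -/
def finv (G : PeriodicGraph d V A) : G.FundEdge → G.FundEdge :=
  Quotient.map' G.inv (by
    rintro a b ⟨m, rfl⟩
    exact ⟨m, (G.inv_vadd m b).symm⟩)

/-- The degree `ϰ_v` of a vertex of the fundamental graph (loops counted twice). -/
def deg (G : PeriodicGraph d V A) (v : G.FundVertex) : ℕ :=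
  (Finset.univ.filter fun a : G.FundEdge => G.fsrc a = v).card

/-- The sum `ϰ` of the degrees of all vertices of the fundamental graph. -/
def totalDeg (G : PeriodicGraph d V A) : ℕ := ∑ v : G.FundVertex, G.deg v

/-- The number `ν` of vertices of the fundamental graph. -/
def nu (G : PeriodicGraph d V A) : ℕ := Fintype.card G.FundVertex

/-- An orientation of the unoriented edges of the fundamental graph: exactly one of `a`, `inv a`
is chosen.  The set of chosen oriented edges stands for the set of unoriented edges. -/
structure Orientation (G : PeriodicGraph d V A) where
  carrier : Set G.FundEdge
  mem_iff : ∀ a, a ∈ carrier ↔ G.finv a ∉ carrier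

/-- A fundamental vertex set: a set of representatives of the vertices modulo `ℤ^d`. -/
structure FundamentalVertexSet (G : PeriodicGraph d V A) where
  carrier : Set V
  existsUnique : ∀ v : V, ∃! v₀ : V, v₀ ∈ carrier ∧ ∃ m : Fin d → ℤ, m +ᵥ v₀ = v

/-- `V₀` is the vertex set of a subtree of the periodic graph. -/
def FundamentalVertexSet.IsTree {G : PeriodicGraph d V A} (V₀ : G.FundamentalVertexSet) : Prop :=
  ∃ T : G.toSimpleGraph.Subgraph, T.verts = V₀.carrier ∧ T.coe.IsTree

/-- The coordinates `[v]` of a vertex: `v = v₀ + [v]` with `v₀ ∈ V₀`. -/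
def coord {G : PeriodicGraph d V A} (V₀ : G.FundamentalVertexSet) (v : V) : Fin d → ℤ :=
  (V₀.existsUnique v).exists.choose_spec.2.choose

theorem coord_spec {G : PeriodicGraph d V A} (V₀ : G.FundamentalVertexSet) (v : V) :
    ∃ v₀ ∈ V₀.carrier, coord V₀ v +ᵥ v₀ = v :=
  ⟨_, (V₀.existsUnique v).exists.choose_spec.1,
    (V₀.existsUnique v).exists.choose_spec.2.choose_spec⟩

theorem coord_eq {G : PeriodicGraph d V A} (V₀ : G.FundamentalVertexSet) {v v₀ : V}
    {m : Fin d → ℤ} (h₀ : v₀ ∈ V₀.carrier) (h : m +ᵥ v₀ = v) : coord V₀ v = m := by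
  obtain ⟨u₀, hu, hc⟩ := coord_spec V₀ v
  have e : u₀ = v₀ := (V₀.existsUnique v).unique ⟨hu, _, hc⟩ ⟨h₀, _, h⟩
  subst e
  have : (-m + coord V₀ v) +ᵥ u₀ = u₀ := by
    rw [add_vadd, hc, ← h, neg_vadd_vadd]
  have := G.free _ _ this
  exact (neg_add_eq_zero.mp this).symm

theorem coord_vadd {G : PeriodicGraph d V A} (V₀ : G.FundamentalVertexSet) (m : Fin d → ℤ)
    (v : V) : coord V₀ (m +ᵥ v) = m + coord V₀ v := by
  obtain ⟨v₀, h₀, h⟩ := coord_spec V₀ v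
  exact coord_eq V₀ h₀ (by rw [add_vadd, h])

/-- The index `τ(e) = [v] - [u]` of an oriented edge `e = (u, v)` of the fundamental graph. -/
def index {G : PeriodicGraph d V A} (V₀ : G.FundamentalVertexSet) : G.FundEdge → (Fin d → ℤ) :=
  fun e => Quotient.liftOn' e (fun a => coord V₀ (G.tgt a) - coord V₀ (G.src a)) (by
    rintro a b ⟨m, rfl⟩
    simp only [G.src_vadd, G.tgt_vadd, coord_vadd]
    abel)

/-- `⟨τ(e), x⟩` for `x ∈ ℝ^d`. -/
def pairing {G : PeriodicGraph d V A} (V₀ : G.FundamentalVertexSet) (e : G.FundEdge)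
    (x : EuclideanSpace ℝ (Fin d)) : ℝ :=
  ∑ i, (index V₀ e i : ℝ) * x i

/-- The bridges: edges with nonzero index, in the chosen orientation. -/
def bridges {G : PeriodicGraph d V A} (V₀ : G.FundamentalVertexSet) (O : G.Orientation) :
    Finset G.FundEdge :=
  open Classical in Finset.univ.filter fun e => e ∈ O.carrier ∧ index V₀ e ≠ 0

/-- The matrix whose rows are the indices of a given family of edges. -/
def indexMatrix {G : PeriodicGraph d V A} (V₀ : G.FundamentalVertexSet) {ι : Type*}
    (b : ι → G.FundEdge) : Matrix ι (Fin d) ℝ :=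
  Matrix.of fun i k => (index V₀ (b i) k : ℝ)

/-! ### The discrete Laplacian -/

/-- The Floquet matrix `Δ(θ)` of the normalized discrete Laplacian. -/
def floquet {G : PeriodicGraph d V A} (V₀ : G.FundamentalVertexSet)
    (θ : EuclideanSpace ℝ (Fin d)) : Matrix G.FundVertex G.FundVertex ℂ :=
  Matrix.of fun u v => (if u = v then 1 else 0) -
    ((1 / Real.sqrt (G.deg u * G.deg v) : ℝ) : ℂ) *
      ∑ e : G.FundEdge with G.fsrc e = u ∧ G.ftgt e = v,
        Complex.exp (Complex.I * (pairing V₀ e θ : ℝ))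

/-- The eigenvalues of the Hermitian matrix `Δ(θ)`, counted with multiplicity. -/
def eigs {G : PeriodicGraph d V A} (V₀ : G.FundamentalVertexSet)
    (θ : EuclideanSpace ℝ (Fin d)) : Multiset ℝ :=
  (floquet V₀ θ).charpoly.roots.map Complex.re

/-- The flat bands: `x` occurs as often as it is an eigenvalue of every `Δ(θ)`, with
multiplicity. -/
def flatBands {G : PeriodicGraph d V A} (V₀ : G.FundamentalVertexSet) : Multiset ℝ :=
  ∑ x ∈ (eigs V₀ 0).toFinset, Multiset.replicate (⨅ θ, (eigs V₀ θ).count x) x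

/-- The number `r` of flat bands. -/
def numFlat {G : PeriodicGraph d V A} (V₀ : G.FundamentalVertexSet) : ℕ :=
  Multiset.card (flatBands V₀)

/-- The band functions `λ_n(θ)`, `1 ≤ n ≤ ν`: the non-flat ones in non-decreasing order for
`n ≤ ν - r`, followed by the `r` flat ones. -/
def band {G : PeriodicGraph d V A} (V₀ : G.FundamentalVertexSet) (n : ℕ)
    (θ : EuclideanSpace ℝ (Fin d)) : ℝ :=
  ((eigs V₀ θ - flatBands V₀).sort (· ≤ ·) ++ (flatBands V₀).sort (· ≤ ·)).getD (n - 1) 0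

/-! ### The metric Laplacian -/

/-- The space `L²(Γ_*)`: an `L²(0,1)` function on each (oriented) edge of the fundamental graph. -/
abbrev MetricL2 (G : PeriodicGraph d V A) (O : G.Orientation) : Type _ :=
  O.carrier → MeasureTheory.Lp ℂ 2 (MeasureTheory.volume.restrict (Set.Icc (0 : ℝ) 1))

/-- `(y, w)` belongs to the graph of the Floquet operator `Δ_M(θ)`, that is, `y` lies in its
domain and `Δ_M(θ) y = w`.  Here `f` is the continuously differentiable representative of `y`,
`p = f'`, and `p' = -w` with `w ∈ L²`.  The functions are read on the lifts of the edges that start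
in the fundamental vertex set, and extended to the periodic graph by `f(x + m) = e^{i⟨m,θ⟩} f(x)`;
continuity and the Kirchhoff conditions on the periodic graph then read as follows. -/
def IsMetricFloquet {G : PeriodicGraph d V A} (V₀ : G.FundamentalVertexSet) (O : G.Orientation)
    (θ : EuclideanSpace ℝ (Fin d)) (y w : G.MetricL2 O) : Prop :=
  ∃ f p : O.carrier → ℝ → ℂ,
    (∀ e, y e =ᵐ[MeasureTheory.volume.restrict (Set.Icc (0 : ℝ) 1)] f e) ∧
    (∀ e, ∀ t ∈ Set.Icc (0 : ℝ) 1, HasDerivWithinAt (f e) (p e t) (Set.Icc 0 1) t) ∧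
    (∀ e, ∀ t ∈ Set.Icc (0 : ℝ) 1, p e t = p e 0 - ∫ s in (0 : ℝ)..t, w e s) ∧
    (∃ Y : G.FundVertex → ℂ, ∀ e : O.carrier, f e 0 = Y (G.fsrc e) ∧
      f e 1 = Complex.exp (Complex.I * (pairing V₀ e θ : ℝ)) * Y (G.ftgt e)) ∧
    (open Classical in ∀ v : G.FundVertex,
      (∑ e : O.carrier, if G.fsrc e = v then p e 0 else 0) -
        (∑ e : O.carrier, if G.ftgt e = v then
          Complex.exp (-(Complex.I * (pairing V₀ e θ : ℝ))) * p e 1 else 0) = 0)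

theorem intervalIntegrable_L2 (w : MeasureTheory.Lp ℂ 2
    (MeasureTheory.volume.restrict (Set.Icc (0 : ℝ) 1))) {t : ℝ} (ht : t ∈ Set.Icc (0 : ℝ) 1) :
    IntervalIntegrable (w : ℝ → ℂ) MeasureTheory.volume 0 t := by
  have h := (MeasureTheory.Lp.memLp w).integrable (by norm_num)
  rw [intervalIntegrable_iff_integrableOn_Ioc_of_le ht.1]
  exact MeasureTheory.IntegrableOn.mono_set h
    (fun s hs => ⟨hs.1.le, hs.2.trans ht.2⟩)

theorem integral_L2_congr {w w' : ℝ → ℂ}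
    (h : w =ᵐ[MeasureTheory.volume.restrict (Set.Icc (0 : ℝ) 1)] w') {t : ℝ}
    (ht : t ∈ Set.Icc (0 : ℝ) 1) : ∫ s in (0 : ℝ)..t, w s = ∫ s in (0 : ℝ)..t, w' s := by
  rw [intervalIntegral.integral_of_le ht.1, intervalIntegral.integral_of_le ht.1]
  refine MeasureTheory.integral_congr_ae (MeasureTheory.ae_restrict_of_ae_restrict_of_subset ?_ h)
  exact fun s hs => ⟨hs.1.le, hs.2.trans ht.2⟩

/-- The graph of the Floquet operator `Δ_M(θ)` as a linear subspace. -/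
def metricFloquetGraph {G : PeriodicGraph d V A} (V₀ : G.FundamentalVertexSet)
    (O : G.Orientation) (θ : EuclideanSpace ℝ (Fin d)) :
    Submodule ℂ (G.MetricL2 O × G.MetricL2 O) where
  carrier := {q | IsMetricFloquet V₀ O θ q.1 q.2}
  zero_mem' := by
    refine ⟨0, 0, fun e => MeasureTheory.Lp.coeFn_zero _ _ _, fun e t _ => ?_, fun e t ht => ?_,
      ⟨0, fun e => by simp⟩, fun v => by simp⟩
    · exact hasDerivWithinAt_const t _ (0 : ℂ)
    · have := integral_L2_congr (MeasureTheory.Lp.coeFn_zero ℂ 2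
        (MeasureTheory.volume.restrict (Set.Icc (0 : ℝ) 1))) ht
      simp only [Prod.snd_zero, Pi.zero_apply]
      rw [this]
      simp
  add_mem' := by
    rintro ⟨y, w⟩ ⟨y', w'⟩ ⟨f, p, h1, h2, h3, ⟨Y, h4⟩, h5⟩ ⟨f', p', h1', h2', h3', ⟨Y', h4'⟩, h5'⟩
    refine ⟨f + f', p + p', fun e => ?_, fun e t ht => (h2 e t ht).add (h2' e t ht),
      fun e t ht => ?_, ⟨Y + Y', fun e => ⟨?_, ?_⟩⟩, fun v => ?_⟩
    · exact (MeasureTheory.Lp.coeFn_add (y e) (y' e)).trans ((h1 e).add (h1' e))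
    · have := integral_L2_congr (MeasureTheory.Lp.coeFn_add (w e) (w' e)) ht
      simp only [Prod.mk_add_mk, Pi.add_apply] at this ⊢
      rw [this, intervalIntegral.integral_add (intervalIntegrable_L2 _ ht)
        (intervalIntegrable_L2 _ ht), h3 e t ht, h3' e t ht]
      ring
    · simp only [Pi.add_apply, (h4 e).1, (h4' e).1]
    · simp only [Pi.add_apply, (h4 e).2, (h4' e).2]
      ring
    · refine Eq.trans ?_ ((congrArg₂ (· + ·) (h5 v) (h5' v)).trans (add_zero 0))
      simp only [← Finset.sum_sub_distrib, ← Finset.sum_add_distrib]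
      refine Finset.sum_congr rfl fun e _ => ?_
      split_ifs <;> (try simp only [Pi.add_apply]) <;> ring
  smul_mem' := by
    rintro c ⟨y, w⟩ ⟨f, p, h1, h2, h3, ⟨Y, h4⟩, h5⟩
    refine ⟨c • f, c • p, fun e => ?_, fun e t ht => (h2 e t ht).const_smul c,
      fun e t ht => ?_, ⟨c • Y, fun e => ⟨?_, ?_⟩⟩, fun v => ?_⟩
    · exact (MeasureTheory.Lp.coeFn_smul c (y e)).trans ((h1 e).const_smul c)
    · have := integral_L2_congr (MeasureTheory.Lp.coeFn_smul c (w e)) ht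
      simp only [Prod.smul_mk, Pi.smul_apply] at this ⊢
      rw [this, intervalIntegral.integral_smul, h3 e t ht, smul_sub]
    · simp only [Pi.smul_apply, (h4 e).1]
    · simp only [Pi.smul_apply, (h4 e).2, smul_eq_mul]
      ring
    · refine Eq.trans ?_ ((congrArg (c * ·) (h5 v)).trans (mul_zero c))
      simp only [← Finset.sum_sub_distrib, Finset.mul_sum]
      refine Finset.sum_congr rfl fun e _ => ?_
      split_ifs <;> (try simp only [Pi.smul_apply, smul_eq_mul]) <;> ring

/-- The eigenspace `{y : Δ_M(θ) y = E y}` of the Floquet operator `Δ_M(θ)`. -/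
def metricEigenspace {G : PeriodicGraph d V A} (V₀ : G.FundamentalVertexSet)
    (O : G.Orientation) (θ : EuclideanSpace ℝ (Fin d)) (E : ℝ) :
    Submodule ℂ (G.MetricL2 O) :=
  (metricFloquetGraph V₀ O θ).comap
    (LinearMap.prod LinearMap.id ((E : ℂ) • LinearMap.id))

/-- `E` is a simple eigenvalue of `Δ_M(θ)`. -/
def IsSimpleMetricEigenvalue {G : PeriodicGraph d V A} (V₀ : G.FundamentalVertexSet)
    (O : G.Orientation) (θ : EuclideanSpace ℝ (Fin d)) (E : ℝ) : Prop :=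
  Module.finrank ℂ (metricEigenspace V₀ O θ E) = 1

/-- `z_{n,j}(θ)`, where `z_n(θ) = arccos (1 - λ_n(θ))`. -/
def metricZ {G : PeriodicGraph d V A} (V₀ : G.FundamentalVertexSet) (n j : ℕ)
    (θ : EuclideanSpace ℝ (Fin d)) : ℝ :=
  if Even j then Real.arccos (1 - band V₀ n θ) + Real.pi * j
  else (Real.pi - Real.arccos (1 - band V₀ n θ)) + Real.pi * j

/-- The band functions `E_{n,j}(θ) = z_{n,j}(θ)²` of the metric Laplacian. -/
def metricBand {G : PeriodicGraph d V A} (V₀ : G.FundamentalVertexSet) (n j : ℕ)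
    (θ : EuclideanSpace ℝ (Fin d)) : ℝ :=
  metricZ V₀ n j θ ^ 2

end PeriodicGraph

/-! ### Effective forms -/

/-- The effective form `μ(ω) = ½ ∂²/∂ε² F(θ₀ + εω) |_{ε = 0}`. -/
def effectiveForm {d : ℕ} (F : EuclideanSpace ℝ (Fin d) → ℝ) (θ₀ ω : EuclideanSpace ℝ (Fin d)) :
    ℝ :=
  1 / 2 * iteratedDeriv 2 (fun ε : ℝ => F (θ₀ + ε • ω)) 0

/-- The effective form of `F` at `θ₀` is well defined: `F` is twice continuously differentiable
at `θ₀` in all directions, and `F(θ) = F(θ₀) + ε² μ(ω) + O(ε³)` as `θ = θ₀ + εω`,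
`ε = |θ - θ₀| → 0`. -/
def HasEffectiveForm {d : ℕ} (F : EuclideanSpace ℝ (Fin d) → ℝ)
    (θ₀ : EuclideanSpace ℝ (Fin d)) : Prop :=
  (∀ ω : EuclideanSpace ℝ (Fin d), ContDiffAt ℝ 2 (fun ε : ℝ => F (θ₀ + ε • ω)) 0) ∧
  (fun θ => F θ - (F θ₀ + ‖θ - θ₀‖ ^ 2 * effectiveForm F θ₀ (‖θ - θ₀‖⁻¹ • (θ - θ₀))))
    =O[nhds θ₀] (fun θ => ‖θ - θ₀‖ ^ 3)

end

open Filter Topology Asymptotics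

/-! ### Effective forms of analytic functions -/

section EffectiveForm

variable {d : ℕ} {F g : EuclideanSpace ℝ (Fin d) → ℝ} {θ₀ : EuclideanSpace ℝ (Fin d)}

/-! Away from the Dirichlet values (πk)², k ≠ 0, a metric eigenfunction is determined by its vertex
values, and the Kirchhoff conditions turn into the discrete eigenvalue equation with λ = 1 - cos √E,
read as 1 - cosh √(-E) for E < 0 (`map_metricExtension`, `finrank_metricEigenspace`). So
multiplicities agree, and E_{n,j} is an explicit function of λ_n.

The ordered non-flat λ_n are continuous in θ (`continuous_getD_sort`, `continuous_band`), hence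
analytic by the implicit function theorem wherever they are simple (`analyticAt_band`). At a
critical point of an analytic function the effective form exists, and composition with a function of
one variable multiplies it by the derivative of that function (`HasEffectiveForm.comp`). This
derivative is 2√E / sin √E in part (i). At the bottom arccos is singular, but arccos(1 - λ)² extends
analytically across λ = 0 with derivative 2 (`exists_analyticAt_arccos_sq`).

At θ = 0 connectedness makes λ_1 = 0 simple and not flat. The upper bound is the Rayleigh quotient
of the constant function (`effectiveForm_band_one_le`). For lower bounds, lift an eigenfunction to a
Bloch function on the periodic graph. Its differences along edges are controlled by the energy,
while translation by m multiplies it by a phase at distance about ε|⟨m,ω⟩| from 1. Since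
eigenfunctions for small eigenvalues have almost constant modulus, λ_1(εω) is bounded below by a
multiple of ε²Σ⟨m,ω⟩² (`sum_sq_le_effectiveForm`). Translations along the coordinate axes give
positivity. The indices of d independent bridges give the explicit constant: if V₀ spans a tree, a
bridge closes a cycle of at most ν edges, and Cauchy–Schwarz costs the factor ν
(`norm_bloch_index_sub_sq_le`). The two bounds together force the bridge indices to span ℝ^d. -/

theorem Filter.EventuallyEq.comp_line (h : F =ᶠ[𝓝 θ₀] g) (ω : EuclideanSpace ℝ (Fin d)) :
    (fun ε : ℝ => F (θ₀ + ε • ω)) =ᶠ[𝓝 0] fun ε : ℝ => g (θ₀ + ε • ω) := by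
  have hc : Tendsto (fun ε : ℝ => θ₀ + ε • ω) (𝓝 0) (𝓝 θ₀) := by
    have : Continuous fun ε : ℝ => θ₀ + ε • ω := by fun_prop
    simpa using this.tendsto 0
  exact hc.eventually h

theorem effectiveForm_congr (h : F =ᶠ[𝓝 θ₀] g) (ω : EuclideanSpace ℝ (Fin d)) :
    effectiveForm F θ₀ ω = effectiveForm g θ₀ ω := by
  unfold effectiveForm
  rw [(h.comp_line ω).iteratedDeriv_eq]

/-- The effective form of an analytic function is half of its second derivative. -/
theorem AnalyticAt.effectiveForm_eq (hF : AnalyticAt ℝ F θ₀) (ω : EuclideanSpace ℝ (Fin d)) :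
    effectiveForm F θ₀ ω = 1 / 2 * fderiv ℝ (fderiv ℝ F) θ₀ ω ω := by
  unfold effectiveForm
  congr 1
  have hline : ∀ ε : ℝ, HasDerivAt (fun ε : ℝ => θ₀ + ε • ω) ω ε := fun ε => by
    simpa using ((hasDerivAt_id ε).smul_const ω).const_add θ₀
  have hc : Tendsto (fun ε : ℝ => θ₀ + ε • ω) (𝓝 0) (𝓝 θ₀) := by
    simpa using (hline 0).continuousAt.tendsto
  have h1 : (deriv fun ε : ℝ => F (θ₀ + ε • ω)) =ᶠ[𝓝 0]
      fun ε : ℝ => fderiv ℝ F (θ₀ + ε • ω) ω := by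
    filter_upwards [hc.eventually hF.eventually_analyticAt] with ε hε
    exact (hε.differentiableAt.hasFDerivAt.comp_hasDerivAt ε (hline ε)).deriv
  rw [iteratedDeriv_succ, iteratedDeriv_one, h1.deriv_eq]
  have h2 : HasFDerivAt (fderiv ℝ F) (fderiv ℝ (fderiv ℝ F) θ₀) (θ₀ + (0 : ℝ) • ω) := by
    simpa using hF.fderiv.differentiableAt.hasFDerivAt
  have h3 : HasDerivAt (fun ε : ℝ => fderiv ℝ F (θ₀ + ε • ω)) (fderiv ℝ (fderiv ℝ F) θ₀ ω) 0 :=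
    h2.comp_hasDerivAt (0 : ℝ) (hline 0)
  exact ((ContinuousLinearMap.apply ℝ ℝ ω).hasFDerivAt.comp_hasDerivAt (0 : ℝ) h3).deriv

/-- The Taylor polynomial of degree two has no linear term at a critical point, and the remainder of
the power series is cubic. -/
theorem AnalyticAt.hasEffectiveForm (hF : AnalyticAt ℝ F θ₀) (h0 : fderiv ℝ F θ₀ = 0) :
    HasEffectiveForm F θ₀ := by
  refine ⟨fun ω => ?_, ?_⟩
  · have h1 : ContDiffAt ℝ 2 F (θ₀ + (0 : ℝ) • ω) := by simpa using hF.contDiffAt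
    exact h1.comp (f := fun ε : ℝ => θ₀ + ε • ω) 0 (by fun_prop)
  · obtain ⟨p, r, hp⟩ := hF
    have hb := hp.hasFPowerSeriesAt.isBigO_sub_partialSum_pow 3
    have hb' := hb.comp_tendsto (k := fun θ => θ - θ₀) (l' := 𝓝 θ₀) (by
      have : Continuous fun θ : EuclideanSpace ℝ (Fin d) => θ - θ₀ := by fun_prop
      simpa using this.tendsto θ₀)
    refine hb'.congr (fun θ => ?_) fun θ => rfl
    have e0 : p 0 (fun _ => θ - θ₀) = F θ₀ := hp.coeff_zero _
    have e1 : p 1 (fun _ => θ - θ₀) = 0 := by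
      have := hp.factorial_smul (θ - θ₀) 1
      rw [iteratedFDeriv_one_apply, h0] at this
      simpa using this
    have e2 : p 2 (fun _ => θ - θ₀) = 1 / 2 * fderiv ℝ (fderiv ℝ F) θ₀ (θ - θ₀) (θ - θ₀) := by
      have := hp.factorial_smul (θ - θ₀) 2
      rw [iteratedFDeriv_two_apply] at this
      simp only [Nat.factorial, nsmul_eq_mul] at this
      rw [← this]
      push_cast
      ring
    simp only [Function.comp_apply, FormalMultilinearSeries.partialSum, Finset.sum_range_succ,
      Finset.range_zero, Finset.sum_empty, e0, e1, e2, add_sub_cancel]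
    rw [hp.analyticAt.effectiveForm_eq]
    -- At the centre the normalized direction is the default value 0. Elsewhere homogeneity of
    -- degree two absorbs the factor ‖θ - θ₀‖².
    by_cases hθ : θ - θ₀ = 0
    · simp [hθ]
    · have hn : ‖θ - θ₀‖ ≠ 0 := norm_ne_zero_iff.mpr hθ
      simp only [map_smul, smul_apply, smul_eq_mul]
      field_simp
      ring

theorem hasEffectiveForm_congr (h : F =ᶠ[𝓝 θ₀] g) (hg : HasEffectiveForm g θ₀) :
    HasEffectiveForm F θ₀ := by
  refine ⟨fun ω => (hg.1 ω).congr_of_eventuallyEq (h.comp_line ω), ?_⟩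
  refine hg.2.congr' ?_ EventuallyEq.rfl
  filter_upwards [h] with θ hθ
  rw [hθ, h.eq_of_nhds, effectiveForm_congr h]

/-- This one-sided limit of quotients is the form in which all identities and inequalities between
effective forms are proved: inequalities between band functions pass to the limit. -/
theorem HasEffectiveForm.tendsto (hF : HasEffectiveForm F θ₀) {ω : EuclideanSpace ℝ (Fin d)}
    (hω : ‖ω‖ = 1) :
    Tendsto (fun ε : ℝ => (F (θ₀ + ε • ω) - F θ₀) / ε ^ 2) (𝓝[>] 0)
      (𝓝 (effectiveForm F θ₀ ω)) := by
  have hc : Tendsto (fun ε : ℝ => θ₀ + ε • ω) (𝓝[>] 0) (𝓝 θ₀) := by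
    have : Continuous fun ε : ℝ => θ₀ + ε • ω := by fun_prop
    simpa using (this.tendsto 0).mono_left nhdsWithin_le_nhds
  have hb := hF.2.comp_tendsto hc
  have h0 : Tendsto (fun ε : ℝ => (F (θ₀ + ε • ω) - F θ₀) / ε ^ 2 - effectiveForm F θ₀ ω)
      (𝓝[>] 0) (𝓝 0) := by
    have h1 : (fun ε : ℝ => (F (θ₀ + ε • ω) - F θ₀) / ε ^ 2 - effectiveForm F θ₀ ω)
        =O[𝓝[>] 0] fun ε : ℝ => ε := by
      obtain ⟨C, hC⟩ := hb.bound
      refine IsBigO.of_bound C ?_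
      filter_upwards [hC, self_mem_nhdsWithin] with ε hε hpos
      have hpos : 0 < ε := hpos
      have hn : ‖θ₀ + ε • ω - θ₀‖ = ε := by simp [norm_smul, hω, abs_of_pos hpos]
      have hd : ‖θ₀ + ε • ω - θ₀‖⁻¹ • (θ₀ + ε • ω - θ₀) = ω := by
        rw [hn, add_sub_cancel_left, smul_smul, inv_mul_cancel₀ hpos.ne', one_smul]
      simp only [Function.comp_apply] at hε
      rw [hd, hn] at hε
      have : (F (θ₀ + ε • ω) - F θ₀) / ε ^ 2 - effectiveForm F θ₀ ω =
          (F (θ₀ + ε • ω) - (F θ₀ + ε ^ 2 * effectiveForm F θ₀ ω)) / ε ^ 2 := by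
        field_simp
        ring
      rw [this, norm_div, div_le_iff₀ (norm_pos_iff.mpr (pow_ne_zero 2 hpos.ne'))]
      refine hε.trans (le_of_eq ?_)
      simp only [norm_pow]
      ring
    exact h1.trans_tendsto (tendsto_id.mono_left nhdsWithin_le_nhds)
  simpa using h0.add_const (effectiveForm F θ₀ ω)

/-- At a critical point, composition with a function of one variable multiplies the effective form
by the derivative of that function. -/
theorem HasEffectiveForm.comp {φ : ℝ → ℝ} {c : ℝ} (hg : HasEffectiveForm g θ₀)
    (hφ : HasEffectiveForm (fun θ => φ (g θ)) θ₀) {s : Set ℝ}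
    (hd : HasDerivWithinAt φ c s (g θ₀)) (hs : ∀ θ, g θ ∈ s)
    {ω : EuclideanSpace ℝ (Fin d)} (hω : ‖ω‖ = 1) :
    effectiveForm (fun θ => φ (g θ)) θ₀ ω = c * effectiveForm g θ₀ ω := by
  refine tendsto_nhds_unique (hφ.tendsto hω) ?_
  have hlim := hg.tendsto hω
  have hcont : Tendsto (fun ε : ℝ => g (θ₀ + ε • ω)) (𝓝[>] 0) (𝓝[s] (g θ₀)) := by
    refine tendsto_nhdsWithin_iff.mpr ⟨?_, Eventually.of_forall fun ε => hs _⟩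
    have := (hg.1 ω).continuousAt.tendsto.mono_left (nhdsWithin_le_nhds (s := Set.Ioi 0))
    simpa using this
  have ho := (hasDerivWithinAt_iff_isLittleO.mp hd).comp_tendsto hcont
  -- The increment of `g` is O(ε²), so the error o(g - g θ₀) of the linearization of `φ` is o(ε²),
  -- and first-order information on `φ` suffices.
  have hO : ((fun x => x - g θ₀) ∘ fun ε : ℝ => g (θ₀ + ε • ω)) =O[𝓝[>] 0] fun ε : ℝ => ε ^ 2 := by
    refine (isBigO_of_div_tendsto_nhds ?_ _ hlim)
    filter_upwards [self_mem_nhdsWithin] with ε hε h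
    exact absurd h (pow_ne_zero 2 (ne_of_gt hε))
  have hq := (ho.trans_isBigO hO).tendsto_div_nhds_zero
  have := hq.add (hlim.const_mul c)
  rw [zero_add] at this
  refine this.congr' ?_
  filter_upwards with ε
  simp only [Function.comp_apply, smul_eq_mul]
  ring

end EffectiveForm

/-! ### The function `arccos (1 - x) ^ 2` near `0` -/

/-- The function `x ↦ arccos (1 - x) ^ 2` on `[0, ∞)` is near `0` the restriction of an analytic
function. -/
theorem exists_analyticAt_arccos_sq : ∃ h : ℝ → ℝ, AnalyticAt ℝ h 0 ∧ HasDerivAt h 2 0 ∧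
    ∀ᶠ x in 𝓝 (0 : ℝ), 0 ≤ x → Real.arccos (1 - x) ^ 2 = h x := by
  -- These are the coefficients of the entire function with value cos z at w = z². The function
  -- sought is the local inverse of w ↦ 1 - cos √w, whose derivative at 0 is 1/2.
  let c : ℕ → ℝ := fun n => (-1) ^ n / (2 * n).factorial
  let p := FormalMultilinearSeries.ofScalars ℝ c
  have hr : p.radius = ⊤ := by
    refine FormalMultilinearSeries.ofScalars_radius_eq_top_of_tendsto ℝ c
      (Eventually.of_forall fun n => ?_) ?_
    · exact div_ne_zero (pow_ne_zero _ (by norm_num)) (by positivity)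
    · have hle : ∀ n : ℕ, ‖c n.succ‖ / ‖c n‖ ≤ 1 / ((n : ℝ) + 1) := fun n => by
        have e : 2 * n.succ = 2 * n + 1 + 1 := by simp [Nat.succ_eq_add_one]; ring
        simp only [c, norm_div, norm_pow, norm_neg, norm_one, one_pow, RCLike.norm_natCast]
        rw [e, Nat.factorial_succ, Nat.factorial_succ]
        have hf : (0 : ℝ) < (2 * n).factorial := by positivity
        push_cast
        rw [div_div_div_eq, div_le_div_iff₀ (by positivity) (by positivity)]
        have : (0 : ℝ) ≤ n := by positivity
        nlinarith [mul_nonneg this hf.le, mul_nonneg (mul_nonneg this this) hf.le]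
      exact squeeze_zero (fun n => by positivity) hle tendsto_one_div_add_atTop_nhds_zero_nat
  have hp : HasFPowerSeriesOnBall p.sum p 0 ⊤ := by
    have := p.hasFPowerSeriesOnBall (by rw [hr]; exact ENNReal.zero_lt_top)
    rwa [hr] at this
  have hsum : ∀ z : ℝ, p.sum (z ^ 2) = Real.cos z := fun z => by
    have h1 : p.sum (z ^ 2) = ∑' n, c n • (z ^ 2) ^ n :=
      FormalMultilinearSeries.ofScalars_sum_eq c (z ^ 2)
    rw [h1, ← (Real.hasSum_cos z).tsum_eq]
    refine tsum_congr fun n => ?_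
    simp only [c, smul_eq_mul, pow_mul]
    ring
  let C : ℝ → ℝ := fun w => 1 - p.sum w
  have hC : AnalyticAt ℝ C 0 := analyticAt_const.sub hp.analyticAt
  have hC' : HasDerivAt C (1 / 2) 0 := by
    have h1 := hp.hasFPowerSeriesAt.hasDerivAt
    have h2 : p 1 (fun _ => (1 : ℝ)) = -1 / 2 := by
      simp only [p, FormalMultilinearSeries.ofScalars_apply_eq, c]
      norm_num [Nat.factorial]
    rw [h2] at h1
    have h3 := h1.const_sub 1
    rwa [show -(-1 / 2 : ℝ) = 1 / 2 by norm_num] at h3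
  have hC0 : C 0 = 0 := by
    have := hsum 0
    simp only [ne_eq, OfNat.ofNat_ne_zero, not_false_eq_true, zero_pow, Real.cos_zero] at this
    simp [C, this]
  -- The exponent `⊤` of `WithTop ℕ∞` means analyticity, so the inverse function theorem yields an
  -- analytic inverse.
  have hcd : ContDiffAt ℝ ⊤ C 0 := hC.contDiffAt
  let e : ℝ ≃L[ℝ] ℝ := ContinuousLinearEquiv.unitsEquivAut ℝ (Units.mk0 (1 / 2) (by norm_num))
  have hf' : HasFDerivAt C (e : ℝ →L[ℝ] ℝ) 0 := by
    have he : (e : ℝ →L[ℝ] ℝ) = ContinuousLinearMap.toSpanSingleton ℝ (1 / 2) := by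
      ext
      simp [e]
    rw [he]
    exact hC'.hasFDerivAt
  let h := hcd.localInverse hf' (by simp)
  have hh : AnalyticAt ℝ h 0 := by
    have := hcd.to_localInverse hf' (by simp)
    rw [hC0] at this
    exact this.analyticAt
  have hinv : ∀ᶠ w in 𝓝 (0 : ℝ), h (C w) = w :=
    (hcd.hasStrictFDerivAt' hf' (by simp)).eventually_left_inverse
  have key : ∀ᶠ x in 𝓝 (0 : ℝ), 0 ≤ x → Real.arccos (1 - x) ^ 2 = h x := by
    have ht : Tendsto (fun x : ℝ => Real.arccos (1 - x) ^ 2) (𝓝 0) (𝓝 0) := by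
      have : Continuous fun x : ℝ => Real.arccos (1 - x) ^ 2 :=
        (Real.continuous_arccos.comp (continuous_const.sub continuous_id)).pow 2
      simpa using this.tendsto 0
    filter_upwards [ht.eventually hinv, eventually_le_nhds (show (0 : ℝ) < 2 by norm_num)]
      with x hx hx2 hx0
    rw [← hx]
    congr 1
    simp only [C, hsum]
    rw [Real.cos_arccos (by linarith) (by linarith)]
    ring
  refine ⟨h, hh, ?_, key⟩
  have hd := hh.differentiableAt.hasDerivAt
  have h1 : HasDerivAt (h ∘ C) (deriv h 0 * (1 / 2)) 0 := by
    refine HasDerivAt.comp 0 ?_ hC'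
    rwa [hC0]
  have h2 : HasDerivAt (h ∘ C) 1 0 := (hasDerivAt_id 0).congr_of_eventuallyEq hinv
  have := h1.unique h2
  rwa [show deriv h 0 = 2 by linarith] at hd

/-! ### Hermitian matrices -/

namespace Matrix.IsHermitian

variable {𝕜 n : Type*} [RCLike 𝕜] [Fintype n] [DecidableEq n] {A : Matrix n n 𝕜}

theorem sub_smul_one_eq (hA : A.IsHermitian) (μ : ℝ) :
    A - (μ : 𝕜) • (1 : Matrix n n 𝕜) = (hA.eigenvectorUnitary : Matrix n n 𝕜) *
      Matrix.diagonal (fun i => ((hA.eigenvalues i - μ : ℝ) : 𝕜)) *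
      (hA.eigenvectorUnitary : Matrix n n 𝕜)ᴴ := by
  have hU : (hA.eigenvectorUnitary : Matrix n n 𝕜) *
      (hA.eigenvectorUnitary : Matrix n n 𝕜)ᴴ = 1 :=
    Unitary.mul_star_self_of_mem hA.eigenvectorUnitary.2
  have hs := hA.spectral_theorem
  rw [Unitary.conjStarAlgAut_apply] at hs
  have hd : Matrix.diagonal (fun i => ((hA.eigenvalues i - μ : ℝ) : 𝕜)) =
      Matrix.diagonal (RCLike.ofReal ∘ hA.eigenvalues) - (μ : 𝕜) • (1 : Matrix n n 𝕜) := by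
    ext i j
    by_cases h : i = j
    · subst h
      rw [Matrix.sub_apply, Matrix.smul_apply, Matrix.one_apply_eq, Matrix.diagonal_apply_eq,
        Matrix.diagonal_apply_eq, smul_eq_mul, mul_one, Function.comp_apply, RCLike.ofReal_sub]
    · simp [h]
  rw [hd, mul_sub, sub_mul, mul_smul_comm, mul_one, smul_mul_assoc, hU]
  conv_lhs => rw [hs]
  rfl

/-- The dimension of an eigenspace of a Hermitian matrix is the multiplicity of the eigenvalue as a
root of the characteristic polynomial. -/
theorem finrank_ker_sub_smul_one (hA : A.IsHermitian) (μ : ℝ) :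
    Module.finrank 𝕜 (LinearMap.ker (A - (μ : 𝕜) • (1 : Matrix n n 𝕜)).mulVecLin) =
      (A.charpoly.roots.map RCLike.re).count μ := by
  classical
  have hdet : IsUnit (hA.eigenvectorUnitary : Matrix n n 𝕜).det :=
    Matrix.UnitaryGroup.det_isUnit hA.eigenvectorUnitary
  have hrank : (A - (μ : 𝕜) • (1 : Matrix n n 𝕜)).rank =
      Fintype.card {i // hA.eigenvalues i ≠ μ} := by
    rw [hA.sub_smul_one_eq μ, Matrix.rank_mul_eq_left_of_isUnit_det _ _ (by
      rw [Matrix.det_conjTranspose]; exact hdet.star),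
      Matrix.rank_mul_eq_right_of_isUnit_det _ _ hdet, Matrix.rank_diagonal]
    refine Fintype.card_congr (Equiv.subtypeEquivRight fun i => ?_)
    rw [Ne, RCLike.ofReal_eq_zero, sub_eq_zero]
  have h1 := LinearMap.finrank_range_add_finrank_ker
    (A - (μ : 𝕜) • (1 : Matrix n n 𝕜)).mulVecLin
  rw [Module.finrank_fintype_fun_eq_card] at h1
  change (A - (μ : 𝕜) • (1 : Matrix n n 𝕜)).rank + _ = _ at h1
  rw [hrank] at h1
  have h2 := Fintype.card_subtype_compl fun i => hA.eigenvalues i = μ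
  have h3 := Fintype.card_subtype_le fun i => hA.eigenvalues i = μ
  have h4 : (A.charpoly.roots.map RCLike.re).count μ =
      Fintype.card {i // hA.eigenvalues i = μ} := by
    rw [hA.roots_charpoly_eq_eigenvalues, Multiset.map_map, Multiset.count_map,
      Fintype.card_subtype]
    simp only [Function.comp_apply, RCLike.ofReal_re, eq_comm (a := μ)]
    rfl
  simp only [ne_eq] at h1
  omega

open scoped ComplexOrder in
/-- A lower bound of the eigenvalues of a Hermitian matrix is a lower bound of its Rayleigh
quotient. -/
theorem le_re_dotProduct_mulVec (hA : A.IsHermitian) {m : ℝ}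
    (hm : ∀ x ∈ A.charpoly.roots.map RCLike.re, m ≤ x) (x : n → 𝕜) :
    m * ∑ i, ‖x i‖ ^ 2 ≤ RCLike.re (star x ⬝ᵥ A *ᵥ x) := by
  have hm' : ∀ i, m ≤ hA.eigenvalues i := fun i => hm _ (by
    rw [hA.roots_charpoly_eq_eigenvalues, Multiset.map_map]
    exact Multiset.mem_map.mpr ⟨i, Finset.mem_univ_val i, by simp⟩)
  have hp : (A - (m : 𝕜) • (1 : Matrix n n 𝕜)).PosSemidef := by
    rw [hA.sub_smul_one_eq m]
    refine Matrix.PosSemidef.mul_mul_conjTranspose_same ?_ _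
    rw [Matrix.posSemidef_diagonal_iff]
    exact fun i => by exact_mod_cast sub_nonneg.mpr (hm' i)
  have h := hp.re_dotProduct_nonneg x
  rw [Matrix.sub_mulVec, dotProduct_sub, Matrix.smul_mulVec, Matrix.one_mulVec, dotProduct_smul,
    map_sub, sub_nonneg, smul_eq_mul, RCLike.re_ofReal_mul] at h
  refine le_trans (le_of_eq ?_) h
  congr 1
  simp only [dotProduct, Pi.star_apply, map_sum]
  refine Finset.sum_congr rfl fun i _ => ?_
  rw [RCLike.star_def, RCLike.conj_mul]
  norm_cast

theorem eigenvalue_mem_spectrum (hA : A.IsHermitian) {x : ℝ}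
    (hx : x ∈ A.charpoly.roots.map RCLike.re) : x ∈ spectrum ℝ A := by
  rw [hA.roots_charpoly_eq_eigenvalues, Multiset.map_map] at hx
  obtain ⟨i, -, rfl⟩ := Multiset.mem_map.mp hx
  simpa using hA.eigenvalues_mem_spectrum_real i

end Matrix.IsHermitian

/-! ### Continuity of the ordered roots -/

theorem Monotone.eq_of_prod_sub_eq {m : ℕ} {Λ Λ' : Fin m → ℝ} (h : Monotone Λ)
    (h' : Monotone Λ') {Z : Set ℝ} (hZ : Z.Finite)
    (he : ∀ t ∉ Z, ∏ i, (t - Λ i) = ∏ i, (t - Λ' i)) : Λ = Λ' := by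
  let P : (Fin m → ℝ) → Polynomial ℝ := fun Λ =>
    ((Multiset.ofList (List.ofFn Λ)).map fun a => Polynomial.X - Polynomial.C a).prod
  have hP : ∀ (Λ : Fin m → ℝ) (t : ℝ), (P Λ).eval t = ∏ i, (t - Λ i) := fun Λ t => by
    simp only [P, Multiset.map_coe, Multiset.prod_coe, List.map_ofFn, List.prod_ofFn,
      Function.comp_apply, Polynomial.eval_prod, Polynomial.eval_sub, Polynomial.eval_X,
      Polynomial.eval_C]
  have hPP : P Λ = P Λ' := by
    refine Polynomial.eq_of_infinite_eval_eq _ _ (hZ.infinite_compl.mono fun t ht => ?_)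
    rw [Set.mem_ofPred_eq, hP, hP, he t ht]
  have hr := congrArg Polynomial.roots hPP
  simp only [P, Polynomial.roots_multiset_prod_X_sub_C] at hr
  have := List.Perm.eq_of_sortedLE h.sortedLE_ofFn h'.sortedLE_ofFn (Multiset.coe_eq_coe.mp hr)
  exact List.ofFn_injective this

/-- The ordered roots of a family of real-rooted monic polynomials depend continuously on the
parameter. -/
theorem continuous_getD_sort {X : Type*} [TopologicalSpace X] {S : X → Multiset ℝ} {m : ℕ}
    (hcard : ∀ x, (S x).card = m) {a b : ℝ} (hab : ∀ x, ∀ s ∈ S x, s ∈ Set.Icc a b)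
    {Z : Set ℝ} (hZ : Z.Finite)
    (hcont : ∀ t ∉ Z, Continuous fun x => ((S x).map fun s => t - s).prod) {n : ℕ} (hn : n < m) :
    Continuous fun x => ((S x).sort (· ≤ ·)).getD n 0 := by
  let K : Set (Fin m → ℝ) := {Λ | Monotone Λ} ∩ Set.pi Set.univ fun _ => Set.Icc a b
  have hK : IsCompact K := (isCompact_univ_pi fun _ => isCompact_Icc).inter_left isClosed_monotone
  have : CompactSpace K := isCompact_iff_compactSpace.mp hK
  let Φ : K → ({t // t ∉ Z} → ℝ) := fun Λ t => ∏ i, ((t : ℝ) - (Λ : Fin m → ℝ) i)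
  -- A continuous injection of a compact space into a Hausdorff space is an embedding. Continuity of
  -- the polynomial values at all t outside `Z` can therefore be pulled back to continuity of the
  -- ordered roots.
  have hΦ : IsClosedEmbedding Φ := by
    refine Continuous.isClosedEmbedding ?_ ?_
    · refine continuous_pi fun t => continuous_finsetProd _ fun i _ => ?_
      exact continuous_const.sub ((continuous_apply i).comp continuous_subtype_val)
    · rintro ⟨Λ, hΛ⟩ ⟨Λ', hΛ'⟩ h
      refine Subtype.ext (Monotone.eq_of_prod_sub_eq hΛ.1 hΛ'.1 hZ fun t ht => ?_)
      exact congrFun h ⟨t, ht⟩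
  have hlen : ∀ x, ((S x).sort (· ≤ ·)).length = m := fun x => by
    rw [Multiset.length_sort, hcard]
  let L : X → Fin m → ℝ := fun x i => ((S x).sort (· ≤ ·)).get (i.cast (hlen x).symm)
  have hL : ∀ x, List.ofFn (L x) = (S x).sort (· ≤ ·) := fun x => by
    refine List.ext_get (by simp [hlen]) fun i h1 h2 => ?_
    simp [L]
  have hLK : ∀ x, L x ∈ K := fun x => by
    refine ⟨fun i j hij => ?_, fun i _ => ?_⟩
    · have hp := (S x).pairwise_sort (· ≤ ·)
      rcases hij.eq_or_lt with rfl | hlt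
      · exact le_rfl
      · exact List.pairwise_iff_get.mp hp _ _ (by simpa using hlt)
    · exact hab x _ ((Multiset.mem_sort (r := (· ≤ ·))).mp (List.get_mem _ _))
  have hcL : Continuous fun x => (⟨L x, hLK x⟩ : K) := by
    rw [hΦ.isEmbedding.continuous_iff]
    refine continuous_pi fun t => ?_
    convert! hcont t t.2 using 2 with x
    simp only [Φ, Function.comp_apply]
    rw [← List.prod_ofFn]
    conv_rhs => rw [← Multiset.sort_eq (S x) (· ≤ ·), ← hL x]
    rw [Multiset.map_coe, Multiset.prod_coe, List.map_ofFn]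
    rfl
  have := (continuous_apply (⟨n, hn⟩ : Fin m)).comp (continuous_subtype_val.comp hcL)
  convert! this using 2 with x
  simp [L, hlen, hn]

/-- A continuous function that solves an analytic equation with nonvanishing partial derivative is
analytic. -/
theorem ContinuousAt.analyticAt_of_implicit {E : Type*} [NormedAddCommGroup E] [NormedSpace ℝ E]
    [CompleteSpace E] {f : E × ℝ → ℝ} {g : E → ℝ} {x₀ : E} (hg : ContinuousAt g x₀)
    (hf : ContDiffAt ℝ ⊤ f (x₀, g x₀)) (hz : ∀ x, f (x, g x) = 0) {c : ℝ} (hc : c ≠ 0)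
    (hd : HasDerivAt (fun t => f (x₀, t)) c (g x₀)) : AnalyticAt ℝ g x₀ := by
  have hinv : (fderiv ℝ f (x₀, g x₀) ∘L .inr ℝ E ℝ).IsInvertible := by
    refine ⟨ContinuousLinearEquiv.unitsEquivAut ℝ (Units.mk0 c hc), ?_⟩
    have h1 : HasFDerivAt f (fderiv ℝ f (x₀, g x₀)) (x₀, g x₀) :=
      (hf.differentiableAt (by simp)).hasFDerivAt
    have h2 : HasDerivAt (fun t : ℝ => (x₀, t)) ((0 : E), (1 : ℝ)) (g x₀) :=
      (hasDerivAt_const _ _).prodMk (hasDerivAt_id _)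
    have h3 := (h1.comp_hasDerivAt (g x₀) h2).unique hd
    ext
    simp [← h3]
  have hψ := (hf.contDiffAt_implicitFunction (by simp) hinv).analyticAt
  refine hψ.congr ?_
  have ht : Tendsto (fun x => (x, g x)) (𝓝 x₀) (𝓝 (x₀, g x₀)) :=
    (continuousAt_id.prodMk hg).tendsto
  -- Continuity of `g` keeps (x, g x) in the neighbourhood where the zero set of `f` is the graph of
  -- the implicit function.
  filter_upwards [ht.eventually (hf.eventually_apply_eq_iff_implicitFunction (by simp) hinv)]
    with x hx
  exact hx.mp (by rw [hz, hz])

/-- The derivative of a real-rooted polynomial at a simple root does not vanish. -/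
theorem Multiset.exists_hasDerivAt_prod_sub {S : Multiset ℝ} {x : ℝ} (hx : S.count x = 1) :
    ∃ c ≠ 0, HasDerivAt (fun t => (S.map fun s => t - s).prod) c x := by
  let P : Polynomial ℝ := (S.map fun a => Polynomial.X - Polynomial.C a).prod
  have hr : P.roots = S := Polynomial.roots_multiset_prod_X_sub_C S
  have hP : (fun t => (S.map fun s => t - s).prod) = fun t => P.eval t := by
    funext t
    simp [P, Polynomial.eval_multiset_prod, Multiset.map_map]
  have hP0 : P ≠ 0 := by
    intro h
    rw [h] at hr
    simp [← hr] at hx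
  refine ⟨P.derivative.eval x, fun h => ?_, by rw [hP]; exact P.hasDerivAt x⟩
  have hm : P.rootMultiplicity x = 1 := by rw [← Polynomial.count_roots, hr, hx]
  have hroot : P.IsRoot x := (Polynomial.rootMultiplicity_pos hP0).mp (by omega)
  have := (Polynomial.one_lt_rootMultiplicity_iff_isRoot hP0).mpr ⟨hroot, h⟩
  omega

namespace PeriodicGraph

variable {d : ℕ} {V A : Type*} [AddAction (Fin d → ℤ) V] [AddAction (Fin d → ℤ) A]
  {G : PeriodicGraph d V A}

/-! ### The fundamental graph -/

/-- The class of a vertex in the fundamental graph. -/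
def vclass (G : PeriodicGraph d V A) (v : V) : G.FundVertex :=
  (Quotient.mk'' v : AddAction.orbitRel.Quotient (Fin d → ℤ) V)

/-- The class of an oriented edge in the fundamental graph. -/
def eclass (G : PeriodicGraph d V A) (a : A) : G.FundEdge := Quotient.mk'' a

theorem exists_vclass (v : G.FundVertex) : ∃ x, G.vclass x = v :=
  Quotient.inductionOn' v fun x => ⟨x, rfl⟩

theorem exists_eclass (e : G.FundEdge) : ∃ a, G.eclass a = e :=
  Quotient.inductionOn' e fun a => ⟨a, rfl⟩

theorem vclass_vadd (m : Fin d → ℤ) (v : V) : G.vclass (m +ᵥ v) = G.vclass v :=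
  Quotient.sound' ⟨m, rfl⟩

theorem eclass_vadd (m : Fin d → ℤ) (a : A) : G.eclass (m +ᵥ a) = G.eclass a :=
  Quotient.sound' ⟨m, rfl⟩

theorem vclass_eq_iff {u v : V} : G.vclass u = G.vclass v ↔ ∃ m : Fin d → ℤ, m +ᵥ v = u :=
  Quotient.eq''

theorem fsrc_eclass (a : A) : G.fsrc (G.eclass a) = G.vclass (G.src a) := rfl

theorem ftgt_eclass (a : A) : G.ftgt (G.eclass a) = G.vclass (G.tgt a) := rfl

theorem finv_eclass (a : A) : G.finv (G.eclass a) = G.eclass (G.inv a) := rfl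

theorem index_eclass (V₀ : G.FundamentalVertexSet) (a : A) :
    index V₀ (G.eclass a) = coord V₀ (G.tgt a) - coord V₀ (G.src a) := rfl

theorem tgt_inv (a : A) : G.tgt (G.inv a) = G.src a := by
  rw [← G.src_inv, G.inv_inv]

theorem fsrc_finv (e : G.FundEdge) : G.fsrc (G.finv e) = G.ftgt e := by
  obtain ⟨a, rfl⟩ := exists_eclass e
  rw [finv_eclass, fsrc_eclass, ftgt_eclass, G.src_inv]

theorem ftgt_finv (e : G.FundEdge) : G.ftgt (G.finv e) = G.fsrc e := by
  obtain ⟨a, rfl⟩ := exists_eclass e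
  rw [finv_eclass, fsrc_eclass, ftgt_eclass, tgt_inv]

theorem finv_finv (e : G.FundEdge) : G.finv (G.finv e) = e := by
  obtain ⟨a, rfl⟩ := exists_eclass e
  rw [finv_eclass, finv_eclass, G.inv_inv]

theorem index_finv (V₀ : G.FundamentalVertexSet) (e : G.FundEdge) :
    index V₀ (G.finv e) = -index V₀ e := by
  obtain ⟨a, rfl⟩ := exists_eclass e
  rw [finv_eclass, index_eclass, index_eclass, G.src_inv, tgt_inv, neg_sub]

theorem pairing_finv (V₀ : G.FundamentalVertexSet) (e : G.FundEdge)
    (θ : EuclideanSpace ℝ (Fin d)) : pairing V₀ (G.finv e) θ = -pairing V₀ e θ := by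
  simp [pairing, index_finv]

theorem pairing_smul (V₀ : G.FundamentalVertexSet) (e : G.FundEdge) (c : ℝ)
    (θ : EuclideanSpace ℝ (Fin d)) : pairing V₀ e (c • θ) = c * pairing V₀ e θ := by
  simp only [pairing, PiLp.smul_apply, smul_eq_mul, Finset.mul_sum]
  exact Finset.sum_congr rfl fun i _ => by ring

theorem pairing_zero (V₀ : G.FundamentalVertexSet) (e : G.FundEdge) :
    pairing V₀ e 0 = 0 := by
  simp [pairing]

theorem sum_finv {M : Type*} [AddCommMonoid M] (f : G.FundEdge → M) :
    ∑ e, f (G.finv e) = ∑ e, f e :=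
  Equiv.sum_comp (Function.Involutive.toPerm G.finv finv_finv) f

open Classical in
/-- A sum over oriented edges as a sum over unoriented edges. -/
theorem sum_orientation {M : Type*} [AddCommMonoid M] (O : G.Orientation) (f : G.FundEdge → M) :
    ∑ e, f e = ∑ e : O.carrier, (f e + f (G.finv e)) := by
  rw [← Finset.sum_filter_add_sum_filter_not Finset.univ (fun e => e ∈ O.carrier) f,
    Finset.sum_add_distrib]
  have h1 : ∀ g : G.FundEdge → M, ∑ e : O.carrier, g e =
      ∑ e with e ∈ O.carrier, g e := fun g =>
    (Finset.sum_subtype (Finset.univ.filter fun e => e ∈ O.carrier)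
      (fun e => by rw [Finset.mem_filter]; exact and_iff_right (Finset.mem_univ e)) g).symm
  rw [h1 f, h1 fun e => f (G.finv e)]
  congr 1
  refine Finset.sum_nbij' G.finv G.finv ?_ ?_ ?_ ?_ ?_
  · intro e he
    have := (O.mem_iff e).not.mp (by simpa using he)
    simpa using this
  · intro e he
    have := (O.mem_iff e).mp (by simpa using he)
    simpa using this
  · exact fun e _ => finv_finv e
  · exact fun e _ => finv_finv e
  · exact fun e _ => by rw [finv_finv]

theorem sum_deg_mul (f : G.FundVertex → ℝ) : ∑ v, (G.deg v : ℝ) * f v = ∑ e, f (G.fsrc e) := by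
  rw [← Finset.sum_fiberwise (s := Finset.univ) (g := G.fsrc)]
  refine Finset.sum_congr rfl fun v _ => ?_
  rw [Finset.sum_congr rfl (g := fun _ => f v) (fun e he => by rw [(Finset.mem_filter.mp he).2]),
    Finset.sum_const, nsmul_eq_mul]
  rfl

/-- A free action of a nontrivial group moves x, so a path from x to a translate must start with an
edge at x. -/
theorem deg_pos (hd : 1 ≤ d) (v : G.FundVertex) : 0 < G.deg v := by
  obtain ⟨x, rfl⟩ := exists_vclass v
  let m : Fin d → ℤ := fun _ => 1
  have hm : m +ᵥ x ≠ x := fun h => by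
    have := congrFun (G.free m x h) ⟨0, hd⟩
    simp [m] at this
  rcases Relation.ReflTransGen.cases_head (G.connected x (m +ᵥ x)) with h | ⟨y, ⟨a, ha, -⟩, -⟩
  · exact absurd h.symm hm
  · refine Finset.card_pos.mpr ⟨G.eclass a, ?_⟩
    simp [fsrc_eclass, ha]

theorem totalDeg_pos (hd : 1 ≤ d) : 0 < G.totalDeg := by
  obtain ⟨x⟩ := G.nonempty
  exact Finset.sum_pos (fun v _ => deg_pos hd v) ⟨G.vclass x, Finset.mem_univ _⟩

theorem nu_pos : 0 < G.nu := by
  obtain ⟨x⟩ := G.nonempty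
  exact Fintype.card_pos_iff.mpr ⟨G.vclass x⟩

/-! ### Phases and the hopping operator -/

/-- The phase `e^{i⟨τ(e),θ⟩}` of an oriented edge. -/
noncomputable def phase (V₀ : G.FundamentalVertexSet) (θ : EuclideanSpace ℝ (Fin d)) (e : G.FundEdge) : ℂ :=
  Complex.exp (Complex.I * (pairing V₀ e θ : ℝ))

theorem phase_finv (V₀ : G.FundamentalVertexSet) (θ : EuclideanSpace ℝ (Fin d))
    (e : G.FundEdge) : phase V₀ θ (G.finv e) = star (phase V₀ θ e) := by
  rw [phase, phase, RCLike.star_def, ← Complex.exp_conj, pairing_finv]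
  simp

theorem phase_finv' (V₀ : G.FundamentalVertexSet) (θ : EuclideanSpace ℝ (Fin d))
    (e : G.FundEdge) :
    phase V₀ θ (G.finv e) = Complex.exp (-(Complex.I * (pairing V₀ e θ : ℝ))) := by
  rw [phase, pairing_finv]
  simp

theorem norm_phase (V₀ : G.FundamentalVertexSet) (θ : EuclideanSpace ℝ (Fin d))
    (e : G.FundEdge) : ‖phase V₀ θ e‖ = 1 := by
  rw [phase, mul_comm, Complex.norm_exp_ofReal_mul_I]

theorem phase_finv_mul (V₀ : G.FundamentalVertexSet) (θ : EuclideanSpace ℝ (Fin d))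
    (e : G.FundEdge) : phase V₀ θ (G.finv e) * phase V₀ θ e = 1 := by
  rw [phase_finv, RCLike.star_def, Complex.conj_mul', norm_phase]
  simp

theorem phase_zero (V₀ : G.FundamentalVertexSet) (e : G.FundEdge) : phase V₀ 0 e = 1 := by
  simp [phase, pairing_zero]

/-- The hopping operator (twisted adjacency operator) of the fundamental graph. -/
noncomputable def hop (V₀ : G.FundamentalVertexSet) (θ : EuclideanSpace ℝ (Fin d)) (Y : G.FundVertex → ℂ)
    (v : G.FundVertex) : ℂ :=
  ∑ e with G.fsrc e = v, phase V₀ θ e * Y (G.ftgt e)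

/-- The functions `Y` with `A(θ) Y = κ D Y`, where `A(θ)` is the hopping operator and `D` the
degree. -/
def hopEigenspace (V₀ : G.FundamentalVertexSet) (θ : EuclideanSpace ℝ (Fin d)) (κ : ℝ) :
    Submodule ℂ (G.FundVertex → ℂ) where
  carrier := {Y | ∀ v, hop V₀ θ Y v = κ * G.deg v * Y v}
  zero_mem' := fun v => by simp [hop]
  add_mem' := fun {Y Z} hY hZ v => by
    have e : hop V₀ θ (Y + Z) v = hop V₀ θ Y v + hop V₀ θ Z v := by
      simp [hop, mul_add, Finset.sum_add_distrib]
    rw [e, hY v, hZ v, Pi.add_apply]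
    ring
  smul_mem' := fun c Y hY v => by
    have e : hop V₀ θ (c • Y) v = c * hop V₀ θ Y v := by
      simp only [hop, Pi.smul_apply, smul_eq_mul, Finset.mul_sum]
      exact Finset.sum_congr rfl fun e _ => by ring
    rw [e, hY v, Pi.smul_apply, smul_eq_mul]
    ring

theorem floquet_isHermitian (V₀ : G.FundamentalVertexSet) (θ : EuclideanSpace ℝ (Fin d)) :
    (floquet V₀ θ).IsHermitian := by
  refine Matrix.IsHermitian.ext fun u v => ?_
  simp only [floquet, Matrix.of_apply, star_sub, star_mul', star_sum]
  congr 1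
  · by_cases h : u = v
    · simp [h]
    · simp [h, Ne.symm h]
  · congr 1
    · rw [mul_comm (G.deg v : ℝ)]
      simp
    · refine Finset.sum_nbij' G.finv G.finv ?_ ?_ ?_ ?_ ?_
      · intro e he
        simpa [fsrc_finv, ftgt_finv, and_comm] using he
      · intro e he
        simpa [fsrc_finv, ftgt_finv, and_comm] using he
      · exact fun e _ => finv_finv e
      · exact fun e _ => finv_finv e
      · exact fun e _ => (phase_finv V₀ θ e).symm

theorem floquet_mulVec (hd : 1 ≤ d) (V₀ : G.FundamentalVertexSet) (θ : EuclideanSpace ℝ (Fin d))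
    (Y : G.FundVertex → ℂ) (u : G.FundVertex) :
    (floquet V₀ θ).mulVec (fun v => (Real.sqrt (G.deg v) : ℂ) * Y v) u =
      (Real.sqrt (G.deg u) : ℂ) * Y u - hop V₀ θ Y u / (Real.sqrt (G.deg u) : ℂ) := by
  have hne : ∀ v, (Real.sqrt (G.deg v) : ℂ) ≠ 0 := fun v => by
    have : (0 : ℝ) < G.deg v := by exact_mod_cast deg_pos hd v
    exact_mod_cast (Real.sqrt_pos.mpr this).ne'
  simp only [Matrix.mulVec, dotProduct, floquet, Matrix.of_apply, sub_mul, Finset.sum_sub_distrib,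
    ite_mul, one_mul, zero_mul]
  rw [Finset.sum_ite_eq Finset.univ u, if_pos (Finset.mem_univ _)]
  congr 1
  have h1 : ∀ v, ((1 / Real.sqrt (G.deg u * G.deg v) : ℝ) : ℂ) *
      (∑ e with G.fsrc e = u ∧ G.ftgt e = v, Complex.exp (Complex.I * (pairing V₀ e θ : ℝ))) *
        ((Real.sqrt (G.deg v) : ℂ) * Y v) =
      (∑ e with G.fsrc e = u ∧ G.ftgt e = v, phase V₀ θ e * Y (G.ftgt e)) /
        (Real.sqrt (G.deg u) : ℂ) := fun v => by
    have h2 : ∑ e with G.fsrc e = u ∧ G.ftgt e = v, phase V₀ θ e * Y (G.ftgt e) =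
        (∑ e with G.fsrc e = u ∧ G.ftgt e = v, phase V₀ θ e) * Y v := by
      rw [Finset.sum_mul]
      exact Finset.sum_congr rfl fun e he => by rw [(Finset.mem_filter.mp he).2.2]
    rw [h2, Real.sqrt_mul (Nat.cast_nonneg _)]
    change _ * (∑ e with G.fsrc e = u ∧ G.ftgt e = v, phase V₀ θ e) * _ = _
    have := hne u
    have := hne v
    push_cast
    field_simp
  rw [Finset.sum_congr rfl fun v _ => h1 v, ← Finset.sum_div, hop]
  congr 1
  rw [← Finset.sum_fiberwise (s := Finset.univ.filter fun e => G.fsrc e = u) (g := G.ftgt)]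
  refine Finset.sum_congr rfl fun v _ => ?_
  rw [Finset.filter_filter]

/-- The eigenvalues of the Floquet matrix in terms of the hopping operator. -/
theorem finrank_hopEigenspace (hd : 1 ≤ d) (V₀ : G.FundamentalVertexSet)
    (θ : EuclideanSpace ℝ (Fin d)) (κ : ℝ) :
    Module.finrank ℂ (hopEigenspace V₀ θ κ) = (eigs V₀ θ).count (1 - κ) := by
  have h := (floquet_isHermitian V₀ θ).finrank_ker_sub_smul_one (1 - κ)
  rw [RCLike.re_eq_complex_re] at h
  rw [eigs, ← h]
  have hsq : ∀ v : G.FundVertex, (Real.sqrt (G.deg v) : ℂ) ^ 2 = G.deg v := fun v => by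
    exact_mod_cast congrArg Complex.ofReal (Real.sq_sqrt (Nat.cast_nonneg (G.deg v)))
  have hne : ∀ v : G.FundVertex, (Real.sqrt (G.deg v) : ℂ) ≠ 0 := fun v => by
    have : (0 : ℝ) < G.deg v := by exact_mod_cast deg_pos hd v
    exact_mod_cast (Real.sqrt_pos.mpr this).ne'
  -- With hopping operator A and degrees D, the Floquet matrix is 1 - D^{-1/2} A D^{-1/2}, so
  -- multiplication by D^{1/2} carries solutions of AY = κDY to its eigenvectors for 1 - κ.
  let T : (G.FundVertex → ℂ) ≃ₗ[ℂ] (G.FundVertex → ℂ) :=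
    LinearEquiv.piCongrRight fun v => LinearEquiv.smulOfUnit (Units.mk0 _ (hne v))
  have hT : ∀ Y : G.FundVertex → ℂ, T Y = fun v => (Real.sqrt (G.deg v) : ℂ) * Y v :=
    fun Y => rfl
  have hmap : (LinearMap.ker (floquet V₀ θ - ((1 - κ : ℝ) : ℂ) •
      (1 : Matrix G.FundVertex G.FundVertex ℂ)).mulVecLin).comap (T : _ →ₗ[ℂ] _) =
        hopEigenspace V₀ θ κ := by
    ext Y
    rw [Submodule.mem_comap, LinearMap.mem_ker, Matrix.mulVecLin_apply, funext_iff]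
    refine forall_congr' fun v => ?_
    rw [LinearEquiv.coe_coe, hT, Matrix.sub_mulVec, Matrix.smul_mulVec, Matrix.one_mulVec,
      Pi.sub_apply, Pi.smul_apply, floquet_mulVec hd, smul_eq_mul, Pi.zero_apply]
    have h1 := hne v
    rw [← hsq v]
    push_cast
    constructor
    · intro h2
      field_simp at h2
      linear_combination -h2
    · intro h2
      rw [h2]
      field_simp
      ring
  rw [← hmap, Submodule.comap_equiv_eq_map_symm]
  exact LinearEquiv.finrank_map_eq T.symm _

/-! ### Energy -/

/-- Twice the quadratic form of the Laplacian with quasimomentum `θ`. -/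
noncomputable def energy (V₀ : G.FundamentalVertexSet) (θ : EuclideanSpace ℝ (Fin d))
    (Y : G.FundVertex → ℂ) : ℝ :=
  ∑ e, ‖Y (G.fsrc e) - phase V₀ θ e * Y (G.ftgt e)‖ ^ 2

/-- The sign σ = 1 gives the energy, σ = -1 its signless analogue. Their nonnegativity places the
spectrum in [0, 2]. -/
theorem sum_norm_sub_sq (V₀ : G.FundamentalVertexSet) (θ : EuclideanSpace ℝ (Fin d))
    (Y : G.FundVertex → ℂ) {σ : ℝ} (hσ : σ ^ 2 = 1) :
    ∑ e, ‖Y (G.fsrc e) - σ * (phase V₀ θ e * Y (G.ftgt e))‖ ^ 2 =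
      2 * ∑ v, G.deg v * ‖Y v‖ ^ 2 - 2 * σ * (∑ v, star (Y v) * hop V₀ θ Y v).re := by
  have h1 : ∀ e, ‖Y (G.fsrc e) - σ * (phase V₀ θ e * Y (G.ftgt e))‖ ^ 2 =
      ‖Y (G.fsrc e)‖ ^ 2 + ‖Y (G.fsrc (G.finv e))‖ ^ 2 -
        2 * σ * (star (Y (G.fsrc e)) * (phase V₀ θ e * Y (G.ftgt e))).re := fun e => by
    rw [@norm_sub_sq ℂ, norm_mul, norm_mul, norm_phase, one_mul, mul_pow, fsrc_finv,
      Complex.norm_real, Real.norm_eq_abs, sq_abs, hσ, one_mul, RCLike.inner_apply,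
      RCLike.re_eq_complex_re, RCLike.star_def, mul_comm _ (starRingEnd ℂ (Y (G.fsrc e))),
      mul_left_comm, Complex.re_ofReal_mul]
    ring
  rw [Finset.sum_congr rfl fun e _ => h1 e, Finset.sum_sub_distrib, Finset.sum_add_distrib,
    sum_finv fun e => ‖Y (G.fsrc e)‖ ^ 2, ← Finset.mul_sum, ← Complex.re_sum,
    sum_deg_mul fun v => ‖Y v‖ ^ 2, ← two_mul]
  congr 3
  rw [← Finset.sum_fiberwise (s := Finset.univ) (g := G.fsrc)]
  refine Finset.sum_congr rfl fun v _ => ?_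
  rw [hop, Finset.mul_sum]
  exact Finset.sum_congr rfl fun e he => by rw [(Finset.mem_filter.mp he).2]

theorem re_sum_star_mul_hop {V₀ : G.FundamentalVertexSet} {θ : EuclideanSpace ℝ (Fin d)} {κ : ℝ}
    {Y : G.FundVertex → ℂ} (hY : Y ∈ hopEigenspace V₀ θ κ) :
    (∑ v, star (Y v) * hop V₀ θ Y v).re = κ * ∑ v, G.deg v * ‖Y v‖ ^ 2 := by
  rw [Complex.re_sum, Finset.mul_sum]
  refine Finset.sum_congr rfl fun v _ => ?_
  have h : star (Y v) * (κ * G.deg v * Y v) = ((κ * (G.deg v * ‖Y v‖ ^ 2) : ℝ) : ℂ) := by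
    have := Complex.conj_mul' (Y v)
    rw [RCLike.star_def]
    push_cast
    rw [← this]
    ring
  rw [hY v, h, Complex.ofReal_re]

theorem energy_of_mem_hopEigenspace {V₀ : G.FundamentalVertexSet}
    {θ : EuclideanSpace ℝ (Fin d)} {κ : ℝ} {Y : G.FundVertex → ℂ}
    (hY : Y ∈ hopEigenspace V₀ θ κ) :
    energy V₀ θ Y = 2 * (1 - κ) * ∑ v, G.deg v * ‖Y v‖ ^ 2 := by
  have h := sum_norm_sub_sq V₀ θ Y (σ := 1) (by norm_num)
  rw [re_sum_star_mul_hop hY] at h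
  simp only [Complex.ofReal_one, one_mul] at h
  rw [energy, h]
  ring

theorem energy_nonneg (V₀ : G.FundamentalVertexSet) (θ : EuclideanSpace ℝ (Fin d))
    (Y : G.FundVertex → ℂ) : 0 ≤ energy V₀ θ Y :=
  Finset.sum_nonneg fun _ _ => by positivity

theorem sum_deg_norm_sq_pos (hd : 1 ≤ d) {Y : G.FundVertex → ℂ} (hY : Y ≠ 0) :
    0 < ∑ v, G.deg v * ‖Y v‖ ^ 2 := by
  obtain ⟨v, hv⟩ := Function.ne_iff.mp hY
  refine Finset.sum_pos' (fun u _ => by positivity) ⟨v, Finset.mem_univ _, ?_⟩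
  have h1 : (0 : ℝ) < G.deg v := by exact_mod_cast deg_pos hd v
  have h2 : 0 < ‖Y v‖ := norm_pos_iff.mpr hv
  positivity

theorem exists_mem_hopEigenspace (hd : 1 ≤ d) {V₀ : G.FundamentalVertexSet}
    {θ : EuclideanSpace ℝ (Fin d)} {x : ℝ} (hx : x ∈ eigs V₀ θ) :
    ∃ Y ∈ hopEigenspace V₀ θ (1 - x), Y ≠ 0 := by
  have h := finrank_hopEigenspace hd V₀ θ (1 - x)
  rw [sub_sub_cancel] at h
  have hpos : 0 < Module.finrank ℂ (hopEigenspace V₀ θ (1 - x)) := by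
    rw [h]
    exact Multiset.count_pos.mpr hx
  have hne : hopEigenspace V₀ θ (1 - x) ≠ ⊥ := fun hb => by
    rw [hb, finrank_bot] at hpos
    exact lt_irrefl _ hpos
  exact Submodule.exists_mem_ne_zero_of_ne_bot hne

theorem eigs_mem_Icc (hd : 1 ≤ d) {V₀ : G.FundamentalVertexSet}
    {θ : EuclideanSpace ℝ (Fin d)} {x : ℝ} (hx : x ∈ eigs V₀ θ) : x ∈ Set.Icc (0 : ℝ) 2 := by
  obtain ⟨Y, hY, hY0⟩ := exists_mem_hopEigenspace hd hx
  have hp := sum_deg_norm_sq_pos hd hY0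
  constructor
  · have h1 := energy_of_mem_hopEigenspace hY
    have h2 := energy_nonneg V₀ θ Y
    rw [h1] at h2
    by_contra hneg
    nlinarith
  · have h1 := sum_norm_sub_sq V₀ θ Y (σ := -1) (by norm_num)
    rw [re_sum_star_mul_hop hY] at h1
    have h2 : 0 ≤ ∑ e, ‖Y (G.fsrc e) - ((-1 : ℝ) : ℂ) * (phase V₀ θ e * Y (G.ftgt e))‖ ^ 2 :=
      Finset.sum_nonneg fun _ _ => by positivity
    rw [h1] at h2
    by_contra hneg
    nlinarith

/-- The constant function as a test function in the Rayleigh quotient. -/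
theorem le_sum_one_sub_cos (hd : 1 ≤ d) {V₀ : G.FundamentalVertexSet}
    {θ : EuclideanSpace ℝ (Fin d)} {m : ℝ} (hm : ∀ x ∈ eigs V₀ θ, m ≤ x) :
    m * G.totalDeg ≤ ∑ e, (1 - Real.cos (pairing V₀ e θ)) := by
  have h := (floquet_isHermitian V₀ θ).le_re_dotProduct_mulVec (m := m)
    (by rw [RCLike.re_eq_complex_re]; exact hm) fun v => (Real.sqrt (G.deg v) : ℂ) * 1
  have hsq : ∀ v : G.FundVertex, Real.sqrt (G.deg v) ^ 2 = G.deg v := fun v =>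
    Real.sq_sqrt (Nat.cast_nonneg (G.deg v))
  have hne : ∀ v : G.FundVertex, (Real.sqrt (G.deg v) : ℂ) ≠ 0 := fun v => by
    have : (0 : ℝ) < G.deg v := by exact_mod_cast deg_pos hd v
    exact_mod_cast (Real.sqrt_pos.mpr this).ne'
  have h1 : ∑ v : G.FundVertex, ‖(Real.sqrt (G.deg v) : ℂ) * 1‖ ^ 2 = G.totalDeg := by
    simp only [mul_one, Complex.norm_real, Real.norm_eq_abs, sq_abs, hsq, totalDeg]
    push_cast
    rfl
  rw [h1] at h
  refine h.trans (le_of_eq ?_)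
  have h2 : ∀ v, star ((Real.sqrt (G.deg v) : ℂ) * 1) *
      (floquet V₀ θ).mulVec (fun v => (Real.sqrt (G.deg v) : ℂ) * 1) v =
      ∑ e with G.fsrc e = v, (1 - phase V₀ θ e) := fun v => by
    rw [floquet_mulVec hd V₀ θ (fun _ => 1), Finset.sum_sub_distrib, hop]
    have h3 : ((∑ e with G.fsrc e = v, 1 : ℂ)) = (Real.sqrt (G.deg v) : ℂ) ^ 2 := by
      rw [← Complex.ofReal_pow, hsq, deg]
      simp
    rw [h3]
    have := hne v
    simp only [mul_one, RCLike.star_def, Complex.conj_ofReal]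
    field_simp
  rw [dotProduct]
  simp only [Pi.star_apply]
  rw [Finset.sum_congr rfl fun v _ => h2 v, Finset.sum_fiberwise, map_sum]
  refine Finset.sum_congr rfl fun e _ => ?_
  rw [phase, mul_comm, map_sub, RCLike.re_eq_complex_re, Complex.exp_ofReal_mul_I_re,
    Complex.one_re]

/-! ### Band functions -/

theorem card_eigs (V₀ : G.FundamentalVertexSet) (θ : EuclideanSpace ℝ (Fin d)) :
    (eigs V₀ θ).card = G.nu := by
  rw [eigs, (floquet_isHermitian V₀ θ).roots_charpoly_eq_eigenvalues, Multiset.card_map,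
    Multiset.card_map]
  rfl

/-- Restricting to eigenvalues at θ = 0 loses nothing: any other number has multiplicity 0 there, so
the infimum vanishes. -/
theorem count_flatBands (V₀ : G.FundamentalVertexSet) (x : ℝ) :
    (flatBands V₀).count x = ⨅ θ, (eigs V₀ θ).count x := by
  rw [flatBands, Multiset.count_sum']
  simp only [Multiset.count_replicate]
  rw [Finset.sum_ite_eq' (eigs V₀ 0).toFinset x]
  split_ifs with h
  · rfl
  · refine (Nat.eq_zero_of_le_zero ?_).symm
    refine (ciInf_le (OrderBot.bddBelow _) 0).trans (le_of_eq ?_)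
    exact Multiset.count_eq_zero.mpr fun hx => h (Multiset.mem_toFinset.mpr hx)

theorem flatBands_le (V₀ : G.FundamentalVertexSet) (θ : EuclideanSpace ℝ (Fin d)) :
    flatBands V₀ ≤ eigs V₀ θ := by
  rw [Multiset.le_iff_count]
  intro x
  rw [count_flatBands]
  exact ciInf_le (OrderBot.bddBelow _) θ

/-- The list of the values at `θ` of all band functions. -/
noncomputable def bandList (V₀ : G.FundamentalVertexSet) (θ : EuclideanSpace ℝ (Fin d)) :
    List ℝ :=
  (eigs V₀ θ - flatBands V₀).sort (· ≤ ·) ++ (flatBands V₀).sort (· ≤ ·)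

theorem coe_bandList (V₀ : G.FundamentalVertexSet) (θ : EuclideanSpace ℝ (Fin d)) :
    (bandList V₀ θ : Multiset ℝ) = eigs V₀ θ := by
  rw [bandList, ← Multiset.coe_add, Multiset.sort_eq, Multiset.sort_eq,
    tsub_add_cancel_of_le (flatBands_le V₀ θ)]

theorem length_bandList (V₀ : G.FundamentalVertexSet) (θ : EuclideanSpace ℝ (Fin d)) :
    (bandList V₀ θ).length = G.nu := by
  rw [← Multiset.coe_card, coe_bandList, card_eigs]

theorem band_mem_eigs (V₀ : G.FundamentalVertexSet) (θ : EuclideanSpace ℝ (Fin d)) {n : ℕ}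
    (h1 : 1 ≤ n) (hn : n ≤ G.nu) : band V₀ n θ ∈ eigs V₀ θ := by
  have hlt : n - 1 < (bandList V₀ θ).length := by rw [length_bandList]; omega
  rw [← coe_bandList, Multiset.mem_coe]
  change (bandList V₀ θ).getD (n - 1) 0 ∈ _
  rw [List.getD_eq_getElem _ _ hlt]
  exact List.getElem_mem hlt

theorem band_mem_Icc (hd : 1 ≤ d) (V₀ : G.FundamentalVertexSet) (n : ℕ)
    (θ : EuclideanSpace ℝ (Fin d)) : band V₀ n θ ∈ Set.Icc (0 : ℝ) 2 := by
  change (bandList V₀ θ).getD (n - 1) 0 ∈ _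
  by_cases hlt : n - 1 < (bandList V₀ θ).length
  · rw [List.getD_eq_getElem _ _ hlt]
    refine eigs_mem_Icc hd (V₀ := V₀) (θ := θ) ?_
    rw [← coe_bandList, Multiset.mem_coe]
    exact List.getElem_mem hlt
  -- Beyond the end of the list the default value 0 still lies in [0, 2], so no bound on `n` is
  -- needed.
  · rw [List.getD_eq_default _ _ (not_lt.mp hlt)]
    exact ⟨le_rfl, by norm_num⟩

theorem card_eigs_sub (V₀ : G.FundamentalVertexSet) (θ : EuclideanSpace ℝ (Fin d)) :
    (eigs V₀ θ - flatBands V₀).card = G.nu - numFlat V₀ := by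
  rw [Multiset.card_sub (flatBands_le V₀ θ), card_eigs, numFlat]

theorem band_eq_getD_sort (V₀ : G.FundamentalVertexSet) (θ : EuclideanSpace ℝ (Fin d)) {n : ℕ}
    (h1 : 1 ≤ n) (hn : n ≤ G.nu - numFlat V₀) :
    band V₀ n θ = ((eigs V₀ θ - flatBands V₀).sort (· ≤ ·)).getD (n - 1) 0 := by
  rw [band, List.getD_append]
  rw [Multiset.length_sort, card_eigs_sub]
  omega

theorem prod_sub_eigs (V₀ : G.FundamentalVertexSet) (θ : EuclideanSpace ℝ (Fin d)) (t : ℝ) :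
    ((eigs V₀ θ).map fun s => t - s).prod =
      ((t : ℂ) • (1 : Matrix G.FundVertex G.FundVertex ℂ) - floquet V₀ θ).det.re := by
  have hH := floquet_isHermitian V₀ θ
  have h1 : ((t : ℂ) • (1 : Matrix G.FundVertex G.FundVertex ℂ) - floquet V₀ θ).det =
      (floquet V₀ θ).charpoly.eval (t : ℂ) := by
    rw [Matrix.eval_charpoly, Matrix.scalar_apply, Matrix.smul_one_eq_diagonal]
  rw [h1, hH.charpoly_eq, Polynomial.eval_prod, eigs, hH.roots_charpoly_eq_eigenvalues,
    Multiset.map_map, Multiset.map_map]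
  have h2 : ∏ i, (Polynomial.X - Polynomial.C ((hH.eigenvalues i : ℝ) : ℂ)).eval (t : ℂ) =
      ((∏ i, (t - hH.eigenvalues i) : ℝ) : ℂ) := by
    push_cast
    exact Finset.prod_congr rfl fun i _ => by simp
  refine Eq.trans ?_ (congrArg Complex.re h2.symm)
  rw [Complex.ofReal_re]
  rfl

/-- The product is the real part of a determinant whose entries are affine in t and trigonometric in
θ. The exponent `⊤` again means analyticity. -/
theorem contDiff_prod_sub_eigs (V₀ : G.FundamentalVertexSet) :
    ContDiff ℝ ⊤ fun q : EuclideanSpace ℝ (Fin d) × ℝ =>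
      ((eigs V₀ q.1).map fun s => q.2 - s).prod := by
  simp only [prod_sub_eigs, Matrix.det_apply, Units.smul_def, zsmul_eq_mul]
  refine Complex.reCLM.contDiff.comp ?_
  refine ContDiff.sum fun σ _ => ?_
  refine ContDiff.mul contDiff_const ?_
  refine contDiff_prod fun i _ => ?_
  simp only [Matrix.sub_apply, Matrix.smul_apply, floquet, Matrix.of_apply, smul_eq_mul, pairing]
  refine ContDiff.sub ?_ (ContDiff.sub contDiff_const (ContDiff.mul contDiff_const
    (ContDiff.sum fun e _ => ?_)))
  · exact (Complex.ofRealCLM.contDiff.comp contDiff_snd).mul contDiff_const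
  · have hp : ContDiff ℝ ⊤ fun q : EuclideanSpace ℝ (Fin d) × ℝ =>
        ∑ i, (index V₀ e i : ℝ) * q.1 i := by
      refine ContDiff.sum fun i _ => ContDiff.mul contDiff_const ?_
      exact ((EuclideanSpace.proj (𝕜 := ℝ) i).contDiff.comp contDiff_fst)
    exact ContDiff.cexp (contDiff_const.mul (Complex.ofRealCLM.contDiff.comp hp))

/-- The polynomial of the non-flat eigenvalues is the characteristic polynomial divided by the
constant flat factor. Division is legitimate away from the finitely many flat values, which form the
exceptional set `Z`. -/
theorem continuous_band (hd : 1 ≤ d) (V₀ : G.FundamentalVertexSet) {n : ℕ} (h1 : 1 ≤ n)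
    (hn : n ≤ G.nu - numFlat V₀) : Continuous (band V₀ n) := by
  have he : band V₀ n =
      fun θ => ((eigs V₀ θ - flatBands V₀).sort (· ≤ ·)).getD (n - 1) 0 :=
    funext fun θ => band_eq_getD_sort V₀ θ h1 hn
  rw [he]
  refine continuous_getD_sort (card_eigs_sub V₀)
    (fun θ s hs => eigs_mem_Icc hd (Multiset.mem_of_le tsub_le_self hs))
    (Z := {t | t ∈ flatBands V₀}) ?_ (fun t ht => ?_) (by omega)
  · exact (flatBands V₀).finite_toSet
  · have hne : ((flatBands V₀).map fun s => t - s).prod ≠ 0 := by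
      refine Multiset.prod_ne_zero fun h0 => ?_
      obtain ⟨s, hs, hs0⟩ := Multiset.mem_map.mp h0
      rw [sub_eq_zero] at hs0
      exact ht (hs0 ▸ hs)
    have hq : ∀ θ, ((eigs V₀ θ - flatBands V₀).map fun s => t - s).prod =
        ((eigs V₀ θ).map fun s => t - s).prod / ((flatBands V₀).map fun s => t - s).prod :=
      fun θ => by
        rw [eq_div_iff hne, ← Multiset.prod_add, ← Multiset.map_add,
          tsub_add_cancel_of_le (flatBands_le V₀ θ)]
    simp only [hq]
    have hc : Continuous fun θ : EuclideanSpace ℝ (Fin d) => (θ, t) :=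
      continuous_id.prodMk continuous_const
    exact ((contDiff_prod_sub_eigs V₀).continuous.comp hc).div_const _

/-- A band function is analytic where its value is a simple eigenvalue. -/
theorem analyticAt_band (hd : 1 ≤ d) (V₀ : G.FundamentalVertexSet) {n : ℕ} (h1 : 1 ≤ n)
    (hn : n ≤ G.nu - numFlat V₀) {θ₀ : EuclideanSpace ℝ (Fin d)}
    (hs : (eigs V₀ θ₀).count (band V₀ n θ₀) = 1) : AnalyticAt ℝ (band V₀ n) θ₀ := by
  obtain ⟨c, hc, hder⟩ := Multiset.exists_hasDerivAt_prod_sub hs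
  refine (continuous_band hd V₀ h1 hn).continuousAt.analyticAt_of_implicit
    (contDiff_prod_sub_eigs V₀).contDiffAt (fun θ => ?_) hc hder
  refine Multiset.prod_eq_zero (Multiset.mem_map.mpr ⟨band V₀ n θ, ?_, sub_self _⟩)
  exact band_mem_eigs V₀ θ h1 (by omega)

end PeriodicGraph

/-! ### The equation `-f'' = E f` on the unit interval -/

section Ode

open MeasureTheory

/-- A fundamental system of the equation `-f'' = E f`, normalized at `0`, without Dirichlet
eigenvalue `E`. -/
structure IsFundamentalSystem (E : ℝ) (c s : ℝ → ℝ) : Prop where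
  deriv_c : ∀ t, HasDerivAt c (-(E * s t)) t
  deriv_s : ∀ t, HasDerivAt s (c t) t
  c_zero : c 0 = 1
  s_zero : s 0 = 0
  s_one : s 1 ≠ 0

namespace IsFundamentalSystem

variable {E : ℝ} {c s : ℝ → ℝ}

theorem continuous_c (h : IsFundamentalSystem E c s) : Continuous c :=
  continuous_iff_continuousAt.mpr fun t => (h.deriv_c t).continuousAt

theorem continuous_s (h : IsFundamentalSystem E c s) : Continuous s :=
  continuous_iff_continuousAt.mpr fun t => (h.deriv_s t).continuousAt

theorem wronskian (h : IsFundamentalSystem E c s) (t : ℝ) : c t ^ 2 + E * s t ^ 2 = 1 := by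
  have hd : ∀ t, HasDerivAt (fun t => c t ^ 2 + E * s t ^ 2) 0 t := fun t => by
    have := ((h.deriv_c t).pow 2).add (((h.deriv_s t).pow 2).const_mul E)
    refine this.congr_deriv ?_
    push_cast
    ring
  have := is_const_of_deriv_eq_zero (fun t => (hd t).differentiableAt) (fun t => (hd t).deriv) t 0
  simpa [h.c_zero, h.s_zero] using this

theorem hasDerivAt_combination (h : IsFundamentalSystem E c s) (a b : ℂ) (t : ℝ) :
    HasDerivAt (fun t => a * c t + b * s t) (a * (-(E * s t)) + b * c t) t := by
  have h1 := (h.deriv_c t).ofReal_comp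
  have h2 := (h.deriv_s t).ofReal_comp
  push_cast at h1
  exact (h1.const_mul a).add (h2.const_mul b)

theorem hasDerivAt_combination' (h : IsFundamentalSystem E c s) (a b : ℂ) (t : ℝ) :
    HasDerivAt (fun t => a * (-(E * s t)) + b * c t) (-(E * (a * c t + b * s t))) t := by
  have h1 := (h.deriv_c t).ofReal_comp
  have h2 := (h.deriv_s t).ofReal_comp
  push_cast at h1
  refine (((h2.const_mul (E : ℂ)).neg.const_mul a).add (h1.const_mul b)).congr_deriv ?_
  ring

theorem integral_combination (h : IsFundamentalSystem E c s) (a b : ℂ) (t : ℝ) :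
    ∫ x in (0 : ℝ)..t, E * (a * c x + b * s x) = b - (a * (-(E * s t)) + b * c t) := by
  have hcc := h.continuous_c
  have hcs := h.continuous_s
  have := intervalIntegral.integral_eq_sub_of_hasDerivAt
    (f := fun t : ℝ => -(a * (-(E * s t)) + b * c t))
    (f' := fun x => E * (a * c x + b * s x)) (a := 0) (b := t)
    (fun x _ => (h.hasDerivAt_combination' a b x).neg.congr_deriv (neg_neg _))
    (Continuous.intervalIntegrable (by fun_prop) _ _)
  rw [this, h.c_zero, h.s_zero]
  push_cast
  ring

/-- With p = f', the expressions f c - p s and p c + E f s have derivative zero, hence equal f(0)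
and p(0). The identity c² + E s² = 1 solves these two equations for f and p. -/
theorem eq_combination (h : IsFundamentalSystem E c s) {f p : ℝ → ℂ}
    (hf : ∀ t ∈ Set.Icc (0 : ℝ) 1, HasDerivWithinAt f (p t) (Set.Icc 0 1) t)
    (hp : ∀ t ∈ Set.Icc (0 : ℝ) 1, p t = p 0 - ∫ x in (0 : ℝ)..t, E * f x)
    {t : ℝ} (ht : t ∈ Set.Icc (0 : ℝ) 1) :
    f t = f 0 * c t + p 0 * s t ∧ p t = f 0 * (-(E * s t)) + p 0 * c t := by
  have hfc : ContinuousOn f (Set.Icc 0 1) := fun t ht => (hf t ht).continuousWithinAt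
  have hp' : ∀ t ∈ Set.Icc (0 : ℝ) 1, HasDerivWithinAt p (-(E * f t)) (Set.Icc 0 1) t := by
    intro t ht
    -- A continuous extension of `f` to the line lets the fundamental theorem of calculus apply at
    -- the endpoints too.
    let g : ℝ → ℂ := Set.IccExtend (zero_le_one (α := ℝ)) ((Set.Icc (0 : ℝ) 1).domRestrict f)
    have hg : Continuous g := (continuousOn_iff_continuous_domRestrict.mp hfc).Icc_extend'
    have hgf : ∀ x ∈ Set.Icc (0 : ℝ) 1, g x = f x := fun x hx =>
      Set.IccExtend_of_mem _ _ hx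
    have hEg : Continuous fun x => E * g x := continuous_const.mul hg
    have hd : HasDerivAt (fun t => p 0 - ∫ x in (0 : ℝ)..t, E * g x) (-(E * g t)) t :=
      ((hEg.integral_hasStrictDerivAt 0 t).hasDerivAt).const_sub (p 0)
    rw [hgf t ht] at hd
    refine hd.hasDerivWithinAt.congr (fun x hx => ?_) ?_
    · rw [hp x hx]
      congr 1
      refine intervalIntegral.integral_congr fun y hy => ?_
      rw [Set.uIcc_of_le hx.1] at hy
      exact congrArg ((E : ℂ) * ·) (hgf y ⟨hy.1, hy.2.trans hx.2⟩).symm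
    · rw [hp t ht]
      congr 1
      refine intervalIntegral.integral_congr fun y hy => ?_
      rw [Set.uIcc_of_le ht.1] at hy
      exact congrArg ((E : ℂ) * ·) (hgf y ⟨hy.1, hy.2.trans ht.2⟩).symm
  have hu := uniqueDiffOn_Icc (zero_lt_one (α := ℝ))
  have hc' : ∀ t, HasDerivAt (fun t => (c t : ℂ)) (-(E * s t)) t := fun t => by
    have := (h.deriv_c t).ofReal_comp
    push_cast at this
    exact this
  have hs' : ∀ t, HasDerivAt (fun t => (s t : ℂ)) (c t) t := fun t => (h.deriv_s t).ofReal_comp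
  have hconst : ∀ w : ℝ → ℂ, (∀ t ∈ Set.Icc (0 : ℝ) 1, HasDerivWithinAt w 0 (Set.Icc 0 1) t) →
      w t = w 0 := fun w hw =>
    constant_of_derivWithin_zero (fun x hx => (hw x hx).differentiableWithinAt)
      (fun x hx => (hw x (Set.Ico_subset_Icc_self hx)).derivWithin
        (hu x (Set.Ico_subset_Icc_self hx))) t ht
  have h1 := hconst (fun t => f t * c t - p t * s t) fun x hx => by
    refine (((hf x hx).mul (hc' x).hasDerivWithinAt).sub
      ((hp' x hx).mul (hs' x).hasDerivWithinAt)).congr_deriv ?_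
    ring
  have h2 := hconst (fun t => p t * c t + E * (f t * s t)) fun x hx => by
    refine (((hp' x hx).mul (hc' x).hasDerivWithinAt).add
      (((hf x hx).mul (hs' x).hasDerivWithinAt).const_mul (E : ℂ))).congr_deriv ?_
    ring
  have hw : (c t : ℂ) ^ 2 + E * (s t : ℂ) ^ 2 = 1 := by exact_mod_cast h.wronskian t
  simp only [h.c_zero, h.s_zero, Complex.ofReal_one, Complex.ofReal_zero, mul_one, mul_zero,
    sub_zero, add_zero] at h1 h2
  constructor
  · rw [← h1, ← h2]
    linear_combination -f t * hw
  · rw [← h1, ← h2]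
    linear_combination -p t * hw

/-- A continuous function as an element of `L²(0, 1)`. -/
theorem memLp_two (f : ℝ → ℝ) (hf : Continuous f) :
    MemLp (fun t => (f t : ℂ)) 2 (volume.restrict (Set.Icc (0 : ℝ) 1)) := by
  have hc : Continuous fun t => (f t : ℂ) := by fun_prop
  obtain ⟨C, hC⟩ := (isCompact_Icc (a := (0 : ℝ)) (b := 1)).exists_bound_of_continuousOn
    hc.continuousOn
  exact MemLp.of_bound hc.aestronglyMeasurable C
    ((ae_restrict_iff' measurableSet_Icc).mpr (Eventually.of_forall hC))

end IsFundamentalSystem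

end Ode

/-! ### Metric eigenfunctions and their vertex values -/

namespace PeriodicGraph

open MeasureTheory

variable {d : ℕ} {V A : Type*} [AddAction (Fin d → ℤ) V] [AddAction (Fin d → ℤ) A]
  {G : PeriodicGraph d V A}

-- The outgoing derivative at the terminal end of an edge, with its phase, is given by the formula
-- at the initial end of the reversed edge. So the flux at v is a sum over all oriented edges
-- leaving v. It is used with κ = c(1) and σ = 1 / s(1).
open Classical in
theorem kirchhoff_eq (V₀ : G.FundamentalVertexSet) (O : G.Orientation)
    (θ : EuclideanSpace ℝ (Fin d)) {κ : ℝ} {σ : ℂ} (Y : G.FundVertex → ℂ)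
    {p : O.carrier → ℝ → ℂ}
    (h0 : ∀ e, p e 0 = σ * (phase V₀ θ e * Y (G.ftgt e) - κ * Y (G.fsrc e)))
    (h1 : ∀ e, p e 1 = σ * (κ * (phase V₀ θ e * Y (G.ftgt e)) - Y (G.fsrc e)))
    (v : G.FundVertex) :
    (∑ e : O.carrier, if G.fsrc e = v then p e 0 else 0) -
        (∑ e : O.carrier, if G.ftgt e = v then
          Complex.exp (-(Complex.I * (pairing V₀ e θ : ℝ))) * p e 1 else 0) =
      σ * (hop V₀ θ Y v - κ * G.deg v * Y v) := by
  have h2 : hop V₀ θ Y v - κ * G.deg v * Y v = ∑ e,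
      if G.fsrc e = v then phase V₀ θ e * Y (G.ftgt e) - κ * Y (G.fsrc e) else 0 := by
    have h3 : ∑ e with G.fsrc e = v, Y (G.fsrc e) = G.deg v * Y v := by
      rw [Finset.sum_congr rfl (g := fun _ => Y v)
        (fun e he => by rw [(Finset.mem_filter.mp he).2]), Finset.sum_const, nsmul_eq_mul, deg]
    rw [← Finset.sum_filter, Finset.sum_sub_distrib, ← Finset.mul_sum, h3, hop, mul_assoc]
  rw [h2, sum_orientation O, Finset.mul_sum, ← Finset.sum_sub_distrib]
  refine Finset.sum_congr rfl fun e _ => ?_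
  have hph := phase_finv_mul V₀ θ (e : G.FundEdge)
  rw [fsrc_finv, ftgt_finv, ← phase_finv', h0, h1]
  split_ifs
  · linear_combination (-(σ * κ * Y (G.ftgt e))) * hph
  · ring
  · linear_combination (-(σ * κ * Y (G.ftgt e))) * hph
  · ring

/-- The functions on the edges with given values at the vertices that solve `-f'' = E f`. -/
noncomputable def metricExtension (V₀ : G.FundamentalVertexSet) (O : G.Orientation)
    (θ : EuclideanSpace ℝ (Fin d)) {E : ℝ} {c s : ℝ → ℝ} (h : IsFundamentalSystem E c s) :
    (G.FundVertex → ℂ) →ₗ[ℂ] G.MetricL2 O where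
  toFun Y e := Y (G.fsrc e) • (IsFundamentalSystem.memLp_two c h.continuous_c).toLp _ +
    ((s 1 : ℂ)⁻¹ * (phase V₀ θ e * Y (G.ftgt e) - c 1 * Y (G.fsrc e))) •
      (IsFundamentalSystem.memLp_two s h.continuous_s).toLp _
  map_add' Y Z := by
    funext e
    simp only [Pi.add_apply]
    module
  map_smul' r Y := by
    funext e
    simp only [Pi.smul_apply, RingHom.id_apply, smul_eq_mul]
    module

theorem metricExtension_ae_eq (V₀ : G.FundamentalVertexSet) (O : G.Orientation)
    (θ : EuclideanSpace ℝ (Fin d)) {E : ℝ} {c s : ℝ → ℝ} (h : IsFundamentalSystem E c s)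
    (Y : G.FundVertex → ℂ) (e : O.carrier) :
    metricExtension V₀ O θ h Y e =ᵐ[volume.restrict (Set.Icc (0 : ℝ) 1)] fun t =>
      Y (G.fsrc e) * c t +
        ((s 1 : ℂ)⁻¹ * (phase V₀ θ e * Y (G.ftgt e) - c 1 * Y (G.fsrc e))) * s t := by
  refine (Lp.coeFn_add _ _).trans (EventuallyEq.add ?_ ?_)
  · exact (Lp.coeFn_smul _ _).trans
      ((IsFundamentalSystem.memLp_two c h.continuous_c).coeFn_toLp.const_smul (Y (G.fsrc e)))
  · exact (Lp.coeFn_smul _ _).trans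
      ((IsFundamentalSystem.memLp_two s h.continuous_s).coeFn_toLp.const_smul _)

theorem integral_smul_L2 (E : ℝ) {y : Lp ℂ 2 (volume.restrict (Set.Icc (0 : ℝ) 1))}
    {f : ℝ → ℂ} (hf : y =ᵐ[volume.restrict (Set.Icc (0 : ℝ) 1)] f) {t : ℝ}
    (ht : t ∈ Set.Icc (0 : ℝ) 1) :
    ∫ x in (0 : ℝ)..t, ((E : ℂ) • y) x = ∫ x in (0 : ℝ)..t, E * f x :=
  integral_L2_congr ((Lp.coeFn_smul (E : ℂ) y).trans (hf.const_smul (E : ℂ))) ht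

/-- Since s(1) ≠ 0, the values at both ends of an edge fix the solution on it, including the
derivatives p(0) and p(1). For these derivatives `kirchhoff_eq` identifies the Kirchhoff conditions
with the hopping equation for κ = c(1). -/
theorem map_metricExtension (V₀ : G.FundamentalVertexSet) (O : G.Orientation)
    (θ : EuclideanSpace ℝ (Fin d)) {E : ℝ} {c s : ℝ → ℝ} (h : IsFundamentalSystem E c s) :
    (hopEigenspace V₀ θ (c 1)).map (metricExtension V₀ O θ h) = metricEigenspace V₀ O θ E := by
  have hs1 : (s 1 : ℂ) ≠ 0 := by exact_mod_cast h.s_one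
  have hw : (c 1 : ℂ) ^ 2 + E * (s 1 : ℂ) ^ 2 = 1 := by exact_mod_cast h.wronskian 1
  ext y
  constructor
  · rintro ⟨Y, hY, rfl⟩
    let b : O.carrier → ℂ := fun e =>
      (s 1 : ℂ)⁻¹ * (phase V₀ θ e * Y (G.ftgt e) - c 1 * Y (G.fsrc e))
    refine ⟨fun e t => Y (G.fsrc e) * c t + b e * s t,
      fun e t => Y (G.fsrc e) * (-(E * s t)) + b e * c t,
      metricExtension_ae_eq V₀ O θ h Y, fun e t _ =>
        (h.hasDerivAt_combination _ _ t).hasDerivWithinAt, fun e t ht => ?_,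
      ⟨Y, fun e => ⟨?_, ?_⟩⟩, fun v => ?_⟩
    · refine Eq.trans ?_ (congrArg₂ (· - ·) rfl
        (integral_smul_L2 E (metricExtension_ae_eq V₀ O θ h Y e) ht).symm)
      change _ = _ - ∫ x in (0 : ℝ)..t, E * (Y (G.fsrc e) * c x + b e * s x)
      rw [h.integral_combination]
      simp only [h.c_zero, h.s_zero]
      push_cast
      ring
    · simp [h.c_zero, h.s_zero]
    · change Y (G.fsrc e) * c 1 + (s 1 : ℂ)⁻¹ * (phase V₀ θ e * Y (G.ftgt e) -
        c 1 * Y (G.fsrc e)) * s 1 = phase V₀ θ e * Y (G.ftgt e)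
      field_simp
      ring
    · refine (kirchhoff_eq V₀ O θ (κ := c 1) (σ := (s 1 : ℂ)⁻¹)
        (p := fun e t => Y (G.fsrc e) * (-(E * s t)) + b e * c t) Y ?_ ?_ v).trans ?_
      · intro e
        simp [b, h.c_zero, h.s_zero]
      · intro e
        simp only [b]
        field_simp
        linear_combination (-Y (G.fsrc e)) * hw
      · rw [hY v, sub_self, mul_zero]
  · rintro ⟨f, p, h1, h2, h3, ⟨Y, h4⟩, h5⟩
    have h3' : ∀ e, ∀ t ∈ Set.Icc (0 : ℝ) 1, p e t = p e 0 - ∫ x in (0 : ℝ)..t, E * f e x :=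
      fun e t ht => by
        rw [← integral_smul_L2 E (h1 e) ht]
        exact h3 e t ht
    have hsol := fun e (t : ℝ) (ht : t ∈ Set.Icc (0 : ℝ) 1) =>
      h.eq_combination (h2 e) (h3' e) ht
    have h4' : ∀ e : O.carrier, f e 1 = phase V₀ θ e * Y (G.ftgt e) := fun e => (h4 e).2
    have hp0 : ∀ e : O.carrier, p e 0 =
        (s 1 : ℂ)⁻¹ * (phase V₀ θ e * Y (G.ftgt e) - c 1 * Y (G.fsrc e)) := fun e => by
      have := (hsol e 1 (by simp)).1
      rw [h4' e, (h4 e).1] at this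
      rw [this]
      field_simp
      ring
    have hp1 : ∀ e : O.carrier, p e 1 =
        (s 1 : ℂ)⁻¹ * (c 1 * (phase V₀ θ e * Y (G.ftgt e)) - Y (G.fsrc e)) := fun e => by
      rw [(hsol e 1 (by simp)).2, (h4 e).1, hp0 e]
      field_simp
      linear_combination (-Y (G.fsrc e)) * hw
    refine ⟨Y, fun v => ?_, ?_⟩
    · have h6 := h5 v
      rw [kirchhoff_eq V₀ O θ (κ := c 1) (σ := (s 1 : ℂ)⁻¹) Y hp0 hp1] at h6
      exact sub_eq_zero.mp ((mul_eq_zero.mp h6).resolve_left (inv_ne_zero hs1))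
    · funext e
      refine Lp.ext ?_
      refine (metricExtension_ae_eq V₀ O θ h Y e).trans (EventuallyEq.trans ?_ (h1 e).symm)
      refine (ae_restrict_iff' measurableSet_Icc).mpr (Eventually.of_forall fun t ht => ?_)
      simp only
      rw [(hsol e t ht).1, (h4 e).1, hp0 e]

/-- A continuous function that vanishes almost everywhere on [0, 1] vanishes at both endpoints, and
every vertex is an endpoint because its degree is positive. -/
theorem metricExtension_injective (hd : 1 ≤ d) (V₀ : G.FundamentalVertexSet) (O : G.Orientation)
    (θ : EuclideanSpace ℝ (Fin d)) {E : ℝ} {c s : ℝ → ℝ} (h : IsFundamentalSystem E c s) :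
    Function.Injective (metricExtension V₀ O θ h) := by
  rw [← LinearMap.ker_eq_bot, LinearMap.ker_eq_bot']
  intro Y hY
  have hs1 : (s 1 : ℂ) ≠ 0 := by exact_mod_cast h.s_one
  have hcc := h.continuous_c
  have hcs := h.continuous_s
  have hzero : ∀ e : O.carrier, Y (G.fsrc e) = 0 ∧ Y (G.ftgt e) = 0 := fun e => by
    have h1 := (metricExtension_ae_eq V₀ O θ h Y e).symm
    rw [hY] at h1
    have h2 := h1.trans (Lp.coeFn_zero ℂ 2 (volume.restrict (Set.Icc (0 : ℝ) 1)))
    have h3 := Measure.eqOn_Icc_of_ae_eq (μ := volume) (zero_ne_one (α := ℝ)) h2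
      (Continuous.continuousOn (by fun_prop)) (continuousOn_const (c := (0 : ℂ)))
    have h4 : Y (G.fsrc e) = 0 := by
      simpa [h.c_zero, h.s_zero] using h3 (Set.left_mem_Icc.mpr zero_le_one)
    refine ⟨h4, ?_⟩
    have h5 := h3 (Set.right_mem_Icc.mpr zero_le_one)
    simp only [h4, zero_mul, mul_zero, sub_zero, zero_add, Pi.zero_apply] at h5
    have hph : phase V₀ θ (e : G.FundEdge) ≠ 0 := Complex.exp_ne_zero _
    simpa [hs1, hph] using h5
  funext v
  obtain ⟨e, he⟩ := Finset.card_pos.mp (deg_pos hd v)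
  have hev : G.fsrc e = v := (Finset.mem_filter.mp he).2
  by_cases hO : e ∈ O.carrier
  · rw [← hev]
    exact (hzero ⟨e, hO⟩).1
  · have hO' : G.finv e ∈ O.carrier := not_not.mp ((O.mem_iff e).not.mp hO)
    have := (hzero ⟨G.finv e, hO'⟩).2
    rwa [ftgt_finv, hev] at this

/-- The multiplicity of an eigenvalue of the metric Laplacian that is no Dirichlet eigenvalue. -/
theorem finrank_metricEigenspace (hd : 1 ≤ d) (V₀ : G.FundamentalVertexSet) (O : G.Orientation)
    (θ : EuclideanSpace ℝ (Fin d)) {E : ℝ} {c s : ℝ → ℝ} (h : IsFundamentalSystem E c s) :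
    Module.Finite ℂ (metricEigenspace V₀ O θ E) ∧
      Module.finrank ℂ (metricEigenspace V₀ O θ E) = (eigs V₀ θ).count (1 - c 1) := by
  rw [← map_metricExtension V₀ O θ h]
  refine ⟨inferInstance, ?_⟩
  rw [← finrank_hopEigenspace hd]
  exact (Submodule.equivMapOfInjective _ (metricExtension_injective hd V₀ O θ h) _).finrank_eq.symm

end PeriodicGraph

/-! ### Explicit fundamental systems for positive, zero and negative energy -/

theorem isFundamentalSystem_of_pos {z : ℝ} (hz : 0 < z) (hsin : Real.sin z ≠ 0) :
    IsFundamentalSystem (z ^ 2) (fun t => Real.cos (z * t)) fun t => Real.sin (z * t) / z where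
  deriv_c t := by
    have := ((hasDerivAt_id t).const_mul z).cos
    refine this.congr_deriv ?_
    simp only [id]
    field_simp
  deriv_s t := by
    have := (((hasDerivAt_id t).const_mul z).sin).div_const z
    refine this.congr_deriv ?_
    simp only [id]
    field_simp
  c_zero := by simp
  s_zero := by simp
  s_one := by simpa using ⟨hsin, hz.ne'⟩

theorem isFundamentalSystem_zero : IsFundamentalSystem 0 (fun _ => 1) fun t => t where
  deriv_c t := by simpa using hasDerivAt_const t (1 : ℝ)
  deriv_s t := hasDerivAt_id t
  c_zero := rfl
  s_zero := rfl
  s_one := one_ne_zero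

theorem isFundamentalSystem_of_neg {z : ℝ} (hz : 0 < z) :
    IsFundamentalSystem (-z ^ 2) (fun t => Real.cosh (z * t)) fun t => Real.sinh (z * t) / z where
  deriv_c t := by
    have := ((hasDerivAt_id t).const_mul z).cosh
    refine this.congr_deriv ?_
    simp only [id]
    field_simp
  deriv_s t := by
    have := (((hasDerivAt_id t).const_mul z).sinh).div_const z
    refine this.congr_deriv ?_
    simp only [id]
    field_simp
  c_zero := by simp
  s_zero := by simp
  s_one := by simpa using hz.ne'

namespace PeriodicGraph

variable {d : ℕ} {V A : Type*} [AddAction (Fin d → ℤ) V] [AddAction (Fin d → ℤ) A]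
  {G : PeriodicGraph d V A}

/-! ### The eigenvalues of the metric Laplacian -/

theorem card_band_eq (V₀ : G.FundamentalVertexSet) (θ : EuclideanSpace ℝ (Fin d)) (x : ℝ) :
    Nat.card {n : ℕ // 1 ≤ n ∧ n ≤ G.nu ∧ band V₀ n θ = x} = (eigs V₀ θ).count x := by
  have h1 : (eigs V₀ θ).count x =
      Nat.card {i : Fin (bandList V₀ θ).length // (bandList V₀ θ).get i = x} := by
    have h2 : (bandList V₀ θ : Multiset ℝ) =
        (Finset.univ : Finset (Fin (bandList V₀ θ).length)).val.map (bandList V₀ θ).get := by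
      rw [Fin.univ_val_map, List.ofFn_get]
    rw [← coe_bandList, h2, Multiset.count_map, Nat.card_eq_fintype_card, Fintype.card_subtype]
    simp only [eq_comm (a := x)]
    rfl
  have hl := length_bandList V₀ θ
  have hb : ∀ (n : ℕ) (h : n < (bandList V₀ θ).length),
      band V₀ (n + 1) θ = (bandList V₀ θ).get ⟨n, h⟩ := fun n h =>
    List.getD_eq_getElem (bandList V₀ θ) 0 h
  rw [h1]
  -- Bands are numbered from 1 and list positions from 0.
  refine Nat.card_congr
    { toFun := fun n => ⟨⟨n.1 - 1, by have := n.2; omega⟩, ?_⟩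
      invFun := fun i => ⟨i.1.1 + 1, by omega, by have := i.1.2; omega, ?_⟩
      left_inv := fun n => Subtype.ext (Nat.sub_add_cancel n.2.1)
      right_inv := fun i => Subtype.ext (Fin.ext (Nat.add_sub_cancel ..)) }
  · rw [← hb, Nat.sub_add_cancel n.2.1]
    exact n.2.2.2
  · rw [hb _ i.1.2]
    exact i.2

theorem cos_metricZ (hd : 1 ≤ d) (V₀ : G.FundamentalVertexSet) (n j : ℕ)
    (θ : EuclideanSpace ℝ (Fin d)) : Real.cos (metricZ V₀ n j θ) = 1 - band V₀ n θ := by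
  obtain ⟨h1, h2⟩ := band_mem_Icc hd V₀ n θ
  have hc : Real.cos (Real.arccos (1 - band V₀ n θ)) = 1 - band V₀ n θ :=
    Real.cos_arccos (by linarith) (by linarith)
  rw [metricZ]
  split_ifs with hj
  · rw [mul_comm, Real.cos_add_nat_mul_pi, hj.neg_one_pow, one_mul, hc]
  · rw [mul_comm, Real.cos_add_nat_mul_pi, (Nat.not_even_iff_odd.mp hj).neg_one_pow,
      Real.cos_pi_sub, hc]
    ring

theorem le_metricZ (V₀ : G.FundamentalVertexSet) (n j : ℕ) (θ : EuclideanSpace ℝ (Fin d)) :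
    Real.pi * j ≤ metricZ V₀ n j θ := by
  have h1 := Real.arccos_nonneg (1 - band V₀ n θ)
  have h2 := Real.arccos_le_pi (1 - band V₀ n θ)
  rw [metricZ]
  split_ifs <;> linarith

theorem metricZ_le (V₀ : G.FundamentalVertexSet) (n j : ℕ) (θ : EuclideanSpace ℝ (Fin d)) :
    metricZ V₀ n j θ ≤ Real.pi * (j + 1) := by
  have h1 := Real.arccos_nonneg (1 - band V₀ n θ)
  have h2 := Real.arccos_le_pi (1 - band V₀ n θ)
  rw [metricZ]
  split_ifs <;> linarith

theorem metricZ_nonneg (V₀ : G.FundamentalVertexSet) (n j : ℕ) (θ : EuclideanSpace ℝ (Fin d)) :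
    0 ≤ metricZ V₀ n j θ :=
  le_trans (by positivity) (le_metricZ V₀ n j θ)

theorem sqrt_metricBand (V₀ : G.FundamentalVertexSet) (n j : ℕ)
    (θ : EuclideanSpace ℝ (Fin d)) : Real.sqrt (metricBand V₀ n j θ) = metricZ V₀ n j θ :=
  Real.sqrt_sq (metricZ_nonneg V₀ n j θ)

/-- The values of z_{n,j} lie in [πj, π(j+1)], so off the positive multiples of π the number j must
be ⌊z/π⌋. On such an interval the cosine is injective, and cos z_{n,j} = 1 - λ_n. The point z = 0 is
allowed. -/
theorem metricZ_eq_iff (hd : 1 ≤ d) (V₀ : G.FundamentalVertexSet) (n j : ℕ)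
    (θ : EuclideanSpace ℝ (Fin d)) {z : ℝ} (hz : 0 ≤ z)
    (hk : ∀ k : ℕ, z ≠ Real.pi * (k + 1)) :
    metricZ V₀ n j θ = z ↔ j = ⌊z / Real.pi⌋₊ ∧ band V₀ n θ = 1 - Real.cos z := by
  have hpi := Real.pi_pos
  constructor
  · rintro rfl
    refine ⟨?_, by rw [cos_metricZ hd]; ring⟩
    symm
    rw [Nat.floor_eq_iff (div_nonneg hz hpi.le), le_div_iff₀ hpi, div_lt_iff₀ hpi]
    refine ⟨by rw [mul_comm]; exact le_metricZ V₀ n j θ, ?_⟩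
    rw [mul_comm]
    exact lt_of_le_of_ne (metricZ_le V₀ n j θ) (hk j)
  · rintro ⟨hj, hb⟩
    have h1 : (j : ℝ) * Real.pi ≤ z := by
      rw [← le_div_iff₀ hpi, hj]
      exact Nat.floor_le (div_nonneg hz hpi.le)
    have h2 : z < ((j : ℝ) + 1) * Real.pi := by
      rw [← div_lt_iff₀ hpi, hj]
      exact Nat.lt_floor_add_one _
    have hcos : Real.cos z = (-1) ^ j * Real.cos (z - j * Real.pi) := by
      conv_lhs => rw [← sub_add_cancel z (j * Real.pi)]
      rw [Real.cos_add_nat_mul_pi]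
    rw [metricZ, hb, sub_sub_cancel, hcos]
    split_ifs with hev
    · rw [hev.neg_one_pow, one_mul, Real.arccos_cos (by linarith) (by linarith)]
      ring
    · rw [(Nat.not_even_iff_odd.mp hev).neg_one_pow, neg_one_mul, Real.arccos_neg,
        Real.arccos_cos (by linarith) (by linarith)]
      ring

theorem card_metricBand_eq (hd : 1 ≤ d) (V₀ : G.FundamentalVertexSet)
    (θ : EuclideanSpace ℝ (Fin d)) {z : ℝ} (hz : 0 ≤ z)
    (hk : ∀ k : ℕ, z ≠ Real.pi * (k + 1)) :
    Nat.card {q : ℕ × ℕ // 1 ≤ q.1 ∧ q.1 ≤ G.nu ∧ metricBand V₀ q.1 q.2 θ = z ^ 2} =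
      (eigs V₀ θ).count (1 - Real.cos z) := by
  have hiff : ∀ n j, metricBand V₀ n j θ = z ^ 2 ↔
      j = ⌊z / Real.pi⌋₊ ∧ band V₀ n θ = 1 - Real.cos z := fun n j => by
    rw [← metricZ_eq_iff hd V₀ n j θ hz hk, metricBand]
    exact sq_eq_sq₀ (metricZ_nonneg V₀ n j θ) hz
  rw [← card_band_eq]
  refine Nat.card_congr
    { toFun := fun q => ⟨q.1.1, q.2.1, q.2.2.1, ((hiff _ _).mp q.2.2.2).2⟩
      invFun := fun n => ⟨(n.1, ⌊z / Real.pi⌋₊), n.2.1, n.2.2.1, (hiff _ _).mpr ⟨rfl, n.2.2.2⟩⟩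
      left_inv := fun q => Subtype.ext (Prod.ext rfl ((hiff _ _).mp q.2.2.2).1.symm)
      right_inv := fun n => rfl }

theorem sin_ne_zero_of_sq_ne {z : ℝ} (hz : z ≠ 0)
    (hk : ∀ k : ℤ, k ≠ 0 → z ^ 2 ≠ (Real.pi * k) ^ 2) : Real.sin z ≠ 0 := fun h => by
  obtain ⟨k, hk'⟩ := Real.sin_eq_zero_iff.mp h
  refine hk k (fun h0 => hz ?_) ?_
  · rw [← hk', h0]
    simp
  · rw [← hk', mul_comm]

theorem finrank_metricEigenspace_sq (hd : 1 ≤ d) (V₀ : G.FundamentalVertexSet)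
    (O : G.Orientation) (θ : EuclideanSpace ℝ (Fin d)) {z : ℝ} (hz : 0 ≤ z)
    (hk : ∀ k : ℤ, k ≠ 0 → z ^ 2 ≠ (Real.pi * k) ^ 2) :
    Module.Finite ℂ (metricEigenspace V₀ O θ (z ^ 2)) ∧
      Module.finrank ℂ (metricEigenspace V₀ O θ (z ^ 2)) =
        (eigs V₀ θ).count (1 - Real.cos z) := by
  rcases hz.eq_or_lt with rfl | hpos
  · have := finrank_metricEigenspace hd V₀ O θ isFundamentalSystem_zero
    rw [zero_pow two_ne_zero]
    simpa using this
  · have := finrank_metricEigenspace hd V₀ O θ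
      (isFundamentalSystem_of_pos hpos (sin_ne_zero_of_sq_ne hpos.ne' hk))
    simpa using this

theorem finrank_metricEigenspace_eq_card (hd : 1 ≤ d) (V₀ : G.FundamentalVertexSet)
    (O : G.Orientation) (θ : EuclideanSpace ℝ (Fin d)) {E : ℝ}
    (hE : ∀ k : ℤ, k ≠ 0 → E ≠ (Real.pi * k) ^ 2) :
    Module.Finite ℂ (metricEigenspace V₀ O θ E) ∧
      Module.finrank ℂ (metricEigenspace V₀ O θ E) =
        Nat.card {q : ℕ × ℕ // 1 ≤ q.1 ∧ q.1 ≤ G.nu ∧ metricBand V₀ q.1 q.2 θ = E} := by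
  rcases le_or_gt 0 E with hE0 | hE0
  · obtain ⟨z, hz, rfl⟩ : ∃ z : ℝ, 0 ≤ z ∧ z ^ 2 = E :=
      ⟨Real.sqrt E, Real.sqrt_nonneg E, Real.sq_sqrt hE0⟩
    rw [card_metricBand_eq hd V₀ θ hz]
    · exact finrank_metricEigenspace_sq hd V₀ O θ hz hE
    · intro k hk
      refine hE (k + 1) (by omega) ?_
      rw [hk]
      push_cast
      ring
  · obtain ⟨z, hz, rfl⟩ : ∃ z : ℝ, 0 < z ∧ -z ^ 2 = E :=
      ⟨Real.sqrt (-E), Real.sqrt_pos.mpr (by linarith), by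
        rw [Real.sq_sqrt (by linarith)]; ring⟩
    obtain ⟨h1, h2⟩ := finrank_metricEigenspace hd V₀ O θ (isFundamentalSystem_of_neg hz)
    refine ⟨h1, h2.trans ?_⟩
    -- For negative E both sides are zero: 1 - cosh z is negative and thus no discrete eigenvalue,
    -- while every E_{n,j} is a square.
    have hcosh : 1 < Real.cosh (z * 1) := by
      rw [mul_one]
      exact Real.one_lt_cosh.mpr hz.ne'
    rw [Multiset.count_eq_zero.mpr fun hmem => ?_]
    · have : IsEmpty {q : ℕ × ℕ // 1 ≤ q.1 ∧ q.1 ≤ G.nu ∧ metricBand V₀ q.1 q.2 θ = -z ^ 2} :=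
        ⟨fun q => by
          have h3 := q.2.2.2
          rw [metricBand] at h3
          nlinarith [sq_nonneg (metricZ V₀ q.1.1 q.1.2 θ), pow_pos hz 2]⟩
      rw [Nat.card_of_isEmpty]
    · have := (eigs_mem_Icc hd hmem).1
      linarith

/-! ### Effective forms at interior extrema -/

/-- The band function `E_{n,j}` as a function of `λ_n`. -/
noncomputable def metricEnergy (j : ℕ) (x : ℝ) : ℝ :=
  (if Even j then Real.arccos (1 - x) + Real.pi * j
    else (Real.pi - Real.arccos (1 - x)) + Real.pi * j) ^ 2

theorem metricBand_eq_metricEnergy (V₀ : G.FundamentalVertexSet) (n j : ℕ)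
    (θ : EuclideanSpace ℝ (Fin d)) :
    metricBand V₀ n j θ = metricEnergy j (band V₀ n θ) := rfl

theorem analyticAt_metricEnergy (j : ℕ) {x : ℝ} (h0 : x ≠ 0) (h2 : x ≠ 2) :
    AnalyticAt ℝ (metricEnergy j) x := by
  have h1 : AnalyticAt ℝ (fun x : ℝ => Real.arccos (1 - x)) x := by
    have ha : AnalyticAt ℝ Real.arccos (1 - x) :=
      (Real.contDiffAt_arccos (fun h => h2 (by linarith)) (fun h => h0 (by linarith))).analyticAt
    exact ha.comp (f := fun x : ℝ => 1 - x) (analyticAt_const.sub analyticAt_id)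
  unfold metricEnergy
  split_ifs
  · exact (h1.add analyticAt_const).pow 2
  · exact ((analyticAt_const.sub h1).add analyticAt_const).pow 2

/-- The derivative of arccos(1 - x) is 1 / sin(arccos(1 - x)). For odd j both this derivative and
the sine change sign on passing to z, so one formula covers both parities. -/
theorem hasDerivAt_metricEnergy (j : ℕ) {x z : ℝ} (h0 : 0 < x) (h2 : x < 2) (hz : 0 ≤ z)
    (hx : metricEnergy j x = z ^ 2) : HasDerivAt (metricEnergy j) (2 * z / Real.sin z) x := by
  have h1 : HasDerivAt (fun x : ℝ => Real.arccos (1 - x)) (1 / Real.sqrt (1 - (1 - x) ^ 2)) x := by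
    have ha := Real.hasDerivAt_arccos (x := 1 - x) (by linarith) (by linarith)
    have := ha.comp x ((hasDerivAt_id x).const_sub 1)
    refine this.congr_deriv ?_
    ring
  rw [← Real.sin_arccos] at h1
  have hpi := Real.pi_pos
  have hb0 := Real.arccos_nonneg (1 - x)
  have hb1 := Real.arccos_le_pi (1 - x)
  have hpj : 0 ≤ Real.pi * j := by positivity
  unfold metricEnergy at hx ⊢
  split_ifs at hx ⊢ with hj
  · have hz' : z = Real.arccos (1 - x) + Real.pi * j :=
      ((sq_eq_sq₀ (by linarith) hz).mp hx).symm
    have hsin : Real.sin z = Real.sin (Real.arccos (1 - x)) := by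
      rw [hz', mul_comm, Real.sin_add_nat_mul_pi, hj.neg_one_pow, one_mul]
    refine ((h1.add_const (Real.pi * j)).pow 2).congr_deriv ?_
    rw [hsin, ← hz']
    push_cast
    ring
  · have hz' : z = Real.pi - Real.arccos (1 - x) + Real.pi * j :=
      ((sq_eq_sq₀ (by linarith) hz).mp hx).symm
    have hsin : Real.sin z = -Real.sin (Real.arccos (1 - x)) := by
      rw [hz', mul_comm, Real.sin_add_nat_mul_pi, (Nat.not_even_iff_odd.mp hj).neg_one_pow,
        Real.sin_pi_sub, neg_one_mul]
    refine (((h1.const_sub Real.pi).add_const (Real.pi * j)).pow 2).congr_deriv ?_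
    rw [hsin, ← hz']
    push_cast
    rw [div_neg]
    ring

/-- Avoiding all (πk)² gives sin √E ≠ 0 and 0 < λ_n < 2, where E is an analytic function of λ_n with
nonzero derivative. Simplicity transfers to the discrete eigenvalue, and an extremum of E_{n,j} is a
critical point of λ_n. -/
theorem effectiveForm_metricBand (hd : 1 ≤ d) (V₀ : G.FundamentalVertexSet) (O : G.Orientation)
    {n j : ℕ} {θ₀ : EuclideanSpace ℝ (Fin d)} (h1 : 1 ≤ n) (hn : n ≤ G.nu - numFlat V₀)
    (hext : IsLocalExtr (metricBand V₀ n j) θ₀)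
    (hk : ∀ k : ℤ, metricBand V₀ n j θ₀ ≠ (Real.pi * k) ^ 2)
    (hs : IsSimpleMetricEigenvalue V₀ O θ₀ (metricBand V₀ n j θ₀)) :
    HasEffectiveForm (band V₀ n) θ₀ ∧ HasEffectiveForm (metricBand V₀ n j) θ₀ ∧
      ∀ ω : EuclideanSpace ℝ (Fin d), ‖ω‖ = 1 →
        effectiveForm (metricBand V₀ n j) θ₀ ω =
          2 * Real.sqrt (metricBand V₀ n j θ₀) / Real.sin (Real.sqrt (metricBand V₀ n j θ₀)) *
            effectiveForm (band V₀ n) θ₀ ω := by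
  have hz := metricZ_nonneg V₀ n j θ₀
  have hz0 : metricZ V₀ n j θ₀ ≠ 0 := fun h => hk 0 (by simp [metricBand, h])
  have hsin : Real.sin (metricZ V₀ n j θ₀) ≠ 0 :=
    sin_ne_zero_of_sq_ne hz0 fun k _ => hk k
  have hcos := cos_metricZ hd V₀ n j θ₀
  have hb := band_mem_Icc hd V₀ n θ₀
  have hsc := Real.sin_sq_add_cos_sq (metricZ V₀ n j θ₀)
  rw [hcos] at hsc
  have hb0 : 0 < band V₀ n θ₀ := lt_of_le_of_ne hb.1 fun h => hsin (by
    rw [← h] at hsc; simpa using hsc)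
  have hb2 : band V₀ n θ₀ < 2 := lt_of_le_of_ne hb.2 fun h => hsin (by
    rw [h] at hsc; norm_num at hsc; exact hsc)
  have hcount : (eigs V₀ θ₀).count (band V₀ n θ₀) = 1 := by
    have := (finrank_metricEigenspace_sq hd V₀ O θ₀ hz fun k _ => hk k).2
    rw [hcos, sub_sub_cancel] at this
    rw [← this]
    exact hs
  have hab := analyticAt_band hd V₀ h1 hn hcount
  have hae : AnalyticAt ℝ (fun θ => metricEnergy j (band V₀ n θ)) θ₀ :=
    (analyticAt_metricEnergy j hb0.ne' hb2.ne).comp hab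
  have hder := hasDerivAt_metricEnergy j hb0 hb2 hz
    (metricBand_eq_metricEnergy V₀ n j θ₀).symm
  have hne : 2 * metricZ V₀ n j θ₀ / Real.sin (metricZ V₀ n j θ₀) ≠ 0 :=
    div_ne_zero (mul_ne_zero two_ne_zero hz0) hsin
  have hgrad : fderiv ℝ (fun θ => metricEnergy j (band V₀ n θ)) θ₀ = 0 := hext.fderiv_eq_zero
  have hgrad' : fderiv ℝ (band V₀ n) θ₀ = 0 := by
    have h3 := (hder.comp_hasFDerivAt θ₀ hab.differentiableAt.hasFDerivAt).fderiv
    have h4 := h3.symm.trans hgrad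
    exact (smul_eq_zero.mp h4).resolve_left hne
  have he1 := hab.hasEffectiveForm hgrad'
  have he2 := hae.hasEffectiveForm hgrad
  refine ⟨he1, he2, fun ω hω => ?_⟩
  rw [sqrt_metricBand]
  exact he1.comp he2 hder.hasDerivWithinAt (fun θ => Set.mem_univ _) hω

/-! ### Bloch functions on the periodic graph -/

/-- The character `e^{i⟨m,θ⟩}` of `ℤ^d`. -/
noncomputable def character (θ : EuclideanSpace ℝ (Fin d)) (m : Fin d → ℤ) : ℂ :=
  Complex.exp ((∑ i, (m i : ℝ) * θ i : ℝ) * Complex.I)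

theorem character_add (θ : EuclideanSpace ℝ (Fin d)) (m n : Fin d → ℤ) :
    character θ (m + n) = character θ m * character θ n := by
  rw [character, character, character, ← Complex.exp_add, ← add_mul, ← Complex.ofReal_add,
    ← Finset.sum_add_distrib]
  congr 3
  exact Finset.sum_congr rfl fun i _ => by rw [Pi.add_apply]; push_cast; ring

theorem norm_character (θ : EuclideanSpace ℝ (Fin d)) (m : Fin d → ℤ) : ‖character θ m‖ = 1 :=
  Complex.norm_exp_ofReal_mul_I _

theorem character_zero (m : Fin d → ℤ) : character 0 m = 1 := by
  simp [character]

/-- The function on the periodic graph with quasimomentum `θ` and given values on the fundamental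
vertex set. -/
noncomputable def bloch (V₀ : G.FundamentalVertexSet) (θ : EuclideanSpace ℝ (Fin d))
    (Y : G.FundVertex → ℂ) (x : V) : ℂ :=
  character θ (coord V₀ x) * Y (G.vclass x)

theorem bloch_vadd (V₀ : G.FundamentalVertexSet) (θ : EuclideanSpace ℝ (Fin d))
    (Y : G.FundVertex → ℂ) (m : Fin d → ℤ) (x : V) :
    bloch V₀ θ Y (m +ᵥ x) = character θ m * bloch V₀ θ Y x := by
  rw [bloch, bloch, coord_vadd, character_add, vclass_vadd, mul_assoc]

theorem norm_bloch (V₀ : G.FundamentalVertexSet) (θ : EuclideanSpace ℝ (Fin d))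
    (Y : G.FundVertex → ℂ) (x : V) : ‖bloch V₀ θ Y x‖ = ‖Y (G.vclass x)‖ := by
  rw [bloch, norm_mul, norm_character, one_mul]

theorem phase_eclass (V₀ : G.FundamentalVertexSet) (θ : EuclideanSpace ℝ (Fin d)) (a : A) :
    character θ (coord V₀ (G.src a)) * phase V₀ θ (G.eclass a) =
      character θ (coord V₀ (G.tgt a)) := by
  have h : phase V₀ θ (G.eclass a) =
      character θ (coord V₀ (G.tgt a) - coord V₀ (G.src a)) := by
    rw [phase, character, pairing, mul_comm, index_eclass]
  rw [h, ← character_add, add_sub_cancel]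

theorem norm_bloch_sub (V₀ : G.FundamentalVertexSet) (θ : EuclideanSpace ℝ (Fin d))
    (Y : G.FundVertex → ℂ) (a : A) :
    ‖bloch V₀ θ Y (G.src a) - bloch V₀ θ Y (G.tgt a)‖ =
      ‖Y (G.fsrc (G.eclass a)) -
        phase V₀ θ (G.eclass a) * Y (G.ftgt (G.eclass a))‖ := by
  rw [bloch, bloch, ← phase_eclass, mul_assoc, ← mul_sub, norm_mul, norm_character, one_mul,
    fsrc_eclass, ftgt_eclass]

theorem norm_bloch_vadd_sub (V₀ : G.FundamentalVertexSet) (θ : EuclideanSpace ℝ (Fin d))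
    (Y : G.FundVertex → ℂ) (m : Fin d → ℤ) (x : V) :
    ‖bloch V₀ θ Y (m +ᵥ x) - bloch V₀ θ Y x‖ = ‖character θ m - 1‖ * ‖Y (G.vclass x)‖ := by
  rw [bloch_vadd, ← norm_bloch V₀ θ Y x, ← norm_mul, sub_mul, one_mul]

theorem norm_sub_le_sqrt_energy (V₀ : G.FundamentalVertexSet) (θ : EuclideanSpace ℝ (Fin d))
    (Y : G.FundVertex → ℂ) (a : A) :
    ‖bloch V₀ θ Y (G.src a) - bloch V₀ θ Y (G.tgt a)‖ ≤ Real.sqrt (energy V₀ θ Y) := by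
  refine Real.le_sqrt_of_sq_le ?_
  rw [norm_bloch_sub]
  exact Finset.single_le_sum
    (f := fun e => ‖Y (G.fsrc e) - phase V₀ θ e * Y (G.ftgt e)‖ ^ 2)
    (fun e _ => by positivity) (Finset.mem_univ (G.eclass a))

/-- The number N is the length of a path from x to y. It depends neither on the quasimomentum nor on
the function. -/
theorem exists_norm_bloch_sub_le (V₀ : G.FundamentalVertexSet) (x y : V) :
    ∃ N : ℕ, ∀ (θ : EuclideanSpace ℝ (Fin d)) (Y : G.FundVertex → ℂ),
      ‖bloch V₀ θ Y x - bloch V₀ θ Y y‖ ≤ N * Real.sqrt (energy V₀ θ Y) := by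
  induction G.connected x y with
  | refl => exact ⟨0, fun θ Y => by simp⟩
  | tail _ h ih =>
    obtain ⟨N, hN⟩ := ih
    obtain ⟨a, rfl, rfl⟩ := h
    refine ⟨N + 1, fun θ Y => ?_⟩
    refine (norm_sub_le_norm_sub_add_norm_sub _ (bloch V₀ θ Y (G.src a)) _).trans ?_
    push_cast
    rw [add_mul, one_mul]
    exact add_le_add (hN θ Y) (norm_sub_le_sqrt_energy V₀ θ Y a)

/-- For eigenvalue 0 of the Laplacian the energy vanishes, so the Bloch function does not change
along any path. -/
theorem bloch_const {V₀ : G.FundamentalVertexSet} {θ : EuclideanSpace ℝ (Fin d)}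
    {Y : G.FundVertex → ℂ} (hY : Y ∈ hopEigenspace V₀ θ 1) (x y : V) :
    bloch V₀ θ Y x = bloch V₀ θ Y y := by
  obtain ⟨N, hN⟩ := exists_norm_bloch_sub_le V₀ x y
  have h1 := hN θ Y
  rw [energy_of_mem_hopEigenspace hY] at h1
  simp only [sub_self, mul_zero, zero_mul, Real.sqrt_zero] at h1
  exact sub_eq_zero.mp (norm_le_zero_iff.mp h1)

/-! ### The lowest band near zero quasimomentum -/

theorem count_zero_eigs_zero (hd : 1 ≤ d) (V₀ : G.FundamentalVertexSet) :
    (eigs V₀ 0).count 0 = 1 := by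
  have h := finrank_hopEigenspace hd V₀ 0 1
  rw [sub_self] at h
  rw [← h]
  have h1 : (fun _ => 1 : G.FundVertex → ℂ) ∈ hopEigenspace V₀ 0 1 := fun v => by
    simp [hop, phase_zero, deg]
  obtain ⟨x⟩ := G.nonempty
  refine finrank_eq_one_iff'.mpr ⟨⟨_, h1⟩, fun h0 => ?_, fun Y => ⟨Y.1 (G.vclass x), ?_⟩⟩
  · have := congrFun (congrArg Subtype.val h0) (G.vclass x)
    simp at this
  · refine Subtype.ext (funext fun v => ?_)
    obtain ⟨y, rfl⟩ := exists_vclass v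
    have := bloch_const Y.2 x y
    simp only [bloch, character_zero, one_mul] at this
    simp [this]

/-- At quasimomentum π in the first coordinate, translation by the first basis vector multiplies
Bloch functions by -1. A constant one is therefore zero, and 0 is no eigenvalue there. -/
theorem zero_notMem_flatBands (hd : 1 ≤ d) (V₀ : G.FundamentalVertexSet) :
    (0 : ℝ) ∉ flatBands V₀ := by
  let θ : EuclideanSpace ℝ (Fin d) := EuclideanSpace.single ⟨0, hd⟩ Real.pi
  let m : Fin d → ℤ := Pi.single ⟨0, hd⟩ 1
  have hm : character θ m = -1 := by
    have : ∑ i, (m i : ℝ) * θ i = Real.pi := by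
      rw [Finset.sum_eq_single ⟨0, hd⟩]
      · simp [m, θ]
      · intro i _ hi
        simp [m, hi]
      · simp
    rw [character, this, Complex.exp_pi_mul_I]
  intro h
  have h0 : (0 : ℝ) ∈ eigs V₀ θ := Multiset.mem_of_le (flatBands_le V₀ θ) h
  obtain ⟨Y, hY, hY0⟩ := exists_mem_hopEigenspace hd h0
  rw [sub_zero] at hY
  refine hY0 (funext fun v => ?_)
  obtain ⟨x, rfl⟩ := exists_vclass v
  have h1 := norm_bloch_vadd_sub V₀ θ Y m x
  rw [bloch_const hY (m +ᵥ x) x, sub_self, norm_zero, hm] at h1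
  norm_num at h1
  exact h1

theorem numFlat_lt (hd : 1 ≤ d) (V₀ : G.FundamentalVertexSet) : 1 ≤ G.nu - numFlat V₀ := by
  rw [← card_eigs_sub V₀ 0, Nat.one_le_iff_ne_zero, Ne, Multiset.card_eq_zero]
  intro h
  have h1 : (eigs V₀ 0 - flatBands V₀).count 0 = 0 := by rw [h, Multiset.count_zero]
  rw [Multiset.count_sub, count_zero_eigs_zero hd,
    Multiset.count_eq_zero.mpr (zero_notMem_flatBands hd V₀)] at h1
  omega

theorem band_one_le (hd : 1 ≤ d) (V₀ : G.FundamentalVertexSet) {θ : EuclideanSpace ℝ (Fin d)}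
    {x : ℝ} (hx : x ∈ eigs V₀ θ - flatBands V₀) : band V₀ 1 θ ≤ x := by
  rw [band_eq_getD_sort V₀ θ le_rfl (numFlat_lt hd V₀)]
  have hp := (eigs V₀ θ - flatBands V₀).pairwise_sort (· ≤ ·)
  have hx' := (Multiset.mem_sort (r := (· ≤ ·))).mpr hx
  cases hl : (eigs V₀ θ - flatBands V₀).sort (· ≤ ·) with
  | nil =>
    rw [hl] at hx'
    simp at hx'
  | cons a l =>
    rw [hl] at hx' hp
    rcases List.mem_cons.mp hx' with rfl | h
    · simp
    · simpa using (List.pairwise_cons.mp hp).1 x h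

theorem band_one_zero (hd : 1 ≤ d) (V₀ : G.FundamentalVertexSet) : band V₀ 1 0 = 0 := by
  refine le_antisymm (band_one_le hd V₀ ?_) (band_mem_Icc hd V₀ 1 0).1
  rw [← Multiset.one_le_count_iff_mem, Multiset.count_sub, count_zero_eigs_zero hd,
    Multiset.count_eq_zero.mpr (zero_notMem_flatBands hd V₀)]

/-- By its labelling λ_1 is smallest only among the non-flat eigenvalues, while the Rayleigh bound
concerns all of them. Near θ = 0 this makes no difference, because the flat bands are positive and
λ_1 tends to 0. -/
theorem eventually_band_one_le (hd : 1 ≤ d) (V₀ : G.FundamentalVertexSet) :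
    ∀ᶠ θ in 𝓝 0, ∀ x ∈ eigs V₀ θ, band V₀ 1 θ ≤ x := by
  have hc := (continuous_band hd V₀ le_rfl (numFlat_lt hd V₀)).tendsto 0
  rw [band_one_zero hd] at hc
  have h1 : ∀ᶠ θ in 𝓝 0, ∀ x ∈ (flatBands V₀).toFinset, band V₀ 1 θ < x := by
    rw [eventually_all_finset]
    intro x hx
    rw [Multiset.mem_toFinset] at hx
    have hx0 : 0 ≤ x := (eigs_mem_Icc hd (Multiset.mem_of_le (flatBands_le V₀ 0) hx)).1
    refine hc.eventually_lt_const (lt_of_le_of_ne hx0 fun h => ?_)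
    rw [← h] at hx
    exact zero_notMem_flatBands hd V₀ hx
  filter_upwards [h1] with θ hθ x hx
  rw [← tsub_add_cancel_of_le (flatBands_le V₀ θ), Multiset.mem_add] at hx
  rcases hx with hx | hx
  · exact band_one_le hd V₀ hx
  · exact (hθ x (Multiset.mem_toFinset.mpr hx)).le

theorem analyticAt_band_one (hd : 1 ≤ d) (V₀ : G.FundamentalVertexSet) :
    AnalyticAt ℝ (band V₀ 1) 0 := by
  refine analyticAt_band hd V₀ le_rfl (numFlat_lt hd V₀) ?_
  rw [band_one_zero hd, count_zero_eigs_zero hd]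

theorem hasEffectiveForm_band_one (hd : 1 ≤ d) (V₀ : G.FundamentalVertexSet) :
    HasEffectiveForm (band V₀ 1) 0 := by
  refine (analyticAt_band_one hd V₀).hasEffectiveForm (IsLocalMin.fderiv_eq_zero ?_)
  refine Eventually.of_forall fun θ => ?_
  rw [band_one_zero hd]
  exact (band_mem_Icc hd V₀ 1 θ).1

theorem metricBand_one_zero_zero (hd : 1 ≤ d) (V₀ : G.FundamentalVertexSet) :
    metricBand V₀ 1 0 0 = 0 := by
  simp [metricBand, metricZ, band_one_zero hd]

/-- The lowest band function of the metric Laplacian near zero quasimomentum. -/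
theorem metricBand_one_zero_properties (hd : 1 ≤ d) (V₀ : G.FundamentalVertexSet) :
    AnalyticAt ℝ (metricBand V₀ 1 0) 0 ∧ HasEffectiveForm (metricBand V₀ 1 0) 0 ∧
      ∀ ω : EuclideanSpace ℝ (Fin d), ‖ω‖ = 1 →
        effectiveForm (metricBand V₀ 1 0) 0 ω = 2 * effectiveForm (band V₀ 1) 0 ω := by
  obtain ⟨h, hh, hh', heq⟩ := exists_analyticAt_arccos_sq
  have hb := analyticAt_band_one hd V₀
  have hc := hb.continuousAt.tendsto
  rw [band_one_zero hd] at hc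
  -- Here λ_1 = 0, where arccos(1 - λ) is not differentiable, so its square is replaced by its
  -- analytic extension. Only λ ≥ 0 occurs.
  have he : metricBand V₀ 1 0 =ᶠ[𝓝 0] fun θ => h (band V₀ 1 θ) := by
    filter_upwards [hc.eventually heq] with θ hθ
    rw [← hθ (band_mem_Icc hd V₀ 1 θ).1]
    simp [metricBand, metricZ]
  have hcomp : AnalyticAt ℝ (fun θ => h (band V₀ 1 θ)) 0 := by
    refine AnalyticAt.comp (g := h) ?_ hb
    rwa [band_one_zero hd]
  have ha : AnalyticAt ℝ (metricBand V₀ 1 0) 0 := hcomp.congr he.symm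
  have hf : HasEffectiveForm (metricBand V₀ 1 0) 0 := by
    refine ha.hasEffectiveForm (IsLocalMin.fderiv_eq_zero ?_)
    refine Eventually.of_forall fun θ => ?_
    rw [metricBand_one_zero_zero hd]
    exact sq_nonneg _
  refine ⟨ha, hf, fun ω hω => ?_⟩
  rw [effectiveForm_congr he]
  refine (hasEffectiveForm_band_one hd V₀).comp (hasEffectiveForm_congr he.symm hf)
    (s := Set.univ) ?_ (fun θ => Set.mem_univ _) hω
  rw [band_one_zero hd]
  exact hh'.hasDerivWithinAt

/-! ### Upper bound for the effective form of the lowest band -/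

open Classical in
theorem sum_pairing_sq (V₀ : G.FundamentalVertexSet) (O : G.Orientation)
    (ω : EuclideanSpace ℝ (Fin d)) :
    ∑ e, pairing V₀ e ω ^ 2 = 2 * ∑ e ∈ bridges V₀ O, pairing V₀ e ω ^ 2 := by
  rw [sum_orientation O]
  simp only [pairing_finv, neg_sq, ← two_mul, ← Finset.mul_sum]
  congr 1
  rw [← Finset.sum_subtype (Finset.univ.filter fun e => e ∈ O.carrier)
    (fun e => by rw [Finset.mem_filter]; exact and_iff_right (Finset.mem_univ e))
    fun e => pairing V₀ e ω ^ 2]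
  symm
  refine Finset.sum_subset (fun e he => ?_) fun e he he' => ?_
  · rw [bridges, Finset.mem_filter] at he
    exact Finset.mem_filter.mpr ⟨he.1, he.2.1⟩
  · rw [Finset.mem_filter] at he
    have h0 : index V₀ e = 0 := by
      by_contra h
      exact he' (Finset.mem_filter.mpr ⟨he.1, he.2, h⟩)
    simp [pairing, h0]

/-- The constant test function gives ϰ λ_1(εω) ≤ Σ(1 - cos ε⟨τ,ω⟩) over oriented edges. The bound 1
- cos t ≤ t²/2 and the passage to unoriented edges, a factor 2, leave ε² times the sum over bridges.
-/
theorem effectiveForm_band_one_le (hd : 1 ≤ d) (V₀ : G.FundamentalVertexSet) (O : G.Orientation)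
    {ω : EuclideanSpace ℝ (Fin d)} (hω : ‖ω‖ = 1) :
    effectiveForm (band V₀ 1) 0 ω ≤
      1 / (G.totalDeg : ℝ) * ∑ e ∈ bridges V₀ O, pairing V₀ e ω ^ 2 := by
  have hpos : (0 : ℝ) < G.totalDeg := by exact_mod_cast totalDeg_pos hd
  refine le_of_tendsto ((hasEffectiveForm_band_one hd V₀).tendsto hω) ?_
  have hc : Tendsto (fun ε : ℝ => (0 : EuclideanSpace ℝ (Fin d)) + ε • ω) (𝓝[>] 0) (𝓝 0) := by
    have : Continuous fun ε : ℝ => (0 : EuclideanSpace ℝ (Fin d)) + ε • ω := by fun_prop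
    simpa using (this.tendsto 0).mono_left nhdsWithin_le_nhds
  filter_upwards [hc.eventually (eventually_band_one_le hd V₀), self_mem_nhdsWithin]
    with ε hε hε0
  have hε0 : 0 < ε := hε0
  have h1 := le_sum_one_sub_cos hd hε
  have h2 : ∑ e, (1 - Real.cos (pairing V₀ e (0 + ε • ω))) ≤
      ∑ e, ε ^ 2 / 2 * pairing V₀ e ω ^ 2 := by
    refine Finset.sum_le_sum fun e _ => ?_
    have := Real.one_sub_sq_div_two_le_cos (x := ε * pairing V₀ e ω)
    rw [zero_add, pairing_smul]
    nlinarith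
  rw [← Finset.mul_sum, sum_pairing_sq V₀ O] at h2
  rw [band_one_zero hd, sub_zero, div_le_iff₀ (by positivity), one_div, inv_mul_eq_div,
    div_mul_eq_mul_div, le_div_iff₀ hpos]
  nlinarith

/-! ### Lower bounds for the effective form -/

/-- Eigenfunctions for small eigenvalues have almost constant modulus. -/
theorem exists_almost_constant_eigenfunction (hd : 1 ≤ d) (V₀ : G.FundamentalVertexSet) :
    ∃ C : ℝ, ∀ (θ : EuclideanSpace ℝ (Fin d)), ∀ l ∈ eigs V₀ θ, ∃ Y : G.FundVertex → ℂ,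
      (∀ v, 1 - C * Real.sqrt l ≤ ‖Y v‖) ∧ energy V₀ θ Y ≤ 2 * l * G.totalDeg := by
  choose rep hrep using fun v : G.FundVertex => exists_vclass v
  choose N hN using fun u v : G.FundVertex => exists_norm_bloch_sub_le V₀ (rep u) (rep v)
  let N₀ : ℝ := ∑ u, ∑ v, (N u v : ℝ)
  have hN₀ : ∀ u v, (N u v : ℝ) ≤ N₀ := fun u v =>
    (Finset.single_le_sum (f := fun v => (N u v : ℝ)) (fun _ _ => by positivity)
      (Finset.mem_univ v)).trans
      (Finset.single_le_sum (f := fun u => ∑ v, (N u v : ℝ)) (fun _ _ => by positivity)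
      (Finset.mem_univ u))
  refine ⟨N₀ * Real.sqrt (2 * G.totalDeg), fun θ l hl => ?_⟩
  obtain ⟨Z, hZ, hZ0⟩ := exists_mem_hopEigenspace hd hl
  have hne : (Finset.univ : Finset G.FundVertex).Nonempty := by
    obtain ⟨x⟩ := G.nonempty
    exact ⟨G.vclass x, Finset.mem_univ _⟩
  obtain ⟨u, -, hu⟩ := Finset.exists_max_image Finset.univ (fun v => ‖Z v‖) hne
  have hu0 : 0 < ‖Z u‖ := by
    obtain ⟨v, hv⟩ := Function.ne_iff.mp hZ0
    exact (norm_pos_iff.mpr hv).trans_le (hu v (Finset.mem_univ v))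
  -- The normalization max |Y| = 1 bounds the energy by 2lϰ. A path of bounded length then keeps |Y|
  -- within a constant times √l of its maximum.
  let Y : G.FundVertex → ℂ := ((‖Z u‖⁻¹ : ℝ) : ℂ) • Z
  have hY : Y ∈ hopEigenspace V₀ θ (1 - l) := Submodule.smul_mem _ _ hZ
  have hYn : ∀ v, ‖Y v‖ = ‖Z v‖ / ‖Z u‖ := fun v => by
    simp only [Y, Pi.smul_apply, smul_eq_mul, norm_mul, Complex.norm_real, norm_inv, norm_norm]
    rw [inv_mul_eq_div]
  have hYu : ‖Y u‖ = 1 := by rw [hYn, div_self hu0.ne']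
  have hYle : ∀ v, ‖Y v‖ ≤ 1 := fun v => by
    rw [hYn, div_le_one hu0]
    exact hu v (Finset.mem_univ v)
  have hl0 : 0 ≤ l := (eigs_mem_Icc hd hl).1
  have hE : energy V₀ θ Y ≤ 2 * l * G.totalDeg := by
    rw [energy_of_mem_hopEigenspace hY, sub_sub_cancel, totalDeg]
    refine mul_le_mul_of_nonneg_left ?_ (by positivity)
    push_cast
    refine Finset.sum_le_sum fun v _ => ?_
    have := pow_le_one₀ (n := 2) (norm_nonneg _) (hYle v)
    exact mul_le_of_le_one_right (by positivity) this
  refine ⟨Y, fun v => ?_, hE⟩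
  have h1 := hN u v θ Y
  have h2 : ‖Y u‖ - ‖Y v‖ ≤ ‖bloch V₀ θ Y (rep u) - bloch V₀ θ Y (rep v)‖ := by
    refine le_trans (le_of_eq ?_) (norm_sub_norm_le _ _)
    rw [norm_bloch, norm_bloch, hrep, hrep]
  have h3 : (N u v : ℝ) * Real.sqrt (energy V₀ θ Y) ≤
      N₀ * (Real.sqrt (2 * G.totalDeg) * Real.sqrt l) := by
    rw [← Real.sqrt_mul (by positivity)]
    refine mul_le_mul (hN₀ u v) (Real.sqrt_le_sqrt (hE.trans (le_of_eq (by ring))))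
      (Real.sqrt_nonneg _) (Finset.sum_nonneg fun _ _ => Finset.sum_nonneg fun _ _ => by positivity)
  rw [hYu] at h2
  rw [mul_assoc]
  linarith

theorem tendsto_norm_character_sub_one (ω : EuclideanSpace ℝ (Fin d)) (m : Fin d → ℤ) :
    Tendsto (fun ε : ℝ => ‖character (0 + ε • ω) m - 1‖ ^ 2 / ε ^ 2) (𝓝[>] 0)
      (𝓝 ((∑ i, (m i : ℝ) * ω i) ^ 2)) := by
  set a : ℝ := ∑ i, (m i : ℝ) * ω i
  have h1 : ∀ ε : ℝ, character (0 + ε • ω) m = Complex.exp ((ε * a : ℝ) * Complex.I) := fun ε => by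
    rw [character]
    congr 3
    rw [Finset.mul_sum]
    refine Finset.sum_congr rfl fun i _ => ?_
    simp only [zero_add, PiLp.smul_apply, smul_eq_mul]
    ring
  have hd : HasDerivAt (fun ε : ℝ => Complex.exp ((ε * a : ℝ) * Complex.I)) (a * Complex.I) 0 := by
    have h2 : HasDerivAt (fun ε : ℝ => ((ε * a : ℝ) : ℂ) * Complex.I) (a * Complex.I) 0 := by
      have := ((hasDerivAt_id (0 : ℝ)).mul_const a).ofReal_comp.mul_const Complex.I
      simpa using this
    simpa using h2.cexp
  have h3 := (hd.tendsto_slope_zero_right.norm).pow 2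
  have h4 : ‖(a : ℂ) * Complex.I‖ ^ 2 = a ^ 2 := by
    rw [norm_mul, Complex.norm_I, mul_one, Complex.norm_real, Real.norm_eq_abs, sq_abs]
  rw [h4] at h3
  refine h3.congr fun ε => ?_
  rw [h1, norm_smul, mul_pow, norm_inv, inv_pow, Real.norm_eq_abs, sq_abs, inv_mul_eq_div]
  simp

/-- A lower bound of the energy in terms of the differences of Bloch functions along translations
gives a lower bound of the effective form. -/
theorem sum_sq_le_effectiveForm (hd : 1 ≤ d) (V₀ : G.FundamentalVertexSet) {ι : Type*}
    [Fintype ι] (m : ι → Fin d → ℤ) (x : ι → V) {K : ℝ}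
    (hK : ∀ (θ : EuclideanSpace ℝ (Fin d)) (Y : G.FundVertex → ℂ),
      ∑ i, ‖bloch V₀ θ Y (m i +ᵥ x i) - bloch V₀ θ Y (x i)‖ ^ 2 ≤ K * (energy V₀ θ Y / 2))
    (hK0 : 0 ≤ K) {ω : EuclideanSpace ℝ (Fin d)} (hω : ‖ω‖ = 1) :
    ∑ i, (∑ k, (m i k : ℝ) * ω k) ^ 2 ≤ K * (G.totalDeg * effectiveForm (band V₀ 1) 0 ω) := by
  obtain ⟨C, hC⟩ := exists_almost_constant_eigenfunction hd V₀
  have hc : Tendsto (fun ε : ℝ => (0 : EuclideanSpace ℝ (Fin d)) + ε • ω) (𝓝[>] 0) (𝓝 0) := by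
    have : Continuous fun ε : ℝ => (0 : EuclideanSpace ℝ (Fin d)) + ε • ω := by fun_prop
    simpa using (this.tendsto 0).mono_left nhdsWithin_le_nhds
  have hb : Tendsto (fun ε : ℝ => band V₀ 1 (0 + ε • ω)) (𝓝[>] 0) (𝓝 0) := by
    have := ((continuous_band hd V₀ le_rfl (numFlat_lt hd V₀)).tendsto 0).comp hc
    rwa [band_one_zero hd] at this
  -- This lower bound for |Y| tends to 1, so it disappears in the limit ε → 0.
  have hw : Tendsto (fun ε : ℝ => 1 - C * Real.sqrt (band V₀ 1 (0 + ε • ω))) (𝓝[>] 0) (𝓝 1) := by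
    have := ((Real.continuous_sqrt.tendsto 0).comp hb).const_mul C
    simpa using this.const_sub 1
  have h1 : Tendsto (fun ε : ℝ => (1 - C * Real.sqrt (band V₀ 1 (0 + ε • ω))) ^ 2 *
      ∑ i, ‖character (0 + ε • ω) (m i) - 1‖ ^ 2 / ε ^ 2) (𝓝[>] 0)
      (𝓝 (1 ^ 2 * ∑ i, (∑ k, (m i k : ℝ) * ω k) ^ 2)) :=
    (hw.pow 2).mul (tendsto_finsetSum _ fun i _ => tendsto_norm_character_sub_one ω (m i))
  rw [one_pow, one_mul] at h1
  have h2 := (((hasEffectiveForm_band_one hd V₀).tendsto hω).const_mul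
    (G.totalDeg : ℝ)).const_mul K
  refine le_of_tendsto_of_tendsto h1 h2 ?_
  filter_upwards [self_mem_nhdsWithin, hw.eventually_const_lt zero_lt_one] with ε hε hw0
  have hε : 0 < ε := hε
  have hnu : 1 ≤ G.nu := nu_pos
  obtain ⟨Y, hY1, hY2⟩ := hC (0 + ε • ω) _ (band_mem_eigs V₀ (0 + ε • ω) le_rfl hnu)
  have h3 := hK (0 + ε • ω) Y
  simp only [norm_bloch_vadd_sub, mul_pow] at h3
  have h4 : (1 - C * Real.sqrt (band V₀ 1 (0 + ε • ω))) ^ 2 *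
      ∑ i, ‖character (0 + ε • ω) (m i) - 1‖ ^ 2 ≤
      K * (band V₀ 1 (0 + ε • ω) * G.totalDeg) := by
    refine le_trans ?_ (h3.trans (mul_le_mul_of_nonneg_left (by linarith) hK0))
    rw [Finset.mul_sum]
    refine Finset.sum_le_sum fun i _ => ?_
    rw [mul_comm]
    refine mul_le_mul_of_nonneg_left ?_ (by positivity)
    exact pow_le_pow_left₀ hw0.le (hY1 _) 2
  rw [← Finset.sum_div, mul_div_assoc', band_one_zero hd, sub_zero]
  rw [mul_div_assoc', mul_div_assoc', div_le_div_iff_of_pos_right (by positivity)]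
  linarith

/-- For translations by the standard basis vectors the left side of `sum_sq_le_effectiveForm` is
|ω|² = 1, and paths from a vertex to its translates supply some finite constant. -/
theorem effectiveForm_band_one_pos (hd : 1 ≤ d) (V₀ : G.FundamentalVertexSet)
    {ω : EuclideanSpace ℝ (Fin d)} (hω : ‖ω‖ = 1) : 0 < effectiveForm (band V₀ 1) 0 ω := by
  obtain ⟨x⟩ := G.nonempty
  let m : Fin d → Fin d → ℤ := fun i => Pi.single i 1
  choose N hN using fun i : Fin d => exists_norm_bloch_sub_le V₀ (m i +ᵥ x) x
  have h := sum_sq_le_effectiveForm hd V₀ m (fun _ => x) (K := ∑ i, 2 * (N i : ℝ) ^ 2)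
    (fun θ Y => ?_) (by positivity) hω
  · have h1 : ∑ i, (∑ k, (m i k : ℝ) * ω k) ^ 2 = 1 := by
      have h2 : ∀ i, ∑ k, (m i k : ℝ) * ω k = ω i := fun i => by
        rw [Finset.sum_eq_single i]
        · simp [m]
        · intro k _ hk
          simp [m, hk]
        · simp
      simp only [h2]
      have := EuclideanSpace.norm_sq_eq ω
      rw [hω] at this
      simpa using this.symm
    rw [h1] at h
    by_contra hneg
    have hpos : (0 : ℝ) ≤ G.totalDeg := by positivity
    have : (∑ i, 2 * (N i : ℝ) ^ 2) * (G.totalDeg * effectiveForm (band V₀ 1) 0 ω) ≤ 0 :=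
      mul_nonpos_of_nonneg_of_nonpos (by positivity)
        (mul_nonpos_of_nonneg_of_nonpos hpos (not_lt.mp hneg))
    linarith
  · rw [Finset.sum_mul]
    refine Finset.sum_le_sum fun i _ => ?_
    have h1 := pow_le_pow_left₀ (norm_nonneg _) (hN i θ Y) 2
    rw [mul_pow, Real.sq_sqrt (energy_nonneg V₀ θ Y)] at h1
    linarith

/-! ### Tree-like fundamental vertex sets and the energy of single edges -/

theorem coord_eq_zero {V₀ : G.FundamentalVertexSet} {x : V} (hx : x ∈ V₀.carrier) :
    coord V₀ x = 0 := coord_eq V₀ hx (zero_vadd _ x)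

theorem vclass_injOn (V₀ : G.FundamentalVertexSet) : Set.InjOn G.vclass V₀.carrier := by
  intro x hx y hy h
  obtain ⟨m, hm⟩ := vclass_eq_iff.mp h
  exact (V₀.existsUnique x).unique ⟨hx, 0, zero_vadd _ x⟩ ⟨hy, m, hm⟩

theorem vclass_bijective (V₀ : G.FundamentalVertexSet) :
    Function.Bijective fun x : V₀.carrier => G.vclass x := by
  refine ⟨fun x y h => Subtype.ext (vclass_injOn V₀ x.2 y.2 h), fun v => ?_⟩
  obtain ⟨x, rfl⟩ := exists_vclass v
  obtain ⟨x₀, h0, h1⟩ := coord_spec V₀ x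
  exact ⟨⟨x₀, h0⟩, by rw [← h1, vclass_vadd]⟩

/-- The endpoints of an edge of the fundamental graph. -/
def ends (G : PeriodicGraph d V A) (e : G.FundEdge) : Sym2 G.FundVertex := s(G.fsrc e, G.ftgt e)

/-- The contribution of an edge to the energy. -/
noncomputable def edgeEnergy (V₀ : G.FundamentalVertexSet) (θ : EuclideanSpace ℝ (Fin d))
    (Y : G.FundVertex → ℂ) (e : G.FundEdge) : ℝ :=
  ‖Y (G.fsrc e) - phase V₀ θ e * Y (G.ftgt e)‖ ^ 2

theorem edgeEnergy_eclass (V₀ : G.FundamentalVertexSet) (θ : EuclideanSpace ℝ (Fin d))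
    (Y : G.FundVertex → ℂ) (a : A) : edgeEnergy V₀ θ Y (G.eclass a) =
      ‖bloch V₀ θ Y (G.src a) - bloch V₀ θ Y (G.tgt a)‖ ^ 2 := by
  rw [norm_bloch_sub, edgeEnergy]

theorem edgeEnergy_finv (V₀ : G.FundamentalVertexSet) (θ : EuclideanSpace ℝ (Fin d))
    (Y : G.FundVertex → ℂ) (e : G.FundEdge) :
    edgeEnergy V₀ θ Y (G.finv e) = edgeEnergy V₀ θ Y e := by
  obtain ⟨a, rfl⟩ := exists_eclass e
  rw [finv_eclass, edgeEnergy_eclass, edgeEnergy_eclass, G.src_inv, tgt_inv, norm_sub_rev]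

theorem ends_finv (e : G.FundEdge) : G.ends (G.finv e) = G.ends e := by
  rw [ends, ends, fsrc_finv, ftgt_finv, Sym2.eq_swap]

open Classical in
theorem half_energy_eq (V₀ : G.FundamentalVertexSet) (O : G.Orientation)
    (θ : EuclideanSpace ℝ (Fin d)) (Y : G.FundVertex → ℂ) :
    energy V₀ θ Y / 2 = ∑ e with e ∈ O.carrier, edgeEnergy V₀ θ Y e := by
  have h : energy V₀ θ Y = ∑ e, edgeEnergy V₀ θ Y e := rfl
  rw [h, sum_orientation O]
  simp only [edgeEnergy_finv, ← two_mul, ← Finset.mul_sum]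
  rw [← Finset.sum_subtype (Finset.univ.filter fun e => e ∈ O.carrier)
    (fun e => by rw [Finset.mem_filter]; exact and_iff_right (Finset.mem_univ e))
    fun e => edgeEnergy V₀ θ Y e]
  ring

theorem exists_oriented (V₀ : G.FundamentalVertexSet) (O : G.Orientation) (e : G.FundEdge) :
    ∃ o ∈ O.carrier, G.ends o = G.ends e ∧ (index V₀ o = 0 ↔ index V₀ e = 0) ∧
      ∀ θ Y, edgeEnergy V₀ θ Y o = edgeEnergy V₀ θ Y e := by
  by_cases h : e ∈ O.carrier
  · exact ⟨e, h, rfl, Iff.rfl, fun _ _ => rfl⟩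
  · exact ⟨G.finv e, not_not.mp ((O.mem_iff e).not.mp h), ends_finv e, by simp [index_finv],
      fun θ Y => edgeEnergy_finv V₀ θ Y e⟩

theorem norm_sub_le_sum_edges {W E : Type*} [SeminormedAddCommGroup E] {H : SimpleGraph W}
    (ψ : W → E) (δ : Sym2 W → ℝ) (hδ : ∀ x y, δ s(x, y) = ‖ψ x - ψ y‖) {u w : W}
    (p : H.Walk u w) : ‖ψ u - ψ w‖ ≤ (p.edges.map δ).sum := by
  induction p with
  | nil => simp
  | cons h p ih =>
    rw [SimpleGraph.Walk.edges_cons, List.map_cons, List.sum_cons, hδ]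
    exact (norm_sub_le_norm_sub_add_norm_sub _ _ _).trans (by gcongr)

open Classical in
/-- In a tree-like fundamental vertex set a bridge closes a cycle with at most `ν` edges. -/
theorem norm_bloch_index_sub_sq_le {V₀ : G.FundamentalVertexSet} (O : G.Orientation)
    (hT : V₀.IsTree) {e : G.FundEdge} (he : index V₀ e ≠ 0) :
    ∃ x : V, ∀ (θ : EuclideanSpace ℝ (Fin d)) (Y : G.FundVertex → ℂ),
      ‖bloch V₀ θ Y (index V₀ e +ᵥ x) - bloch V₀ θ Y x‖ ^ 2 ≤
        G.nu * (energy V₀ θ Y / 2) := by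
  obtain ⟨T, hTv, hTt⟩ := hT
  -- The bridge is lifted so as to start in V₀. It then ends at w translated by the index, with w in
  -- V₀, and a path in the tree joins its start to w.
  obtain ⟨a, ha, hau⟩ : ∃ a, G.eclass a = e ∧ G.src a ∈ V₀.carrier := by
    obtain ⟨a, rfl⟩ := exists_eclass e
    obtain ⟨u, hu, hc⟩ := coord_spec V₀ (G.src a)
    refine ⟨-coord V₀ (G.src a) +ᵥ a, eclass_vadd _ _, ?_⟩
    rw [G.src_vadd]
    nth_rewrite 2 [← hc]
    rwa [neg_vadd_vadd]
  obtain ⟨w, hw, hwc⟩ := coord_spec V₀ (G.tgt a)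
  have hidx : index V₀ e = coord V₀ (G.tgt a) := by
    rw [← ha, index_eclass, coord_eq_zero hau, sub_zero]
  refine ⟨w, fun θ Y => ?_⟩
  rw [hidx, hwc]
  let ψ : T.verts → ℂ := fun x => bloch V₀ θ Y x
  let δ : Sym2 T.verts → ℝ := Sym2.lift ⟨fun x y => ‖ψ x - ψ y‖, fun x y => norm_sub_rev _ _⟩
  have hδ : ∀ x y, δ s(x, y) = ‖ψ x - ψ y‖ := fun x y => rfl
  let u' : T.verts := ⟨G.src a, by rw [hTv]; exact hau⟩
  let w' : T.verts := ⟨w, by rw [hTv]; exact hw⟩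
  obtain ⟨p, hp⟩ := (hTt.connected.preconnected u' w').exists_isPath
  let S : Finset (Sym2 T.verts) := p.edges.toFinset
  have hnd : p.edges.Nodup := hp.isTrail.edges_nodup
  let eqv : T.verts ≃ G.FundVertex :=
    (Equiv.setCongr hTv).trans (Equiv.ofBijective _ (vclass_bijective V₀))
  have heqv : ∀ x, eqv x = G.vclass x := fun x => rfl
  have : Fintype T.verts := Fintype.ofEquiv _ eqv.symm
  have hcardT : Fintype.card T.verts = G.nu := Fintype.card_congr eqv
  have hcardS : S.card + 1 ≤ G.nu := by
    rw [List.toFinset_card_of_nodup hnd, SimpleGraph.Walk.length_edges, ← hcardT]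
    exact hp.length_lt
  have h1 : ‖ψ u' - ψ w'‖ ≤ ∑ s ∈ S, δ s := by
    rw [List.sum_toFinset δ hnd]
    exact norm_sub_le_sum_edges ψ δ hδ p
  -- Tree edges join vertices of V₀, so their classes have index zero and cannot be confused with
  -- the bridge.
  have hlift : ∀ s ∈ S, ∃ o ∈ O.carrier, G.ends o = s.map eqv ∧ index V₀ o = 0 ∧
      edgeEnergy V₀ θ Y o = δ s ^ 2 := by
    intro s hs
    have hadj : s ∈ T.coe.edgeSet := p.edges_subset_edgeSet (List.mem_toFinset.mp hs)
    induction s with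
    | _ x y =>
      have hadj' : T.Adj x y := hadj
      obtain ⟨-, b, hb1, hb2⟩ := T.adj_sub hadj'
      have hx : (x : V) ∈ V₀.carrier := hTv ▸ x.2
      have hy : (y : V) ∈ V₀.carrier := hTv ▸ y.2
      obtain ⟨o, ho, ho1, ho2, ho3⟩ := exists_oriented V₀ O (G.eclass b)
      refine ⟨o, ho, ?_, ?_, ?_⟩
      · rw [ho1, ends, fsrc_eclass, ftgt_eclass, hb1, hb2, Sym2.map_mk, heqv, heqv]
      · rw [ho2, index_eclass, hb1, hb2, coord_eq_zero hx, coord_eq_zero hy, sub_zero]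
      · rw [ho3, edgeEnergy_eclass, hb1, hb2, hδ]
  have : Nonempty G.FundEdge := ⟨e⟩
  choose! g hg1 hg2 hg3 hg4 using hlift
  -- Vertices of the tree correspond bijectively to V_*, so different tree edges have different
  -- endpoint pairs in the fundamental graph. No edge is counted twice in the energy.
  have hginj : Set.InjOn g S := fun s hs t ht hst => by
    refine Sym2.map.injective eqv.injective ?_
    rw [← hg2 s hs, ← hg2 t ht, hst]
  have h2 : ∑ s ∈ S, δ s ^ 2 ≤
      ∑ o with o ∈ O.carrier ∧ index V₀ o = 0, edgeEnergy V₀ θ Y o := by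
    rw [Finset.sum_congr rfl fun s hs => (hg4 s hs).symm, ← Finset.sum_image hginj]
    refine Finset.sum_le_sum_of_subset_of_nonneg (fun o ho => ?_) fun o _ _ => sq_nonneg _
    obtain ⟨s, hs, rfl⟩ := Finset.mem_image.mp ho
    exact Finset.mem_filter.mpr ⟨Finset.mem_univ _, hg1 s hs, hg3 s hs⟩
  have h3 : ‖bloch V₀ θ Y (G.src a) - bloch V₀ θ Y (G.tgt a)‖ ^ 2 ≤
      ∑ o with o ∈ O.carrier ∧ ¬ index V₀ o = 0, edgeEnergy V₀ θ Y o := by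
    obtain ⟨o, ho, -, ho2, ho3⟩ := exists_oriented V₀ O e
    rw [← edgeEnergy_eclass, ha, ← ho3]
    exact Finset.single_le_sum (f := fun o => edgeEnergy V₀ θ Y o) (fun o _ => sq_nonneg _)
      (Finset.mem_filter.mpr ⟨Finset.mem_univ _, ho, ho2.not.mpr he⟩)
  have h4 : energy V₀ θ Y / 2 =
      ∑ o with o ∈ O.carrier ∧ index V₀ o = 0, edgeEnergy V₀ θ Y o +
      ∑ o with o ∈ O.carrier ∧ ¬ index V₀ o = 0, edgeEnergy V₀ θ Y o := by
    rw [half_energy_eq V₀ O, ← Finset.filter_filter, ← Finset.filter_filter,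
      Finset.sum_filter_add_sum_filter_not]
  -- The value `none` stands for the bridge. With the at most ν - 1 path edges there are at most ν
  -- terms, which is the factor in Cauchy–Schwarz.
  have h5 : ‖bloch V₀ θ Y (G.tgt a) - bloch V₀ θ Y w‖ ≤
      ∑ s ∈ S.insertNone,
        s.elim ‖bloch V₀ θ Y (G.src a) - bloch V₀ θ Y (G.tgt a)‖ δ := by
    rw [Finset.sum_insertNone]
    refine (norm_sub_le_norm_sub_add_norm_sub _ (bloch V₀ θ Y (G.src a)) _).trans ?_
    rw [norm_sub_rev (bloch V₀ θ Y (G.tgt a))]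
    exact add_le_add le_rfl h1
  have h6 := sq_sum_le_card_mul_sum_sq (s := S.insertNone)
    (f := fun s => s.elim ‖bloch V₀ θ Y (G.src a) - bloch V₀ θ Y (G.tgt a)‖ δ)
  refine (pow_le_pow_left₀ (norm_nonneg _) h5 2).trans (h6.trans ?_)
  rw [Finset.card_insertNone, Finset.sum_insertNone]
  refine mul_le_mul (by exact_mod_cast hcardS) ?_ (by positivity) (by positivity)
  rw [h4, add_comm]
  exact add_le_add h2 h3

end PeriodicGraph

/-! ### Quadratic forms -/

/-- The effective form of an analytic function is a quadratic form. -/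
theorem AnalyticAt.exists_effectiveForm_eq {d : ℕ} {F : EuclideanSpace ℝ (Fin d) → ℝ}
    {θ₀ : EuclideanSpace ℝ (Fin d)} (hF : AnalyticAt ℝ F θ₀) :
    ∃ M : Matrix (Fin d) (Fin d) ℝ, M.IsHermitian ∧
      ∀ ω : EuclideanSpace ℝ (Fin d), effectiveForm F θ₀ ω = ω.ofLp ⬝ᵥ M.mulVec ω.ofLp := by
  let B := fderiv ℝ (fderiv ℝ F) θ₀
  let b : Fin d → EuclideanSpace ℝ (Fin d) := fun i => EuclideanSpace.single i 1
  -- Symmetrizing makes the matrix Hermitian without appeal to the symmetry of the second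
  -- derivative. The factor 1/4 is 1/2 from the effective form times 1/2 from the average.
  refine ⟨Matrix.of fun i j => 1 / 4 * (B (b i) (b j) + B (b j) (b i)), ?_, fun ω => ?_⟩
  · refine Matrix.IsHermitian.ext fun i j => ?_
    simp [add_comm]
  · have hω : ω = ∑ i, ω i • b i := by
      ext j
      simp [b, Pi.single_apply]
    have hB : B ω ω = ∑ i, ∑ j, ω i * ω j * B (b i) (b j) := by
      conv_lhs => rw [hω]
      simp only [map_sum, map_smul, sum_apply,
        smul_apply, smul_eq_mul, Finset.mul_sum]
      rw [Finset.sum_comm]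
      refine Finset.sum_congr rfl fun i _ => Finset.sum_congr rfl fun j _ => by ring
    have hB' : B ω ω = ∑ i, ∑ j, ω i * ω j * B (b j) (b i) := by
      rw [hB, Finset.sum_comm]
      exact Finset.sum_congr rfl fun i _ => Finset.sum_congr rfl fun j _ => by ring
    rw [hF.effectiveForm_eq]
    change 1 / 2 * B ω ω = _
    have h2 : 1 / 2 * B ω ω = 1 / 4 * (B ω ω + B ω ω) := by ring
    rw [h2]
    nth_rewrite 1 [hB]
    rw [hB']
    simp only [dotProduct, Matrix.mulVec, Matrix.of_apply, Finset.mul_sum,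
      ← Finset.sum_add_distrib]
    exact Finset.sum_congr rfl fun i _ => Finset.sum_congr rfl fun j _ => by ring

theorem Matrix.posDef_of_unit_sphere {d : ℕ} {M : Matrix (Fin d) (Fin d) ℝ} (hM : M.IsHermitian)
    (h : ∀ ω : EuclideanSpace ℝ (Fin d), ‖ω‖ = 1 → 0 < ω.ofLp ⬝ᵥ M.mulVec ω.ofLp) :
    M.PosDef := by
  refine Matrix.PosDef.of_dotProduct_mulVec_pos hM fun x hx => ?_
  let y : EuclideanSpace ℝ (Fin d) := WithLp.toLp 2 x
  have hy : ‖y‖ ≠ 0 := by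
    rw [norm_ne_zero_iff]
    exact fun h0 => hx (by simpa [y] using h0)
  have h1 := h (‖y‖⁻¹ • y) (by rw [norm_smul, norm_inv, norm_norm, inv_mul_cancel₀ hy])
  rw [WithLp.ofLp_smul, Matrix.mulVec_smul, dotProduct_smul, smul_dotProduct, smul_eq_mul,
    smul_eq_mul] at h1
  have h2 : 0 < ‖y‖⁻¹ := inv_pos.mpr (lt_of_le_of_ne (norm_nonneg _) hy.symm)
  exact (mul_pos_iff_of_pos_left h2).mp ((mul_pos_iff_of_pos_left h2).mp h1)

theorem Matrix.isHermitian_real_gram {m n : Type*} [Fintype m] (T : Matrix m n ℝ) :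
    (T.transpose * T).IsHermitian := by
  have := Matrix.isHermitian_conjTranspose_mul_self T
  rwa [Matrix.conjTranspose_eq_transpose_of_trivial] at this

/-! ### Extreme eigenvalues of Gram matrices -/

section Gram

variable {m n : Type*} [Fintype m] [Fintype n] (T : Matrix m n ℝ)

theorem Matrix.dotProduct_transpose_mul_self (x : n → ℝ) :
    x ⬝ᵥ (T.transpose * T).mulVec x = ∑ i, T.mulVec x i ^ 2 := by
  rw [← Matrix.mulVec_mulVec, Matrix.dotProduct_mulVec, Matrix.vecMul_transpose, dotProduct]
  exact Finset.sum_congr rfl fun i _ => by ring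

theorem Matrix.le_sum_mulVec_sq [DecidableEq n] {l : ℝ} (hl : IsLeast (spectrum ℝ (T.transpose * T)) l)
    (x : n → ℝ) : l * ∑ i, x i ^ 2 ≤ ∑ i, T.mulVec x i ^ 2 := by
  have h := (Matrix.isHermitian_real_gram T).le_re_dotProduct_mulVec (m := l)
    (fun y hy => hl.2 ((Matrix.isHermitian_real_gram T).eigenvalue_mem_spectrum hy)) x
  rw [← Matrix.dotProduct_transpose_mul_self]
  simpa using h

/-- The upper bound is the lower Rayleigh bound for the negated matrix. -/
theorem Matrix.sum_mulVec_sq_le [DecidableEq n] {l : ℝ} (hl : IsGreatest (spectrum ℝ (T.transpose * T)) l)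
    (x : n → ℝ) : ∑ i, T.mulVec x i ^ 2 ≤ l * ∑ i, x i ^ 2 := by
  have hH := (Matrix.isHermitian_real_gram T).neg
  have h := hH.le_re_dotProduct_mulVec (m := -l) (fun y hy => by
    have h1 := hH.eigenvalue_mem_spectrum hy
    rw [← spectrum.neg_eq, Set.mem_neg] at h1
    linarith [hl.2 h1]) x
  rw [← Matrix.dotProduct_transpose_mul_self]
  rw [Matrix.neg_mulVec, dotProduct_neg] at h
  simp only [RCLike.re_to_real, Real.norm_eq_abs, sq_abs, star_trivial] at h
  linarith

theorem Matrix.pos_of_mem_spectrum_gram [DecidableEq n] {l : ℝ} (hT : Function.Injective T.mulVec)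
    (hl : l ∈ spectrum ℝ (T.transpose * T)) : 0 < l := by
  rw [← Matrix.spectrum_toLin', ← Module.End.hasEigenvalue_iff_mem_spectrum] at hl
  obtain ⟨x, hx⟩ := hl.exists_hasEigenvector
  have h1 : (T.transpose * T).mulVec x = l • x := by
    simpa using hx.apply_eq_smul
  have h2 := Matrix.dotProduct_transpose_mul_self T x
  rw [h1, dotProduct_smul, smul_eq_mul] at h2
  have h3 : 0 < x ⬝ᵥ x := by
    rw [← star_trivial x]
    exact Matrix.dotProduct_star_self_pos_iff.mpr hx.2
  have h4 : 0 < ∑ i, T.mulVec x i ^ 2 := by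
    have h5 : T.mulVec x ≠ 0 := fun h0 => hx.2 (hT (by rw [h0, Matrix.mulVec_zero]))
    obtain ⟨i, hi⟩ := Function.ne_iff.mp h5
    exact Finset.sum_pos' (fun _ _ => sq_nonneg _) ⟨i, Finset.mem_univ _, by
      have : T.mulVec x i ≠ 0 := hi
      positivity⟩
  rw [← h2] at h4
  exact (mul_pos_iff_of_pos_right h3).mp h4

end Gram

/-! ### Independent bridges and the final assembly -/

namespace PeriodicGraph

variable {d : ℕ} {V A : Type*} [AddAction (Fin d → ℤ) V] [AddAction (Fin d → ℤ) A]
  {G : PeriodicGraph d V A}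

theorem mem_bridges {V₀ : G.FundamentalVertexSet} {O : G.Orientation} {e : G.FundEdge} :
    e ∈ bridges V₀ O ↔ e ∈ O.carrier ∧ index V₀ e ≠ 0 := by
  simp [bridges]

theorem indexMatrix_mulVec (V₀ : G.FundamentalVertexSet) {ι : Type*} (b : ι → G.FundEdge)
    (ω : EuclideanSpace ℝ (Fin d)) (i : ι) :
    (indexMatrix V₀ b).mulVec ω.ofLp i = pairing V₀ (b i) ω := rfl

/-- If the bridge indices did not span, some unit ω would be orthogonal to all of them. The upper
bound would then make the effective form of λ_1 at ω nonpositive, contradicting its positivity. A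
basis is extracted from the spanning family. -/
theorem exists_linearIndependent_bridges (hd : 1 ≤ d) (V₀ : G.FundamentalVertexSet)
    (O : G.Orientation) : ∃ b : Fin d → G.FundEdge,
      (∀ s, b s ∈ bridges V₀ O) ∧ LinearIndependent ℝ (indexMatrix V₀ b).row := by
  let r : bridges V₀ O → Fin d → ℝ := (indexMatrix V₀ fun e : bridges V₀ O => (e : G.FundEdge)).row
  have hspan : Submodule.span ℝ (Set.range r) = ⊤ := by
    by_contra hne
    obtain ⟨f, hf, hle⟩ := Submodule.exists_le_ker_of_lt_top _ (lt_top_iff_ne_top.mpr hne)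
    let ω : EuclideanSpace ℝ (Fin d) := WithLp.toLp 2 fun i =>
      f fun j => if i = j then 1 else 0
    have hfω : ∀ x : Fin d → ℝ, f x = ∑ i, x i * ω i := fun x => by
      rw [LinearMap.pi_apply_eq_sum_univ f x]
      rfl
    have hω : ‖ω‖ ≠ 0 := by
      rw [norm_ne_zero_iff]
      refine fun h0 => hf (LinearMap.ext fun x => ?_)
      rw [hfω, h0]
      simp
    let ω' := ‖ω‖⁻¹ • ω
    have hω' : ‖ω'‖ = 1 := by rw [norm_smul, norm_inv, norm_norm, inv_mul_cancel₀ hω]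
    have h1 := (effectiveForm_band_one_pos hd V₀ hω').trans_le
      (effectiveForm_band_one_le hd V₀ O hω')
    have h2 : ∑ e ∈ bridges V₀ O, pairing V₀ e ω' ^ 2 = 0 := by
      refine Finset.sum_eq_zero fun e he => ?_
      have h3 : f (r ⟨e, he⟩) = 0 := hle (Submodule.subset_span ⟨⟨e, he⟩, rfl⟩)
      rw [hfω] at h3
      have h4 : pairing V₀ e ω = 0 := h3
      rw [pairing_smul, h4]
      simp
    rw [h2, mul_zero] at h1
    exact lt_irrefl _ h1
  obtain ⟨κ, a, -, hs, hli⟩ := exists_linearIndependent' ℝ r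
  rw [hspan] at hs
  let B : Module.Basis κ ℝ (Fin d → ℝ) := Module.Basis.mk hli hs.ge
  have : Fintype κ := FiniteDimensional.fintypeBasisIndex B
  have hcard : Fintype.card κ = d := by
    rw [← Module.finrank_eq_card_basis B, Module.finrank_fin_fun]
  let eqv : Fin d ≃ κ := (Fintype.equivFinOfCardEq hcard).symm
  exact ⟨fun s => (a (eqv s) : G.FundEdge), fun s => (a (eqv s)).2,
    hli.comp eqv eqv.injective⟩

end PeriodicGraph

open PeriodicGraph in
theorem theorem3p1 {d : ℕ} (hd : 2 ≤ d) {V A : Type*}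
    [AddAction (Fin d → ℤ) V] [AddAction (Fin d → ℤ) A]
    (G : PeriodicGraph d V A) (V₀ : G.FundamentalVertexSet) (O : G.Orientation) :
    -- outside `{(πk)² : k ≠ 0}`, the `E_{n,j}(θ)` are the eigenvalues of `Δ_M(θ)` with multiplicity
    (∀ (θ : EuclideanSpace ℝ (Fin d)) (E : ℝ), (∀ k : ℤ, k ≠ 0 → E ≠ (Real.pi * k) ^ 2) →
      Module.Finite ℂ (metricEigenspace V₀ O θ E) ∧
      Module.finrank ℂ (metricEigenspace V₀ O θ E) =
        Nat.card {q : ℕ × ℕ // 1 ≤ q.1 ∧ q.1 ≤ G.nu ∧ metricBand V₀ q.1 q.2 θ = E}) ∧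
    -- part i)
    (∀ (n j : ℕ) (θ₀ : EuclideanSpace ℝ (Fin d)), 1 ≤ n → n ≤ G.nu - numFlat V₀ →
      IsLocalExtr (metricBand V₀ n j) θ₀ →
      (∀ k : ℤ, metricBand V₀ n j θ₀ ≠ (Real.pi * k) ^ 2) →
      IsSimpleMetricEigenvalue V₀ O θ₀ (metricBand V₀ n j θ₀) →
      HasEffectiveForm (band V₀ n) θ₀ ∧ HasEffectiveForm (metricBand V₀ n j) θ₀ ∧
      ∀ ω : EuclideanSpace ℝ (Fin d), ‖ω‖ = 1 →
        effectiveForm (metricBand V₀ n j) θ₀ ω =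
          2 * Real.sqrt (metricBand V₀ n j θ₀) / Real.sin (Real.sqrt (metricBand V₀ n j θ₀)) *
            effectiveForm (band V₀ n) θ₀ ω) ∧
    -- part ii)
    (HasEffectiveForm (band V₀ 1) 0 ∧ HasEffectiveForm (metricBand V₀ 1 0) 0 ∧
      -- non-degeneracy
      (∃ M : Matrix (Fin d) (Fin d) ℝ, M.PosDef ∧
        ∀ ω : EuclideanSpace ℝ (Fin d), ‖ω‖ = 1 →
          effectiveForm (metricBand V₀ 1 0) 0 ω = ω.ofLp ⬝ᵥ M.mulVec ω.ofLp) ∧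
      -- identity and upper bounds
      (∀ ω : EuclideanSpace ℝ (Fin d), ‖ω‖ = 1 →
        effectiveForm (metricBand V₀ 1 0) 0 ω = 2 * effectiveForm (band V₀ 1) 0 ω ∧
        effectiveForm (metricBand V₀ 1 0) 0 ω ≤
          2 / (G.totalDeg : ℝ) * ∑ e ∈ bridges V₀ O, pairing V₀ e ω ^ 2 ∧
        ∀ Λ₁ : ℝ,
          IsGreatest (spectrum ℝ ((indexMatrix V₀ (fun e : bridges V₀ O => (e : G.FundEdge))).transpose *
            indexMatrix V₀ (fun e : bridges V₀ O => (e : G.FundEdge)))) Λ₁ →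
          2 / (G.totalDeg : ℝ) * ∑ e ∈ bridges V₀ O, pairing V₀ e ω ^ 2 ≤
            2 * Λ₁ / (G.totalDeg : ℝ)) ∧
      -- existence of `d` bridges with linearly independent indices, and the lower bound
      (∃ b : Fin d → G.FundEdge,
        (∀ s, b s ∈ bridges V₀ O) ∧ LinearIndependent ℝ (indexMatrix V₀ b).row) ∧
      (V₀.IsTree → ∀ b : Fin d → G.FundEdge,
        (∀ s, b s ∈ bridges V₀ O) → LinearIndependent ℝ (indexMatrix V₀ b).row →
        ∀ Λ₀ : ℝ, IsLeast (spectrum ℝ ((indexMatrix V₀ b).transpose * indexMatrix V₀ b)) Λ₀ →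
        ∀ ω : EuclideanSpace ℝ (Fin d), ‖ω‖ = 1 →
          0 < 2 * Λ₀ / (G.totalDeg * G.nu * d : ℝ) ∧
          2 * Λ₀ / (G.totalDeg * G.nu * d : ℝ) ≤ effectiveForm (metricBand V₀ 1 0) 0 ω)) := by
  have hd1 : 1 ≤ d := by omega
  obtain ⟨ha, hE, h2⟩ := metricBand_one_zero_properties hd1 V₀
  have hpos : (0 : ℝ) < G.totalDeg := by exact_mod_cast totalDeg_pos hd1
  have hnorm : ∀ ω : EuclideanSpace ℝ (Fin d), ‖ω‖ = 1 → ∑ i, ω.ofLp i ^ 2 = 1 := fun ω hω => by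
    have := EuclideanSpace.norm_sq_eq ω
    rw [hω] at this
    simpa using this.symm
  refine ⟨fun θ E hk => finrank_metricEigenspace_eq_card hd1 V₀ O θ hk,
    fun n j θ₀ h1 hn hext hk hs => effectiveForm_metricBand hd1 V₀ O h1 hn hext hk hs,
    hasEffectiveForm_band_one hd1 V₀, hE, ?_, fun ω hω => ⟨h2 ω hω, ?_, fun Λ₁ hΛ => ?_⟩,
    exists_linearIndependent_bridges hd1 V₀ O, fun hT b hb hli Λ₀ hΛ ω hω => ?_⟩
  · obtain ⟨M, hM, hMω⟩ := ha.exists_effectiveForm_eq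
    refine ⟨M, Matrix.posDef_of_unit_sphere hM fun ω hω => ?_, fun ω _ => hMω ω⟩
    rw [← hMω, h2 ω hω]
    exact mul_pos two_pos (effectiveForm_band_one_pos hd1 V₀ hω)
  · rw [h2 ω hω]
    have := mul_le_mul_of_nonneg_left (effectiveForm_band_one_le hd1 V₀ O hω) zero_le_two
    refine this.trans (le_of_eq ?_)
    ring
  · have h3 := Matrix.sum_mulVec_sq_le _ hΛ ω.ofLp
    rw [hnorm ω hω, mul_one] at h3
    simp only [indexMatrix_mulVec] at h3
    rw [Finset.sum_coe_sort (bridges V₀ O) fun e => pairing V₀ e ω ^ 2] at h3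
    rw [div_mul_eq_mul_div]
    gcongr
  · have hinj : Function.Injective (indexMatrix V₀ b).mulVec :=
      Matrix.mulVec_injective_iff_isUnit.mpr (Matrix.linearIndependent_rows_iff_isUnit.mp hli)
    have hΛ0 := Matrix.pos_of_mem_spectrum_gram _ hinj hΛ.1
    have hnu : (0 : ℝ) < G.nu := by exact_mod_cast G.nu_pos
    have hd0 : (0 : ℝ) < d := by exact_mod_cast hd1
    refine ⟨by positivity, ?_⟩
    have h3 := Matrix.le_sum_mulVec_sq _ hΛ ω.ofLp
    rw [hnorm ω hω, mul_one] at h3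
    have hne : ∀ s, index V₀ (b s) ≠ 0 := fun s => (mem_bridges.mp (hb s)).2
    choose x hx using fun s => norm_bloch_index_sub_sq_le O hT (hne s)
    -- Each of the d bridges contributes at most ν times half the energy, hence the constant νd. The
    -- left side is |T₀ω|², which is at least Λ₀.
    have h4 := sum_sq_le_effectiveForm hd1 V₀ (fun s => index V₀ (b s)) x (K := G.nu * d)
      (fun θ Y => by
        refine (Finset.sum_le_sum fun s _ => hx s θ Y).trans (le_of_eq ?_)
        rw [Finset.sum_const, Finset.card_univ, Fintype.card_fin, nsmul_eq_mul]
        ring) (by positivity) hω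
    have h5 : Λ₀ ≤ G.nu * d * (G.totalDeg * effectiveForm (band V₀ 1) 0 ω) := h3.trans h4
    rw [h2 ω hω, div_le_iff₀ (by positivity)]
    linarith
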